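/- **Notation.** $\langle x\rangle=1+\|x\|$, $\log_+x=\max\{1,\log x\}$, $B(x;r)$ is the open Euclidean ball, $\mathcal N(h,A,E)$ is the smallest number of balls of radius $h$ of $E$ (with arbitrary centres in $E$) covering $A$. For $\varphi:\mathbb R^d\to(-\infty,+\infty]$ let $\mathrm{dom}(\varphi)=\{\varphi<\infty\}$ and $\varphi^*(y)=\sup_x(\langle x,y\rangle-\varphi(x))$. Let $P$ be a probability measure on $\mathbb R^d$. A *potential* is a function $\varphi:\mathbb R^d\to(-\infty,+\infty]$ with $\varphi(0)=0$ whose domain is open and contains $\mathrm{supp}\,P$. For $\beta,a\ge 0$, it is *$(\beta,a)$-smooth* if it is twice differentiable on its domain with $\|\nabla^2\varphi(x)\|_{\rm op}\le\beta\langle x\rangle^a$ there (for $a=0$, it is also allowed to be merely differentiable with $\beta$-Lipschitz gradient). For $\alpha>0$, it is *$(\alpha,a)$-convex* if its domain is convex and it is twice differentiable there with $\lambda_{\min}(\nabla^2\varphi(x))\ge\alpha\langle x\rangle^a$ (for $a=0$, it is also allowed to be $\alpha$-strongly convex in the usual sense). **Assumptions.** Suppose that: 1. (Poincaré) there is $C<\infty$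 with $\mathrm{Var}_P(f)\le C\int\|\nabla f\|^2\,dP$ for every differentiable $f:\mathbb R^d\to\mathbb R$; 2. (local Poincaré) there are $C,\theta\ge0$, $\kappa>0$ such that for all $R>0$, $0<r\le\kappa\langle R\rangle^{-\theta}$, $x\in\mathrm{supp}(P)\cap B(0;R)$ and every differentiable $f$, $\mathrm{Var}_{P_B}(f)\le C r^2\int\|\nabla f\|^2\,dP_B$, where $P_B$ is $P$ conditioned on $B=B(x;r)$; 3. (local doubling) there are $C,\theta\ge0$, $\kappa>0$ such that $P(B(x;r))\le C\,P(B(x;r/2))$ for all $R>0$, $0<r\le\kappa\langle R\rangle^{-\theta}$ and $x\in\mathrm{supp}(P)\cap B(0;R)$; 4. (covering growth) $m\ge2$ and there are $c,R_0,\varepsilon_0>0$ such that $\mathcal N(\varepsilon,\mathrm{supp}(P)\cap B(0;R),\mathbb R^d)\le(c\varepsilon/R)^{-m}$ for all $R\ge R_0$, $0<\varepsilon\le\varepsilon_0$. Let $\beta,a\ge0$, $\alpha>0$, let $\varphi_0$ be a convex $(\beta,a)$-smooth potential and $Q=(\nabla\varphi_0)_\sharp P$. For a class $\mathcal F$ of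 (not necessarily convex) $(\beta,a)$-smooth potentials, $\overline\varphi\in\mathcal F$, a set $\mathcal G\subseteq\{t\varphi+(1-t)\overline\varphi:\varphi\in\mathcal F,\ 0\le t\le1\}$ (with $0\cdot\infty=0$) of $(\alpha,a)$-convex functions, and $\tau>0$, put $$B_\tau=\{g\in\mathcal G:\|\nabla g-\nabla\overline\varphi\|_{L^2(P)}\le\tau\},\qquad B^*_\tau=\{g^*:g\in\mathcal G,\ \|\nabla g^*-\nabla\overline\varphi^*\|_{L^2(Q)}\le\tau\}.$$ **Conclusion.** (i) There are constants $C,p,q$, depending only on $P,m,\beta,a,\alpha,\varphi_0$, such that for all such $\mathcal F,\overline\varphi,\mathcal G$ and all $0<h<\tau$, $$\log\mathcal N(h,B_\tau,L^2(P))\le C\,\log_+(1/h)^p\,\log_+(1/\tau)^q\,(h/\tau)^{-m}.$$ (ii) For every $K$ there are constants $C,p,q,s$, depending only on $K,P,m,\beta,a,\alpha,\varphi_0$, such that for all such $\mathcal F,\overline\varphi,\mathcal G$ satisfying - $\|\nabla\overline\varphi^*\|_{L^2(Q)}\le K$ or $\|\nabla\overline\varphi^*\|_{L^2(Q)}=\infty$,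 and - every $g\in\mathcal G$ has $\mathrm{dom}(g)=\mathbb R^d$ or $\|\nabla g(0)\|\le K$, and for all $0<h<\tau$, $$\log\mathcal N(h,B^*_\tau,L^2(Q))\le C\,\log_+(1/h)^p\,\log_+(1/\tau)^q\,\log_+(\tau)^s\,(h/\tau)^{-m}.$$ (In (ii), $\nabla\overline\varphi^*$ is read as $0$ where $\overline\varphi^*$ has no gradient; all the $g^*$ are finite and differentiable on $\mathbb R^d$.) -/

import Mathlib

open MeasureTheory ProbabilityTheory Set
open scoped ENNReal NNReal

noncomputable section

namespace Brenier

/-- Euclidean space of dimension `d`. -/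
abbrev Euc (d : ℕ) : Type := EuclideanSpace ℝ (Fin d)

/-- `log₊ x = max {1, log x}`. -/
def logPlus (x : ℝ) : ℝ := max 1 (Real.log x)

/-! ### Conditions on the source measure -/

/-- Poincaré inequality. `evariance` is the variance with values in `[0, ∞]`; for a probability
measure it is `∞` as soon as `f` is not square integrable. -/
def Poincare {d : ℕ} (P : Measure (Euc d)) : Prop :=
  ∃ C : ℝ≥0, ∀ f : Euc d → ℝ, Differentiable ℝ f →
    evariance f P ≤ C * ∫⁻ x, ‖gradient f x‖ₑ ^ 2 ∂P

/-- Local Poincaré inequality: a Poincaré inequality with constant of order `r ^ 2` for `P`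
conditioned on an open ball of radius `r`, where `r ≤ κ (1 + R) ^ (-θ)` and the centre belongs to
the support of `P` and to `B(0; R)`. -/
def LocalPoincare {d : ℕ} (P : Measure (Euc d)) : Prop :=
  ∃ C : ℝ≥0, ∃ θ κ : ℝ, 0 ≤ θ ∧ 0 < κ ∧
    ∀ R : ℝ, 0 < R → ∀ r : ℝ, 0 < r → r ≤ κ * (1 + R) ^ (-θ) →
      ∀ x ∈ P.support ∩ Metric.ball (0 : Euc d) R,
        ∀ f : Euc d → ℝ, Differentiable ℝ f →
          evariance f (ProbabilityTheory.cond P (Metric.ball x r)) ≤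
            C * ENNReal.ofReal (r ^ 2) *
              ∫⁻ z, ‖gradient f z‖ₑ ^ 2 ∂(ProbabilityTheory.cond P (Metric.ball x r))

/-- Local doubling. -/
def LocalDoubling {d : ℕ} (P : Measure (Euc d)) : Prop :=
  ∃ C : ℝ≥0, ∃ θ κ : ℝ, 0 ≤ θ ∧ 0 < κ ∧
    ∀ R : ℝ, 0 < R → ∀ r : ℝ, 0 < r → r ≤ κ * (1 + R) ^ (-θ) →
      ∀ x ∈ P.support ∩ Metric.ball (0 : Euc d) R,
        P (Metric.ball x r) ≤ C * P (Metric.ball x (r / 2))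

/-- The support of `P` has `m`-dimensional covering growth: for all large `R` and small `ε`, at
most `(c ε / R) ^ (-m)` balls of radius `ε` of `ℝ^d` are needed to cover `supp P ∩ B(0; R)`. -/
def SupportGrowth {d : ℕ} (P : Measure (Euc d)) (m : ℝ) : Prop :=
  ∃ c R₀ ε₀ : ℝ, 0 < c ∧ 0 < R₀ ∧ 0 < ε₀ ∧
    ∀ R : ℝ, R₀ ≤ R → ∀ ε : ℝ, 0 < ε → ε ≤ ε₀ →
      ((Metric.externalCoveringNumber ε.toNNReal
          (P.support ∩ Metric.ball (0 : Euc d) R) : ℕ∞) : ℝ≥0∞) ≤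
        ENNReal.ofReal ((c * ε / R) ^ (-m))

/-! ### Potentials: functions with values in `(-∞, ∞]` -/

/-- The domain of an extended real valued function. -/
def edom {d : ℕ} (φ : Euc d → EReal) : Set (Euc d) := {x | φ x < ⊤}

/-- The real values of `φ` (meaningful on the domain). -/
def realPart {d : ℕ} (φ : Euc d → EReal) : Euc d → ℝ := fun x => (φ x).toReal

/-- The gradient of `φ` (meaningful on the domain when it is open). -/
def grad {d : ℕ} (φ : Euc d → EReal) : Euc d → Euc d := gradient (realPart φ)

/-- The Hessian of `φ`, as an operator on `ℝ^d`. -/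
def hess {d : ℕ} (φ : Euc d → EReal) (x : Euc d) : Euc d →L[ℝ] Euc d := fderiv ℝ (grad φ) x

/-- The convex conjugate `φ* (y) = sup_x (⟨x, y⟩ - φ x)`. -/
def conj {d : ℕ} (φ : Euc d → EReal) : Euc d → EReal :=
  fun y => ⨆ x : Euc d, ((inner ℝ x y : ℝ) : EReal) - φ x

/-- A potential for `P`: a function with values in `(-∞, ∞]`, equal to `0` at `0`, whose domain is
open and contains the support of `P`. -/
structure IsPotential {d : ℕ} (P : Measure (Euc d)) (φ : Euc d → EReal) : Prop where
  ne_bot : ∀ x, φ x ≠ ⊥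
  map_zero : φ 0 = 0
  isOpen_edom : IsOpen (edom φ)
  support_subset : P.support ⊆ edom φ

/-- Twice differentiability on the domain. -/
def TwiceDiff {d : ℕ} (φ : Euc d → EReal) : Prop :=
  ∀ x ∈ edom φ, DifferentiableAt ℝ (realPart φ) x ∧ DifferentiableAt ℝ (grad φ) x

/-- `(β, a)`-smoothness: the Hessian is bounded by `β (1 + ‖x‖) ^ a` on the domain. When `a = 0`,
differentiability with a `β`-Lipschitz gradient is allowed as well. -/
def Smooth {d : ℕ} (β a : ℝ) (φ : Euc d → EReal) : Prop :=
  (TwiceDiff φ ∧ ∀ x ∈ edom φ, ‖hess φ x‖ ≤ β * (1 + ‖x‖) ^ a) ∨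
  (a = 0 ∧ (∀ x ∈ edom φ, DifferentiableAt ℝ (realPart φ) x) ∧
    ∀ x ∈ edom φ, ∀ y ∈ edom φ, ‖grad φ x - grad φ y‖ ≤ β * ‖x - y‖)

/-- `(α, a)`-convexity: the domain is convex and the smallest eigenvalue of the Hessian is at least
`α (1 + ‖x‖) ^ a` on it. When `a = 0`, the usual `α`-strong convexity is allowed as well. -/
def StrConvex {d : ℕ} (α a : ℝ) (φ : Euc d → EReal) : Prop :=
  (Convex ℝ (edom φ) ∧ TwiceDiff φ ∧
    ∀ x ∈ edom φ, ∀ v : Euc d, α * (1 + ‖x‖) ^ a * ‖v‖ ^ 2 ≤ inner ℝ (hess φ x v) v) ∨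
  (a = 0 ∧ StrongConvexOn (edom φ) α (realPart φ))

/-- The functions `t φ + (1 - t) φbar` with `φ ∈ F` and `0 ≤ t ≤ 1` (with `0 * ∞ = 0`). -/
def segments {d : ℕ} (F : Set (Euc d → EReal)) (φbar : Euc d → EReal) : Set (Euc d → EReal) :=
  {g | ∃ φ ∈ F, ∃ t : ℝ, 0 ≤ t ∧ t ≤ 1 ∧
    g = fun x => (t : EReal) * φ x + ((1 - t : ℝ) : EReal) * φbar x}

/-! ### Balls and covering numbers -/

/-- The ball of radius `τ` in `G`, centred at `c`, for the pseudo-norm `g ↦ ‖∇g‖_{L²(μ)}`. -/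
def gradBall {d : ℕ} (μ : Measure (Euc d)) (G : Set (Euc d → EReal)) (c : Euc d → EReal)
    (τ : ℝ) : Set (Euc d → EReal) :=
  {g ∈ G | eLpNorm (fun x => grad g x - grad c x) 2 μ ≤ ENNReal.ofReal τ}

/-- The covering number `N(h, A, L²(μ))`: the smallest number of open balls of radius `h` of `L²(μ)`
(with arbitrary centres in `L²(μ)`) that cover `A`; it is `∞` if there is no finite cover. -/
def l2Covering {d : ℕ} (μ : Measure (Euc d)) (h : ℝ) (A : Set (Euc d → EReal)) : ℕ∞ :=
  ⨅ (N : Set (Euc d → ℝ)) (_ : ∀ u ∈ N, MemLp u 2 μ)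
    (_ : ∀ g ∈ A, ∃ u ∈ N, eLpNorm (fun x => realPart g x - u x) 2 μ < ENNReal.ofReal h),
    N.encard

/-- The metric entropy `log N(h, A, L²(μ))`, with values in `[-∞, ∞]`. -/
def l2Entropy {d : ℕ} (μ : Measure (Euc d)) (h : ℝ) (A : Set (Euc d → EReal)) : EReal :=
  ENNReal.log (l2Covering μ h A : ℝ≥0∞)

end Brenier

end

noncomputable section

namespace Brenier

open Filter Topology

/-! Functions are coded by their rounded averages over the cells of a net, and Poincaré inequalities
on the cells show that the code determines the function up to a small `L²` error.

The global Poincaré inequality gives `P` exponential tails (`Poincare.exp_moment`). For functions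
bounded by `M (1 + ‖z‖) ^ k`, everything outside a ball of radius `R`, a constant times `log₊(1/h) +
log M`, is therefore negligible at precision `h`. The support inside this ball is covered by balls
of radius `r` with bounded overlap (`exists_separated_cover`). If two functions have the same
rounded averages, the local Poincaré inequality summed over the balls bounds the square of their
distance by a multiple of `r² T² + δ²` plus the tail, up to powers of `R`; here `T` bounds the `L²`
norms of the gradients and `δ` is the rounding precision. With `δ` of order `h` and `r` of order `h
/ T` up to powers of `R`, `SupportGrowth` leaves `(T / h) ^ m` cells up to logarithms, and each
average costs a logarithm. This is `exists_coded_bound`.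

For (i) it is applied to `g - g₀`, with `g₀` a fixed member of the ball and `T = 2τ`. Since `dom g`
is convex and lies in the domains of the smooth functions that `g` combines, `∇g - ∇g(0)` has
polynomial growth uniformly in the class. If `τ > 1`, the linear part of `g - g₀` is split off: the
remainder has a gradient bounded independently of `τ`, and the linear parts form a `d`-dimensional
family of entropy of order `τ / h ≤ (τ / h) ^ m`.

For (ii), `L²(Q)` is pulled back to `L²(P)` by `∇φ₀`, which is locally Lipschitz with polynomially
growing constant, so that compositions still satisfy local Poincaré inequalities
(`LocalPoincare.exists_comp_grad`). Strong convexity makes `g*` finite with `1/α`-Lipschitz gradient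
and `0 ≤ g*(y) ≤ ‖y - ∇g(0)‖² / (2α)`. It remains to bound `∇g(0)`: by assumption, or through the
minimizer `∇g*(0)` of `g`, which `norm_grad_conj_zero_le` controls linearly in `τ`. The growth
constant is then polynomial in `τ`, whence the factor in `log₊ τ`. -/

lemma norm_gradient_eq {d : ℕ} (f : Euc d → ℝ) (x : Euc d) : ‖gradient f x‖ = ‖fderiv ℝ f x‖ := by
  simp [gradient]

/-! ### Exponential moments from the Poincaré inequality -/

/-- The derivative is bounded on `[0, 1]` by compactness and vanishes elsewhere, where the function
is at its minimum or maximum. -/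
lemma exists_lipschitz_smoothTransition :
    ∃ L : ℝ≥0, LipschitzWith L Real.smoothTransition := by
  have hd : Differentiable ℝ Real.smoothTransition :=
    (Real.smoothTransition.contDiff (n := 1)).differentiable (by norm_num)
  have hc : Continuous (deriv Real.smoothTransition) :=
    (Real.smoothTransition.contDiff (n := 1)).continuous_deriv (by norm_num)
  obtain ⟨M, hM⟩ := (isCompact_Icc (a := (0 : ℝ)) (b := 1)).exists_bound_of_continuousOn
    hc.continuousOn
  refine ⟨M.toNNReal, lipschitzWith_of_nnnorm_deriv_le hd fun x => ?_⟩
  have h0 : 0 ≤ M := (norm_nonneg _).trans (hM 0 (by simp))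
  rw [← NNReal.coe_le_coe, coe_nnnorm, Real.coe_toNNReal _ h0]
  by_cases hx : x ∈ Icc (0 : ℝ) 1
  · exact hM x hx
  · have : deriv Real.smoothTransition x = 0 := by
      rcases lt_or_ge x 0 with h | h
      · apply IsLocalMin.deriv_eq_zero
        refine Eventually.of_forall fun y => ?_
        rw [Real.smoothTransition.zero_of_nonpos h.le]
        exact Real.smoothTransition.nonneg y
      · apply IsLocalMax.deriv_eq_zero
        refine Eventually.of_forall fun y => ?_
        have : 1 ≤ x := by
          by_contra h'
          exact hx ⟨h, by linarith⟩
        rw [Real.smoothTransition.one_of_one_le this]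
        exact Real.smoothTransition.le_one y
    simpa [this] using h0

/-- A smooth radial cutoff which vanishes on `B(0; R)` and is `1` outside `B(0; R + 1)`. -/
def radialStep {d : ℕ} (R : ℝ) (x : Euc d) : ℝ := Real.smoothTransition (‖x‖ - R)

lemma differentiable_radialStep {d : ℕ} {R : ℝ} (hR : 0 < R) :
    Differentiable ℝ (radialStep R : Euc d → ℝ) := by
  intro x
  by_cases hx : x = 0
  · have : (radialStep R : Euc d → ℝ) =ᶠ[𝓝 x] fun _ => 0 := by
      filter_upwards [Metric.ball_mem_nhds x hR] with y hy
      have : ‖y‖ < R := by simpa [hx] using hy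
      exact Real.smoothTransition.zero_of_nonpos (by linarith)
    exact (differentiableAt_const (0 : ℝ)).congr_of_eventuallyEq this
  · have h1 : DifferentiableAt ℝ Real.smoothTransition (‖x‖ - R) :=
      (Real.smoothTransition.contDiff (n := 1)).differentiable (by norm_num) _
    have h2 : DifferentiableAt ℝ (fun y : Euc d => ‖y‖ - R) x :=
      (differentiableAt_id.norm ℝ hx).sub_const R
    exact DifferentiableAt.comp x h1 h2

lemma norm_gradient_radialStep_le {d : ℕ} {R : ℝ} {L : ℝ≥0}
    (hL : LipschitzWith L Real.smoothTransition) (x : Euc d) :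
    ‖gradient (radialStep R) x‖ ≤ (Set.indicator {x : Euc d | R ≤ ‖x‖ ∧ ‖x‖ < R + 1}
      (fun _ => (L : ℝ)) x) := by
  rw [norm_gradient_eq]
  by_cases hx : R ≤ ‖x‖ ∧ ‖x‖ < R + 1
  · rw [indicator_of_mem (by exact hx)]
    apply norm_fderiv_le_of_lipschitz
    refine LipschitzWith.of_dist_le_mul fun y z => ?_
    refine (hL.dist_le_mul _ _).trans ?_
    gcongr
    rw [Real.dist_eq, dist_eq_norm]
    have := abs_norm_sub_norm_le y z
    simpa using this
  · rw [indicator_of_notMem (by exact hx)]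
    have : fderiv ℝ (radialStep R) x = 0 := by
      rcases lt_or_ge ‖x‖ R with h | h
      · apply IsLocalMin.fderiv_eq_zero
        refine Eventually.of_forall fun y => ?_
        simp only [radialStep]
        rw [Real.smoothTransition.zero_of_nonpos (by linarith)]
        exact Real.smoothTransition.nonneg _
      · apply IsLocalMax.fderiv_eq_zero
        refine Eventually.of_forall fun y => ?_
        have : R + 1 ≤ ‖x‖ := by
          by_contra h'
          exact hx ⟨h, by linarith⟩
        simp only [radialStep]
        rw [Real.smoothTransition.one_of_one_le (show 1 ≤ ‖x‖ - R by linarith)]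
        exact Real.smoothTransition.le_one _
    simp [this]

lemma measurableSet_le_norm {d : ℕ} (R : ℝ) : MeasurableSet {x : Euc d | R ≤ ‖x‖} :=
  measurableSet_le measurable_const measurable_norm

/-- Test the inequality on `radialStep R`: its energy only sees the mass of the annulus, while its
variance is at least half of the mass beyond `R + 1`. -/
lemma Poincare.tail_step {d : ℕ} {P : Measure (Euc d)} [IsProbabilityMeasure P]
    (hP : Poincare P) : ∃ A : ℝ, 1 ≤ A ∧ ∀ R : ℝ, 0 < R → P.real {x | R ≤ ‖x‖} ≤ 1 / 2 →
      P.real {x | R + 1 ≤ ‖x‖} ≤ A * (P.real {x | R ≤ ‖x‖} - P.real {x | R + 1 ≤ ‖x‖}) := by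
  obtain ⟨C, hC⟩ := hP
  obtain ⟨L, hL⟩ := exists_lipschitz_smoothTransition
  refine ⟨max 1 (2 * C * L ^ 2), le_max_left _ _, fun R hR hu => ?_⟩
  have hsub : {x : Euc d | R + 1 ≤ ‖x‖} ⊆ {x | R ≤ ‖x‖} := fun x (hx : R + 1 ≤ ‖x‖) => by
    show R ≤ ‖x‖
    linarith
  have hmono : P.real {x | R + 1 ≤ ‖x‖} ≤ P.real {x | R ≤ ‖x‖} := measureReal_mono hsub
  set f : Euc d → ℝ := radialStep R with hf
  have hfd := differentiable_radialStep (d := d) hR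
  have hf0 : ∀ x, 0 ≤ f x := fun x => Real.smoothTransition.nonneg _
  have hf1 : ∀ x, f x ≤ 1 := fun x => Real.smoothTransition.le_one _
  have hmem : MemLp f 2 P := MemLp.of_bound hfd.continuous.aestronglyMeasurable 1
    (ae_of_all _ fun x => by rw [Real.norm_eq_abs, abs_of_nonneg (hf0 x)]; exact hf1 x)
  set μ := P[f] with hμ
  have hdiff : P.real {x | R ≤ ‖x‖ ∧ ‖x‖ < R + 1} =
      P.real {x | R ≤ ‖x‖} - P.real {x | R + 1 ≤ ‖x‖} := by
    rw [← measureReal_sdiff hsub (measurableSet_le_norm _)]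
    congr 1
    ext x
    simp
  have h1 := hC f hfd
  have hlow : P.real {x | R + 1 ≤ ‖x‖} / 2 ≤ variance f P := by
    rw [variance_eq_integral hmem.aestronglyMeasurable.aemeasurable]
    have hint : Integrable (fun x => (f x - μ) ^ 2) P := by
      simpa using (hmem.sub (memLp_const μ)).integrable_sq
    have hle : ∫ x, ({x : Euc d | R ≤ ‖x‖}ᶜ.indicator (fun _ => μ ^ 2) x +
        {x : Euc d | R + 1 ≤ ‖x‖}.indicator (fun _ => (1 - μ) ^ 2) x) ∂P ≤
        ∫ x, (f x - μ) ^ 2 ∂P := by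
      refine integral_mono ?_ hint fun x => ?_
      · exact ((integrable_const _).indicator (measurableSet_le_norm _).compl).add
          ((integrable_const _).indicator (measurableSet_le_norm _))
      · by_cases ha : R ≤ ‖x‖ <;> by_cases hb : R + 1 ≤ ‖x‖
        · have : f x = 1 := Real.smoothTransition.one_of_one_le (by linarith)
          simp [ha, hb, this]
        · simp [ha, hb]; positivity
        · linarith
        · have : f x = 0 := Real.smoothTransition.zero_of_nonpos (by linarith)
          simp [ha, hb, this]
    rw [integral_add ((integrable_const _).indicator (measurableSet_le_norm _).compl)
      ((integrable_const _).indicator (measurableSet_le_norm _)),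
      integral_indicator_const _ (measurableSet_le_norm _).compl,
      integral_indicator_const _ (measurableSet_le_norm _),
      probReal_compl_eq_one_sub (measurableSet_le_norm _)] at hle
    refine le_trans ?_ hle
    simp only [smul_eq_mul]
    have h0 : 0 ≤ P.real {x | R + 1 ≤ ‖x‖} := measureReal_nonneg
    -- Both sides of the step carry at least the outer mass, and `μ² + (1 - μ)² ≥ 1/2` whatever the
    -- mean `μ` is.
    have h2 : P.real {x | R + 1 ≤ ‖x‖} ≤ 1 - P.real {x | R ≤ ‖x‖} := by linarith
    nlinarith [mul_le_mul_of_nonneg_right h2 (sq_nonneg μ),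
      mul_nonneg h0 (sq_nonneg (2 * μ - 1))]
  have hupp : variance f P ≤ C * L ^ 2 * P.real {x | R ≤ ‖x‖ ∧ ‖x‖ < R + 1} := by
    have hms : MeasurableSet {x : Euc d | R ≤ ‖x‖ ∧ ‖x‖ < R + 1} :=
      (measurableSet_le_norm R).inter (measurableSet_lt measurable_norm measurable_const)
    have : evariance f P ≤ C * (L ^ 2 * P {x | R ≤ ‖x‖ ∧ ‖x‖ < R + 1}) := by
      refine h1.trans ?_
      gcongr
      rw [← lintegral_indicator_const hms]
      refine lintegral_mono fun x => ?_
      have := norm_gradient_radialStep_le (R := R) hL x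
      by_cases hx : x ∈ {x : Euc d | R ≤ ‖x‖ ∧ ‖x‖ < R + 1}
      · rw [indicator_of_mem hx] at this ⊢
        gcongr
        rw [← ofReal_norm]
        exact (ENNReal.ofReal_le_ofReal this).trans_eq (ENNReal.ofReal_coe_nnreal)
      · rw [indicator_of_notMem hx] at this ⊢
        have h0 : gradient (radialStep R) x = 0 := by simpa using this
        show ‖gradient (radialStep R) x‖ₑ ^ 2 ≤ 0
        simp [h0]
    have h3 := ENNReal.toReal_mono (by finiteness) this
    simpa [variance, Measure.real, mul_assoc] using h3
  rw [hdiff] at hupp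
  have : P.real {x | R + 1 ≤ ‖x‖} ≤
      2 * C * L ^ 2 * (P.real {x | R ≤ ‖x‖} - P.real {x | R + 1 ≤ ‖x‖}) := by linarith
  refine this.trans ?_
  exact mul_le_mul_of_nonneg_right (le_max_right _ _) (by linarith)

/-- Solving `v ≤ A (u - v)` for `v` contracts the tail by `A / (1 + A)` per unit of radius, from a
radius beyond which at most half of the mass lies. -/
lemma Poincare.tail {d : ℕ} {P : Measure (Euc d)} [IsProbabilityMeasure P]
    (hP : Poincare P) : ∃ R₀ ρ : ℝ, 0 < R₀ ∧ 0 < ρ ∧ ρ < 1 ∧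
      ∀ n : ℕ, P.real {x | R₀ + n ≤ ‖x‖} ≤ ρ ^ n := by
  obtain ⟨A, hA, hstep⟩ := hP.tail_step
  have hlim : ∃ R₀ : ℝ, 0 < R₀ ∧ P.real {x | R₀ ≤ ‖x‖} ≤ 1 / 2 := by
    have ht : Tendsto (fun n : ℕ => P {x : Euc d | (n : ℝ) ≤ ‖x‖}) atTop (𝓝 (P (⋂ n : ℕ,
        {x : Euc d | (n : ℝ) ≤ ‖x‖}))) := by
      refine tendsto_measure_iInter_atTop (fun n => (measurableSet_le_norm _).nullMeasurableSet)
        ?_ ⟨0, by finiteness⟩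
      intro i j hij x (hx : (j : ℝ) ≤ ‖x‖)
      exact le_trans (by exact_mod_cast hij) hx
    have he : (⋂ n : ℕ, {x : Euc d | (n : ℝ) ≤ ‖x‖}) = ∅ := by
      ext x
      simp only [mem_iInter, mem_ofPred_eq, mem_empty_iff_false, iff_false, not_forall, not_le]
      exact exists_nat_gt _
    rw [he, measure_empty] at ht
    have := ht.eventually (gt_mem_nhds (show (0 : ℝ≥0∞) < ENNReal.ofReal (1 / 2) by simp))
    obtain ⟨n, hn, hn1⟩ := (this.and (eventually_gt_atTop 0)).exists
    refine ⟨n, by exact_mod_cast hn1, ?_⟩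
    exact ENNReal.toReal_le_of_le_ofReal (by norm_num) hn.le
  obtain ⟨R₀, hR₀, hhalf⟩ := hlim
  refine ⟨R₀, A / (1 + A), hR₀, by positivity, by rw [div_lt_one (by positivity)]; linarith,
    fun n => ?_⟩
  induction n with
  | zero => simp
  | succ k ih =>
    have hle : P.real {x : Euc d | R₀ + k ≤ ‖x‖} ≤ 1 / 2 := by
      refine le_trans (measureReal_mono ?_) hhalf
      intro x (hx : R₀ + k ≤ ‖x‖)
      show R₀ ≤ ‖x‖
      have : (0 : ℝ) ≤ k := k.cast_nonneg
      linarith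
    have := hstep (R₀ + k) (by positivity) hle
    have heq : R₀ + k + 1 = R₀ + ((k + 1 : ℕ) : ℝ) := by push_cast; ring
    rw [heq] at this
    rw [pow_succ]
    have h2 : P.real {x : Euc d | R₀ + ((k + 1 : ℕ) : ℝ) ≤ ‖x‖} ≤
        P.real {x : Euc d | R₀ + k ≤ ‖x‖} * (A / (1 + A)) := by
      rw [mul_div_assoc', le_div_iff₀ (by positivity)]
      linarith
    refine h2.trans ?_
    gcongr

/-- A Poincaré inequality implies exponential moments. -/
lemma Poincare.exp_moment {d : ℕ} {P : Measure (Euc d)} [IsProbabilityMeasure P]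
    (hP : Poincare P) : ∃ c : ℝ, 0 < c ∧ ∫⁻ x, ENNReal.ofReal (Real.exp (c * ‖x‖)) ∂P ≠ ⊤ := by
  obtain ⟨R₀, ρ, hR₀, hρ, hρ1, htail⟩ := hP.tail
  have hc : 0 < -Real.log ρ / 2 := by
    have := Real.log_neg hρ hρ1
    linarith
  set c := -Real.log ρ / 2 with hcdef
  refine ⟨c, hc, ?_⟩
  -- The choice of `c` makes this product equal to `√ρ`.
  have hexp : Real.exp c * ρ < 1 := by
    have : ρ = Real.exp (Real.log ρ) := (Real.exp_log hρ).symm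
    rw [this, ← Real.exp_add]
    rw [Real.exp_lt_one_iff, hcdef]
    linarith [Real.log_neg hρ hρ1]
  set K := ENNReal.ofReal (Real.exp (c * (R₀ + 1)))
  have hpt : ∀ x : Euc d, ENNReal.ofReal (Real.exp (c * ‖x‖)) ≤
      K * (1 + ∑' n : ℕ, {x : Euc d | R₀ + n ≤ ‖x‖}.indicator
        (fun _ => ENNReal.ofReal (Real.exp c ^ n)) x) := by
    intro x
    rcases lt_or_ge ‖x‖ R₀ with h | h
    · refine le_trans ?_ (mul_le_mul_right (le_self_add : (1 : ℝ≥0∞) ≤ _) K)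
      rw [mul_one]
      apply ENNReal.ofReal_le_ofReal
      apply Real.exp_le_exp.2
      gcongr
      linarith
    · set n := ⌊‖x‖ - R₀⌋₊ with hn
      have h1 : (n : ℝ) ≤ ‖x‖ - R₀ := Nat.floor_le (by linarith)
      have h2 : ‖x‖ - R₀ < n + 1 := Nat.lt_floor_add_one _
      have h3 : ENNReal.ofReal (Real.exp c ^ n) ≤ ∑' n : ℕ, {x : Euc d | R₀ + n ≤ ‖x‖}.indicator
          (fun _ => ENNReal.ofReal (Real.exp c ^ n)) x := by
        refine le_trans ?_ (ENNReal.le_tsum n)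
        rw [indicator_of_mem (show x ∈ {x : Euc d | R₀ + n ≤ ‖x‖} by
          show R₀ + n ≤ ‖x‖; linarith)]
      refine le_trans ?_ (mul_le_mul_right (h3.trans le_add_self) K)
      rw [← ENNReal.ofReal_mul (Real.exp_nonneg _), ← Real.exp_nat_mul, ← Real.exp_add]
      apply ENNReal.ofReal_le_ofReal
      apply Real.exp_le_exp.2
      nlinarith
  refine ne_top_of_le_ne_top ?_ (lintegral_mono hpt)
  have hms : ∀ n : ℕ, Measurable ({x : Euc d | R₀ + n ≤ ‖x‖}.indicator
      (fun _ => ENNReal.ofReal (Real.exp c ^ n))) := fun n =>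
    measurable_const.indicator (measurableSet_le_norm _)
  rw [lintegral_const_mul' _ _ (show K ≠ ⊤ from ENNReal.ofReal_ne_top),
    lintegral_add_left measurable_const, lintegral_tsum fun n => (hms n).aemeasurable]
  have hsum : ∑' n : ℕ, ∫⁻ x, {x : Euc d | R₀ + n ≤ ‖x‖}.indicator
      (fun _ => ENNReal.ofReal (Real.exp c ^ n)) x ∂P ≤
      ∑' n : ℕ, ENNReal.ofReal ((Real.exp c * ρ) ^ n) := by
    refine ENNReal.tsum_le_tsum fun n => ?_
    rw [lintegral_indicator_const (measurableSet_le_norm _), mul_pow,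
      ENNReal.ofReal_mul (by positivity)]
    gcongr
    rw [← ofReal_measureReal]
    exact ENNReal.ofReal_le_ofReal (htail n)
  have hfin : ∑' n : ℕ, ENNReal.ofReal ((Real.exp c * ρ) ^ n) ≠ ⊤ :=
    (summable_geometric_of_lt_one (by positivity) hexp).tsum_ofReal_ne_top
  have := ne_top_of_le_ne_top hfin hsum
  exact ENNReal.mul_ne_top ENNReal.ofReal_ne_top (ENNReal.add_ne_top.2 ⟨by simp, this⟩)

/-- Half of the exponential rate absorbs the polynomial weight, the other half becomes decay in `R`.
-/
lemma exists_tail_bound {d : ℕ} {P : Measure (Euc d)}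
    (hexp : ∃ c : ℝ, 0 < c ∧ ∫⁻ x, ENNReal.ofReal (Real.exp (c * ‖x‖)) ∂P ≠ ⊤) (k : ℝ) :
    ∃ A c : ℝ, 0 < A ∧ 0 < c ∧ ∀ R : ℝ,
      ∫⁻ x in {x | R ≤ ‖x‖}, ENNReal.ofReal ((1 + ‖x‖) ^ k) ∂P ≤
        ENNReal.ofReal (A * Real.exp (-(c * R))) := by
  obtain ⟨c, hc, hI⟩ := hexp
  set I := ∫⁻ x, ENNReal.ofReal (Real.exp (c * ‖x‖)) ∂P
  -- A positive exponent is needed to compare with the exponential; `k` may have any sign.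
  set j := max k 1 with hj
  have hj0 : 0 < j := lt_of_lt_of_le one_pos (le_max_right _ _)
  set B : ℝ := (2 * j / c) ^ j * Real.exp (c / 2) with hB
  have hB0 : 0 < B := by positivity
  have hpt : ∀ R t : ℝ, 0 ≤ t → R ≤ t →
      (1 + t) ^ k ≤ B * Real.exp (-(c / 2 * R)) * Real.exp (c * t) := by
    intro R t ht hRt
    have h1 : (1 + t) ^ k ≤ (1 + t) ^ j :=
      Real.rpow_le_rpow_of_exponent_le (by linarith) (le_max_left _ _)
    have h2 : (1 + t) * (c / (2 * j)) ≤ Real.exp ((1 + t) * (c / (2 * j))) := by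
      linarith [Real.add_one_le_exp ((1 + t) * (c / (2 * j)))]
    have h3 : 1 + t ≤ (2 * j / c) * Real.exp ((1 + t) * (c / (2 * j))) := by
      calc 1 + t = (2 * j / c) * ((1 + t) * (c / (2 * j))) := by field_simp
        _ ≤ _ := by gcongr
    have h4 : (1 + t) ^ j ≤ (2 * j / c) ^ j * Real.exp ((1 + t) * (c / 2)) := by
      calc (1 + t) ^ j ≤ ((2 * j / c) * Real.exp ((1 + t) * (c / (2 * j)))) ^ j := by gcongr
        _ = (2 * j / c) ^ j * Real.exp ((1 + t) * (c / 2)) := by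
          rw [Real.mul_rpow (by positivity) (by positivity), ← Real.exp_mul]
          congr 2
          field_simp
    refine h1.trans (h4.trans ?_)
    rw [hB, mul_assoc, mul_assoc, ← Real.exp_add, ← Real.exp_add]
    gcongr
    nlinarith
  refine ⟨B * (I.toReal + 1), c / 2, by positivity, by positivity, fun R => ?_⟩
  calc ∫⁻ x in {x | R ≤ ‖x‖}, ENNReal.ofReal ((1 + ‖x‖) ^ k) ∂P
      ≤ ∫⁻ x in {x | R ≤ ‖x‖}, ENNReal.ofReal (B * Real.exp (-(c / 2 * R))) *
          ENNReal.ofReal (Real.exp (c * ‖x‖)) ∂P := by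
        refine setLIntegral_mono' (measurableSet_le_norm R) fun x hx => ?_
        rw [← ENNReal.ofReal_mul (by positivity)]
        exact ENNReal.ofReal_le_ofReal (hpt R ‖x‖ (norm_nonneg _) hx)
    _ ≤ ∫⁻ x, ENNReal.ofReal (B * Real.exp (-(c / 2 * R))) *
          ENNReal.ofReal (Real.exp (c * ‖x‖)) ∂P := setLIntegral_le_lintegral _ _
    _ = ENNReal.ofReal (B * Real.exp (-(c / 2 * R))) * I :=
        lintegral_const_mul' _ _ ENNReal.ofReal_ne_top
    _ ≤ ENNReal.ofReal (B * Real.exp (-(c / 2 * R))) * ENNReal.ofReal (I.toReal + 1) := by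
        gcongr
        rw [← ENNReal.ofReal_toReal hI]
        simp only [ENNReal.toReal_ofReal ENNReal.toReal_nonneg]
        exact ENNReal.ofReal_le_ofReal (by linarith)
    _ = _ := by
        rw [← ENNReal.ofReal_mul (by positivity)]
        congr 1
        ring

lemma lintegral_rpow_ne_top {d : ℕ} {P : Measure (Euc d)}
    (hexp : ∃ c : ℝ, 0 < c ∧ ∫⁻ x, ENNReal.ofReal (Real.exp (c * ‖x‖)) ∂P ≠ ⊤) (k : ℝ) :
    ∫⁻ x, ENNReal.ofReal ((1 + ‖x‖) ^ k) ∂P ≠ ⊤ := by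
  obtain ⟨A, c, -, -, h⟩ := exists_tail_bound hexp k
  have h0 := h 0
  have : {x : Euc d | 0 ≤ ‖x‖} = univ := by ext; simp
  rw [this, Measure.restrict_univ] at h0
  exact ne_top_of_le_ne_top ENNReal.ofReal_ne_top h0

/-! ### Covers with bounded overlap and comparison on one cell -/

-- The centres form a maximal `r/2`-separated subset. Maximality gives the cover, separation bounds
-- the cardinality by the external covering number at scale `r/4`, and the overlap is bounded by the
-- geometry of `ℝ^d` alone.
open Classical in
lemma exists_separated_cover {d : ℕ} {A : Set (Euc d)} {r : ℝ} (hr : 0 < r) {n : ℝ}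
    (hn : ((Metric.externalCoveringNumber (r / 4).toNNReal A : ℕ∞) : ℝ≥0∞) ≤ ENNReal.ofReal n)
    (hn0 : 0 ≤ n) :
    ∃ S : Finset (Euc d), ↑S ⊆ A ∧ (S.card : ℝ) ≤ n ∧ (A ⊆ ⋃ x ∈ S, Metric.ball x r) ∧
      ∀ z, (S.filter fun x => z ∈ Metric.ball x r).card ≤ 5 ^ d := by
  set ε : ℝ≥0 := (r / 4).toNNReal with hε
  have hεr : (ε : ℝ) = r / 4 := Real.coe_toNNReal _ (by positivity)
  have hpc := Metric.packingNumber_two_mul_le_externalCoveringNumber ε A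
  have hle : ((Metric.packingNumber (2 * ε) A : ℕ∞) : ℝ≥0∞) ≤ ENNReal.ofReal n :=
    le_trans (by exact_mod_cast hpc) hn
  have hfin : Metric.packingNumber (2 * ε) A ≠ ⊤ := by
    intro h
    rw [h] at hle
    simp at hle
  set S := Metric.maximalSeparatedSet (2 * ε) A with hS
  have hcard : S.encard = Metric.packingNumber (2 * ε) A := Metric.encard_maximalSeparatedSet hfin
  have hSf : S.Finite := by
    rw [← Set.encard_ne_top_iff, hcard]
    exact hfin
  have hdist : ∀ x y : Euc d, (((2 * ε : ℝ≥0) : ℝ≥0∞) < edist x y ↔ r / 2 < dist x y) := by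
    intro x y
    rw [edist_dist, ENNReal.lt_ofReal_iff_toReal_lt ENNReal.coe_ne_top]
    have : (((2 * ε : ℝ≥0) : ℝ≥0∞)).toReal = r / 2 := by
      rw [ENNReal.coe_toReal]; push_cast; rw [hεr]; ring
    rw [this]
  refine ⟨hSf.toFinset, by simpa using Metric.maximalSeparatedSet_subset, ?_, ?_, fun z => ?_⟩
  · rw [← hcard, hSf.encard_eq_coe_toFinset_card] at hle
    have := ENNReal.toReal_le_of_le_ofReal hn0 hle
    simpa using this
  · intro x hx
    obtain ⟨y, hy, hxy⟩ := Metric.isCover_maximalSeparatedSet hfin hx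
    simp only [mem_iUnion]
    refine ⟨y, by simpa using hy, ?_⟩
    have h1 : ¬ (((2 * ε : ℝ≥0) : ℝ≥0∞) < edist x y) := not_lt.2 hxy
    rw [hdist] at h1
    rw [Metric.mem_ball]
    linarith
  · set U := hSf.toFinset.filter fun x => z ∈ Metric.ball x r
    set φ : Euc d → Euc d := fun x => (2 / r) • (x - z) with hφ
    have hφd : ∀ x y, ‖φ x - φ y‖ = 2 / r * dist x y := by
      intro x y
      rw [hφ, dist_eq_norm, ← smul_sub, norm_smul, Real.norm_of_nonneg (by positivity)]
      congr 2
      abel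
    have hinj : Set.InjOn φ U := by
      intro x _ y _ hxy
      have := hφd x y
      rw [hxy, sub_self, norm_zero] at this
      have h2 : (2 / r) ≠ 0 := by positivity
      have h3 : dist x y = 0 := by
        rcases mul_eq_zero.1 this.symm with h | h
        · exact absurd h h2
        · exact h
      exact dist_eq_zero.1 h3
    have hφz : ∀ x, ‖φ x‖ = 2 / r * dist x z := by
      intro x
      rw [← hφd x z]; simp [hφ]
    rw [← Finset.card_image_of_injOn hinj]
    -- After scaling by `2 / r`, the centres of the balls containing `z` are `1`-separated points of
    -- a ball of radius `2`.
    have := Besicovitch.card_le_of_separated (E := Euc d) (U.image φ) ?_ ?_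
    · simpa using this
    · intro c hc
      obtain ⟨x, hx, rfl⟩ := Finset.mem_image.1 hc
      have hx2 : dist x z < r := by
        rw [dist_comm]; exact (Finset.mem_filter.1 hx).2
      rw [hφz]
      calc 2 / r * dist x z ≤ 2 / r * r := by gcongr
        _ = 2 := by field_simp
    · intro c hc c' hc' hne
      obtain ⟨x, hx, rfl⟩ := Finset.mem_image.1 hc
      obtain ⟨y, hy, rfl⟩ := Finset.mem_image.1 hc'
      have hxy : x ≠ y := fun h => hne (by rw [h])
      have := Metric.isSeparated_maximalSeparatedSet (ε := 2 * ε) (A := A)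
        (show x ∈ S by simpa using (Finset.mem_filter.1 hx).1)
        (show y ∈ S by simpa using (Finset.mem_filter.1 hy).1) hxy
      have := (hdist x y).1 this
      rw [hφd]
      calc (1 : ℝ) = 2 / r * (r / 2) := by field_simp
        _ ≤ _ := by gcongr

open Classical in
lemma sum_setLIntegral_le_of_overlap {d : ℕ} {P : Measure (Euc d)} {S : Finset (Euc d)} {r : ℝ}
    {N : ℕ} (hN : ∀ z, (S.filter fun x => z ∈ Metric.ball x r).card ≤ N) {E : Euc d → ℝ≥0∞}
    (hE : Measurable E) :
    ∑ x ∈ S, ∫⁻ z in Metric.ball x r, E z ∂P ≤ N * ∫⁻ z, E z ∂P := by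
  have h1 : ∀ x ∈ S, ∫⁻ z in Metric.ball x r, E z ∂P =
      ∫⁻ z, (Metric.ball x r).indicator E z ∂P := fun x _ =>
    (lintegral_indicator Metric.isOpen_ball.measurableSet _).symm
  rw [Finset.sum_congr rfl h1,
    ← lintegral_finsetSum _ fun x _ => hE.indicator Metric.isOpen_ball.measurableSet,
    ← lintegral_const_mul _ hE]
  refine lintegral_mono fun z => ?_
  calc ∑ x ∈ S, (Metric.ball x r).indicator E z
      = ∑ x ∈ S.filter fun x => z ∈ Metric.ball x r, E z := by
        rw [Finset.sum_filter]
        exact Finset.sum_congr rfl fun x _ => by simp [indicator]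
    _ = ((S.filter fun x => z ∈ Metric.ball x r).card : ℝ≥0∞) * E z := by simp
    _ ≤ _ := by
        gcongr
        exact hN z

lemma enorm_add_add_sq_le (a b c : ℝ) : ‖a + b + c‖ₑ ^ 2 ≤ 3 * (‖a‖ₑ ^ 2 + ‖b‖ₑ ^ 2 + ‖c‖ₑ ^ 2) := by
  have key : ∀ x : ℝ, ‖x‖ₑ ^ 2 = ENNReal.ofReal (x ^ 2) := fun x => by
    rw [← ofReal_norm, ← ENNReal.ofReal_pow (norm_nonneg _), Real.norm_eq_abs, sq_abs]
  rw [key, key, key, key, ← ENNReal.ofReal_add (by positivity) (by positivity),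
    ← ENNReal.ofReal_add (by positivity) (by positivity),
    show (3 : ℝ≥0∞) = ENNReal.ofReal 3 by simp, ← ENNReal.ofReal_mul (by positivity)]
  apply ENNReal.ofReal_le_ofReal
  nlinarith [sq_nonneg (a - b), sq_nonneg (b - c), sq_nonneg (a - c)]

/-- Integral of a function over a ball in terms of the conditioned measure. -/
lemma setLIntegral_eq_mul_cond {d : ℕ} {P : Measure (Euc d)} [IsFiniteMeasure P] {B : Set (Euc d)}
    (hB : P B ≠ 0) (f : Euc d → ℝ≥0∞) :
    ∫⁻ z in B, f z ∂P = P B * ∫⁻ z, f z ∂(ProbabilityTheory.cond P B) := by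
  rw [ProbabilityTheory.cond, lintegral_smul_measure, smul_eq_mul, ← mul_assoc,
    ENNReal.mul_inv_cancel hB (measure_ne_top _ _), one_mul]

/-- `F - F'` splits into the two fluctuations about the means on `B`, which the variance bounds
control, and the difference of the means. -/
lemma setLIntegral_sub_sq_le {d : ℕ} {P : Measure (Euc d)} [IsFiniteMeasure P] {B : Set (Euc d)}
    (hB : P B ≠ 0) {F F' : Euc d → ℝ} (hF : AEStronglyMeasurable F P)
    {E E' : Euc d → ℝ≥0∞} {K : ℝ≥0∞}
    (hE : evariance F (ProbabilityTheory.cond P B) ≤ K * ∫⁻ z, E z ∂(ProbabilityTheory.cond P B))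
    (hE' : evariance F' (ProbabilityTheory.cond P B) ≤
      K * ∫⁻ z, E' z ∂(ProbabilityTheory.cond P B)) {δ : ℝ}
    (hδ : |(ProbabilityTheory.cond P B)[F] - (ProbabilityTheory.cond P B)[F']| ≤ δ) :
    ∫⁻ z in B, ‖F z - F' z‖ₑ ^ 2 ∂P ≤
      3 * (K * ∫⁻ z in B, E z ∂P + ENNReal.ofReal (δ ^ 2) * P B + K * ∫⁻ z in B, E' z ∂P) := by
  set Q := ProbabilityTheory.cond P B with hQ
  have : IsProbabilityMeasure Q := ProbabilityTheory.cond_isProbabilityMeasure hB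
  have hQP : Q ≪ P := ProbabilityTheory.cond_absolutelyContinuous
  have hFQ : AEMeasurable F Q := hF.aemeasurable.mono_ac hQP
  rw [setLIntegral_eq_mul_cond hB, setLIntegral_eq_mul_cond hB, setLIntegral_eq_mul_cond hB]
  set c := Q[F]
  set c' := Q[F']
  have hδ0 : 0 ≤ δ := (abs_nonneg _).trans hδ
  have h1 : ∫⁻ z, ‖F z - F' z‖ₑ ^ 2 ∂Q ≤ 3 * (evariance F Q + ENNReal.ofReal (δ ^ 2) +
      evariance F' Q) := by
    calc ∫⁻ z, ‖F z - F' z‖ₑ ^ 2 ∂Q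
        ≤ ∫⁻ z, 3 * (‖F z - c‖ₑ ^ 2 + ENNReal.ofReal (δ ^ 2) + ‖F' z - c'‖ₑ ^ 2) ∂Q := by
          refine lintegral_mono fun z => ?_
          have e1 : F z - F' z = (F z - c) + (c - c') + -(F' z - c') := by ring
          rw [e1]
          refine (enorm_add_add_sq_le _ _ _).trans ?_
          rw [enorm_neg]
          gcongr
          rw [← ofReal_norm, ← ENNReal.ofReal_pow (norm_nonneg _)]
          apply ENNReal.ofReal_le_ofReal
          gcongr
          exact hδ
      _ = _ := by
          rw [lintegral_const_mul' _ _ (by simp), lintegral_add_left' (by fun_prop),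
            lintegral_add_left' (by fun_prop)]
          simp [evariance, c, c']
  calc P B * ∫⁻ z, ‖F z - F' z‖ₑ ^ 2 ∂Q
      ≤ P B * (3 * (K * ∫⁻ z, E z ∂Q + ENNReal.ofReal (δ ^ 2) + K * ∫⁻ z, E' z ∂Q)) := by
        gcongr
        refine h1.trans ?_
        gcongr
    _ = _ := by ring

/-! ### Coding by rounded local averages -/

/-- The family `u` takes at most `exp n` codes, and members of the family with the same code are at
distance at most `h` in `L²(P)`. -/
def Coded {d : ℕ} (P : Measure (Euc d)) {X : Type} (u : X → Euc d → ℝ) (h n : ℝ) : Prop :=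
  ∃ (ι : Type) (_ : Fintype ι) (code : X → ι), (Fintype.card ι : ℝ) ≤ Real.exp n ∧
    ∀ x y, code x = code y → eLpNorm (u x - u y) 2 P ≤ ENNReal.ofReal h

lemma Coded.mono {d : ℕ} {P : Measure (Euc d)} {X : Type} {u : X → Euc d → ℝ} {h n n' : ℝ}
    (hu : Coded P u h n) (hn : n ≤ n') : Coded P u h n' := by
  obtain ⟨ι, hι, code, hc, hd⟩ := hu
  exact ⟨ι, hι, code, hc.trans (Real.exp_le_exp.2 hn), hd⟩

lemma Coded.add {d : ℕ} {P : Measure (Euc d)} {X : Type} {u v : X → Euc d → ℝ} {h h' n n' : ℝ}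
    (hu : Coded P u h n) (hv : Coded P v h' n') (hh : 0 ≤ h) (hh' : 0 ≤ h')
    (hum : ∀ x, AEStronglyMeasurable (u x) P) (hvm : ∀ x, AEStronglyMeasurable (v x) P) :
    Coded P (u + v) (h + h') (n + n') := by
  obtain ⟨ι, hι, code, hc, hd⟩ := hu
  obtain ⟨ι', hι', code', hc', hd'⟩ := hv
  refine ⟨ι × ι', inferInstance, fun x => (code x, code' x), ?_, fun x y hxy => ?_⟩
  · rw [Fintype.card_prod, Nat.cast_mul, Real.exp_add]
    gcongr
  · simp only [Prod.mk.injEq] at hxy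
    have e : (u + v) x - (u + v) y = (u x - u y) + (v x - v y) := by
      simp only [Pi.add_apply]; abel
    rw [e, ENNReal.ofReal_add hh hh']
    exact (eLpNorm_add_le ((hum x).sub (hum y)) ((hvm x).sub (hvm y)) (by norm_num)).trans
      (add_le_add (hd x y hxy.1) (hd' x y hxy.2))

/-- One representative for each attained code serves as a centre. Precision `h / 2` is required
because the covering balls are open. -/
lemma Coded.l2Entropy_le {d : ℕ} {P : Measure (Euc d)} {A : Set (Euc d → EReal)} {h n : ℝ}
    (hh : 0 < h) (hm : ∀ g ∈ A, MemLp (realPart g) 2 P)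
    (hA : Coded P (fun g : A => realPart g.1) (h / 2) n) : l2Entropy P h A ≤ (n : EReal) := by
  classical
  obtain ⟨ι, hι, code, hc, hd⟩ := hA
  have hcov : l2Covering P h A ≤ (Fintype.card ι : ℕ∞) := by
    set N : Set (Euc d → ℝ) := Set.range fun i : Set.range code => realPart (i.2.choose).1
    have hN : N.encard ≤ (Fintype.card ι : ℕ∞) := by
      calc N.encard ≤ (univ : Set (Set.range code)).encard := by
            simp only [N, ← Set.image_univ]; exact Set.encard_image_le _ _
        _ = (Set.range code).encard := Set.encard_univ _
        _ ≤ (univ : Set ι).encard := Set.encard_le_encard (subset_univ _)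
        _ = _ := by simp
    refine le_trans ?_ hN
    refine iInf_le_of_le N (iInf_le_of_le ?_ (iInf_le_of_le ?_ le_rfl))
    · rintro _ ⟨i, rfl⟩
      exact hm _ (i.2.choose).2
    · intro g hg
      set i : Set.range code := ⟨code ⟨g, hg⟩, mem_range_self _⟩
      refine ⟨_, ⟨i, rfl⟩, ?_⟩
      have h1 : code ⟨g, hg⟩ = code i.2.choose := i.2.choose_spec.symm
      refine (hd _ _ h1).trans_lt ?_
      exact (ENNReal.ofReal_lt_ofReal_iff hh).2 (by linarith)
  have h2 : ((l2Covering P h A : ℕ∞) : ℝ≥0∞) ≤ ENNReal.ofReal (Real.exp n) := by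
    calc ((l2Covering P h A : ℕ∞) : ℝ≥0∞) ≤ ((Fintype.card ι : ℕ∞) : ℝ≥0∞) := by exact_mod_cast hcov
      _ = ENNReal.ofReal (Fintype.card ι) := by simp
      _ ≤ _ := ENNReal.ofReal_le_ofReal hc
  unfold l2Entropy
  refine (ENNReal.log_le_log h2).trans ?_
  rw [ENNReal.log_ofReal_of_pos (Real.exp_pos _), Real.log_exp]

/-- Coding of bounded coefficients up to an error `δ`. -/
lemma exists_code_coeff {X S : Type} [Fintype S] (c : X → S → ℝ) {B δ : ℝ} (hB : 0 ≤ B)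
    (hδ : 0 < δ) (hc : ∀ x j, |c x j| ≤ B) :
    ∃ (ι : Type) (_ : Fintype ι) (code : X → ι),
      (Fintype.card ι : ℝ) ≤ Real.exp (Fintype.card S * Real.log (2 * B / δ + 2)) ∧
      ∀ x y, code x = code y → ∀ j, |c x j - c y j| ≤ δ := by
  classical
  set I := Finset.Icc ⌊-(B / δ)⌋ ⌊B / δ⌋
  have hmem : ∀ x j, ⌊c x j / δ⌋ ∈ I := by
    intro x j
    have h := abs_le.1 (hc x j)
    rw [Finset.mem_Icc, ← neg_div]
    constructor <;> apply Int.floor_mono <;> gcongr <;> linarith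
  refine ⟨S → I, inferInstance, fun x j => ⟨_, hmem x j⟩, ?_, fun x y hxy j => ?_⟩
  · rw [Fintype.card_fun, Fintype.card_coe, Int.card_Icc, Nat.cast_pow,
      mul_comm, Real.exp_mul, Real.exp_log (by positivity), Real.rpow_natCast]
    gcongr
    have h1 : ⌊-(B / δ)⌋ ≤ ⌊B / δ⌋ + 1 := by
      have : ⌊-(B / δ)⌋ ≤ ⌊B / δ⌋ := Int.floor_mono (by
        have : 0 ≤ B / δ := by positivity
        linarith)
      omega
    have h2 : (((⌊B / δ⌋ + 1 - ⌊-(B / δ)⌋).toNat : ℤ) : ℝ) = ⌊B / δ⌋ + 1 - ⌊-(B / δ)⌋ := by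
      rw [Int.toNat_of_nonneg (by omega)]; push_cast; ring
    rw [Int.cast_natCast] at h2
    rw [h2]
    have h3 := Int.floor_le (B / δ)
    have h4 := Int.lt_floor_add_one (-(B / δ))
    have h5 : 2 * B / δ = 2 * (B / δ) := by ring
    linarith
  · have h1 : ⌊c x j / δ⌋ = ⌊c y j / δ⌋ := by
      have := congrFun hxy j
      simpa using this
    have h2 := (Int.abs_sub_lt_one_of_floor_eq_floor h1).le
    rw [← sub_div, abs_div, abs_of_pos hδ, div_le_one hδ] at h2
    exact h2

/-- Coding at a given resolution: `S` is the net of centres, `r` the radius of the cells and `δ` the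
precision of the coefficients. -/
lemma coded_of_net {d : ℕ} {P : Measure (Euc d)} [IsProbabilityMeasure P] {X : Type}
    {F : X → Euc d → ℝ} {E : X → Euc d → ℝ≥0∞} (hFm : ∀ x, AEStronglyMeasurable (F x) P)
    (hEm : ∀ x, Measurable (E x)) {S : Finset (Euc d)} {R r δ B h : ℝ} {K T W : ℝ≥0∞} {N : ℕ}
    (hSP : ∀ z ∈ S, P (Metric.ball z r) ≠ 0) (hr : r ≤ 1)
    (hSR : ∀ z ∈ S, ‖z‖ ≤ R)
    (hcov : P.support ∩ Metric.ball 0 R ⊆ ⋃ z ∈ S, Metric.ball z r)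
    (hN : ∀ E : Euc d → ℝ≥0∞, Measurable E →
      ∑ z ∈ S, ∫⁻ y in Metric.ball z r, E y ∂P ≤ N * ∫⁻ y, E y ∂P)
    (hFB : ∀ x, ∀ z ∈ P.support, ‖z‖ ≤ R + 1 → |F x z| ≤ B) (hB : 0 ≤ B) (hδ : 0 < δ)
    (hET : ∀ x, ∫⁻ y, E x y ∂P ≤ T)
    (hloc : ∀ x, ∀ z ∈ S, evariance (F x) (ProbabilityTheory.cond P (Metric.ball z r)) ≤
      K * ∫⁻ y, E x y ∂(ProbabilityTheory.cond P (Metric.ball z r)))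
    (htail : ∀ x y, ∫⁻ z in {z | R ≤ ‖z‖}, ‖F x z - F y z‖ₑ ^ 2 ∂P ≤ W)
    (hh : 0 ≤ h)
    (hsum : 3 * N * (2 * K * T + ENNReal.ofReal (δ ^ 2)) + W ≤ ENNReal.ofReal (h ^ 2)) :
    Coded P F h (S.card * Real.log (2 * B / δ + 2)) := by
  have hprob : ∀ z : S, IsProbabilityMeasure (ProbabilityTheory.cond P (Metric.ball z.1 r)) :=
    fun z => ProbabilityTheory.cond_isProbabilityMeasure (hSP z z.2)
  -- The coefficients are the means over the cells; they are at most `B` since a cell of radius `r ≤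
  -- 1` centred in `B(0; R)` stays within norm `R + 1`.
  obtain ⟨ι, hι, code, hcard, hcode⟩ := exists_code_coeff
    (fun (x : X) (z : S) => (ProbabilityTheory.cond P (Metric.ball z.1 r))[F x]) hB hδ (by
      intro x z
      have := hprob z
      have hae : ∀ᵐ y ∂(ProbabilityTheory.cond P (Metric.ball z.1 r)), ‖F x y‖ ≤ B := by
        have h1 : ∀ᵐ y ∂(ProbabilityTheory.cond P (Metric.ball z.1 r)), y ∈ P.support :=
          ProbabilityTheory.cond_absolutelyContinuous.ae_le Measure.support_mem_ae
        have h2 : ∀ᵐ y ∂(ProbabilityTheory.cond P (Metric.ball z.1 r)), y ∈ Metric.ball z.1 r :=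
          ProbabilityTheory.ae_cond_mem Metric.isOpen_ball.measurableSet
        filter_upwards [h1, h2] with y hy1 hy2
        refine hFB x y hy1 ?_
        have h3 := hSR z z.2
        have h4 : ‖y - z.1‖ < r := by rwa [← dist_eq_norm]
        have h5 : ‖y‖ ≤ ‖y - z.1‖ + ‖z.1‖ := by
          simpa using norm_add_le (y - z.1) z.1
        linarith
      have h6 := norm_integral_le_of_norm_le_const hae
      simpa using h6)
  refine ⟨ι, hι, code, by simpa using hcard, fun x y hxy => ?_⟩
  have hball : ∀ z ∈ S, ∫⁻ w in Metric.ball z r, ‖F x w - F y w‖ₑ ^ 2 ∂P ≤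
      3 * (K * ∫⁻ w in Metric.ball z r, E x w ∂P + ENNReal.ofReal (δ ^ 2) * P (Metric.ball z r) +
        K * ∫⁻ w in Metric.ball z r, E y w ∂P) := fun z hz =>
    setLIntegral_sub_sq_le (hSP z hz) (hFm x) (hloc x z hz) (hloc y z hz) (hcode x y hxy ⟨z, hz⟩)
  have hmain : ∫⁻ w, ‖F x w - F y w‖ₑ ^ 2 ∂P ≤ ENNReal.ofReal (h ^ 2) := by
    -- Almost every point lies in the support, hence in a cell or in the tail region.
    have hsub : ∀ᵐ w ∂P, w ∈ (⋃ z ∈ S, Metric.ball z r) ∪ {w | R ≤ ‖w‖} := by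
      filter_upwards [Measure.support_mem_ae (μ := P)] with w hw
      rcases lt_or_ge ‖w‖ R with h | h
      · exact Or.inl (hcov ⟨hw, by simpa using h⟩)
      · exact Or.inr h
    calc ∫⁻ w, ‖F x w - F y w‖ₑ ^ 2 ∂P
        = ∫⁻ w in (⋃ z ∈ S, Metric.ball z r) ∪ {w | R ≤ ‖w‖}, ‖F x w - F y w‖ₑ ^ 2 ∂P := by
          rw [Measure.restrict_eq_self_of_ae_mem hsub]
      _ ≤ ∫⁻ w in (⋃ z ∈ S, Metric.ball z r), ‖F x w - F y w‖ₑ ^ 2 ∂P +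
          ∫⁻ w in {w | R ≤ ‖w‖}, ‖F x w - F y w‖ₑ ^ 2 ∂P := lintegral_union_le _ _ _
      _ ≤ ∑ z ∈ S, ∫⁻ w in Metric.ball z r, ‖F x w - F y w‖ₑ ^ 2 ∂P + W := by
          gcongr
          · have e : (⋃ z ∈ S, Metric.ball z r) = ⋃ z : S, Metric.ball z.1 r := by
              ext; simp
            rw [e]
            refine (lintegral_iUnion_le _ _).trans ?_
            rw [tsum_fintype]
            exact (Finset.sum_coe_sort S
              (fun z => ∫⁻ w in Metric.ball z r, ‖F x w - F y w‖ₑ ^ 2 ∂P)).le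
          · exact htail x y
      _ ≤ ∑ z ∈ S, 3 * (K * ∫⁻ w in Metric.ball z r, E x w ∂P +
            ENNReal.ofReal (δ ^ 2) * ∫⁻ w in Metric.ball z r, 1 ∂P +
            K * ∫⁻ w in Metric.ball z r, E y w ∂P) + W := by
          gcongr with z hz
          simpa using hball z hz
      _ = 3 * (K * ∑ z ∈ S, ∫⁻ w in Metric.ball z r, E x w ∂P +
            ENNReal.ofReal (δ ^ 2) * ∑ z ∈ S, ∫⁻ w in Metric.ball z r, 1 ∂P +
            K * ∑ z ∈ S, ∫⁻ w in Metric.ball z r, E y w ∂P) + W := by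
          simp only [← Finset.mul_sum, Finset.sum_add_distrib]
      _ ≤ 3 * (K * (N * T) + ENNReal.ofReal (δ ^ 2) * (N * 1) + K * (N * T)) + W := by
          gcongr
          · exact (hN _ (hEm x)).trans (by gcongr; exact hET x)
          · exact (hN _ measurable_const).trans (by simp)
          · exact (hN _ (hEm y)).trans (by gcongr; exact hET y)
      _ = 3 * N * (2 * K * T + ENNReal.ofReal (δ ^ 2)) + W := by ring
      _ ≤ _ := hsum
  rw [eLpNorm_eq_lintegral_rpow_enorm_toReal (by norm_num) (by norm_num)]
  simp only [ENNReal.toReal_ofNat, ENNReal.rpow_ofNat, Pi.sub_apply]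
  calc (∫⁻ w, ‖F x w - F y w‖ₑ ^ 2 ∂P) ^ (1 / (2 : ℝ)) ≤ (ENNReal.ofReal (h ^ 2)) ^ (1 / (2 : ℝ)) := by
        gcongr
    _ = ENNReal.ofReal h := by
        rw [ENNReal.ofReal_pow hh, ← ENNReal.rpow_natCast, ← ENNReal.rpow_mul]
        norm_num

/-! ### Choice of the radius, the mesh and the precision -/

lemma one_le_logPlus (x : ℝ) : 1 ≤ logPlus x := le_max_left _ _

lemma log_le_logPlus (x : ℝ) : Real.log x ≤ logPlus x := le_max_right _ _

/-- Truncation error: a radius proportional to `log₊(1/h) + log M` lets the exponential tail beat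
the factor `M² / h²`. -/
lemma tail_arith {A c' M h C₁ : ℝ} (hA : 0 < A) (hc' : 0 < c') (hM : 1 ≤ M) (hh : 0 < h)
    (hL1 : 1 ≤ logPlus (1 / h) + Real.log M) (hC₁ : (|Real.log (16 * A)| + 2) / c' ≤ C₁) :
    4 * M ^ 2 * (A * Real.exp (-(c' * (C₁ * (logPlus (1 / h) + Real.log M))))) ≤ h ^ 2 / 4 := by
  obtain ⟨L, hL⟩ : ∃ L, L = logPlus (1 / h) + Real.log M := ⟨_, rfl⟩
  rw [← hL] at hL1 ⊢
  have h1 : Real.log (16 * A) + 2 * Real.log M + 2 * Real.log (1 / h) ≤ c' * (C₁ * L) := by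
    have h2 : (|Real.log (16 * A)| + 2) * L ≤ c' * (C₁ * L) := by
      rw [div_le_iff₀ hc'] at hC₁
      calc (|Real.log (16 * A)| + 2) * L ≤ (C₁ * c') * L := by gcongr
        _ = c' * (C₁ * L) := by ring
    have h3 := le_abs_self (Real.log (16 * A))
    have h4 : |Real.log (16 * A)| ≤ |Real.log (16 * A)| * L :=
      le_mul_of_one_le_right (abs_nonneg _) hL1
    have h5 := log_le_logPlus (1 / h)
    have h6 : (|Real.log (16 * A)| + 2) * L = |Real.log (16 * A)| * L + 2 * L := by ring
    linarith
  have h6 : 16 * A * M ^ 2 * (1 / h) ^ 2 ≤ Real.exp (c' * (C₁ * L)) := by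
    rw [← Real.log_le_iff_le_exp (by positivity), Real.log_mul (by positivity) (by positivity),
      Real.log_mul (by positivity) (by positivity), Real.log_pow, Real.log_pow]
    push_cast
    linarith
  rw [Real.exp_neg]
  have h7 : 16 * A * M ^ 2 ≤ Real.exp (c' * (C₁ * L)) * h ^ 2 := by
    have : 16 * A * M ^ 2 * (1 / h) ^ 2 = 16 * A * M ^ 2 / h ^ 2 := by field_simp
    rwa [this, div_le_iff₀ (by positivity)] at h6
  have h8 : 4 * M ^ 2 * (A * (Real.exp (c' * (C₁ * L)))⁻¹) = 4 * M ^ 2 * A / Real.exp (c' * (C₁ * L)) := by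
    field_simp
  rw [h8, div_le_iff₀ (Real.exp_pos _)]
  linarith

/-- Error budget: rounding and oscillation on the cells cost at most `h² / 12` each, the tail at
most `h² / 4`. The factor `9 N (K + 1)` is such that its square dominates `72 N K`. -/
lemma energy_arith {N R s T h r W : ℝ} {K : ℝ≥0} (hN1 : 1 ≤ N) (hR1 : 1 ≤ R) (hs : 0 ≤ s)
    (hT : 0 ≤ T) (hWh : W ≤ h ^ 2 / 4) (hrT : r * (9 * N * (K + 1) * (1 + R) ^ s * T) ≤ h)
    (hr0 : 0 ≤ r) :
    3 * N * (2 * (K * (r ^ 2 * (1 + R) ^ s)) * T ^ 2 + (h / (6 * N)) ^ 2) + W ≤ h ^ 2 := by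
  have h1 : 3 * N * (h / (6 * N)) ^ 2 ≤ h ^ 2 / 12 := by
    rw [div_pow, mul_pow]
    have : 3 * N * (h ^ 2 / (6 ^ 2 * N ^ 2)) = h ^ 2 / (12 * N) := by field_simp; ring
    rw [this]
    gcongr
    linarith
  have h2 : 3 * N * (2 * (K * (r ^ 2 * (1 + R) ^ s)) * T ^ 2) ≤ h ^ 2 / 12 := by
    have h3 : (r * (9 * N * (K + 1) * (1 + R) ^ s * T)) ^ 2 ≤ h ^ 2 := by gcongr
    have h4 : 1 ≤ (1 + R) ^ s := Real.one_le_rpow (by linarith) hs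
    have h5 : 72 * N * K ≤ (9 * N * (K + 1)) ^ 2 := by
      have hK : (0 : ℝ) ≤ K := K.2
      have : N * K ≤ N ^ 2 * (K + 1) ^ 2 := by
        have : N ≤ N ^ 2 := by nlinarith
        gcongr
        nlinarith
      nlinarith
    have h6 : (1 + R) ^ s ≤ ((1 + R) ^ s) ^ 2 := by nlinarith
    calc 3 * N * (2 * (K * (r ^ 2 * (1 + R) ^ s)) * T ^ 2)
        = (72 * N * K) * (1 + R) ^ s * (r ^ 2 * T ^ 2) / 12 := by ring
      _ ≤ (9 * N * (K + 1)) ^ 2 * ((1 + R) ^ s) ^ 2 * (r ^ 2 * T ^ 2) / 12 := by gcongr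
      _ = (r * (9 * N * (K + 1) * (1 + R) ^ s * T)) ^ 2 / 12 := by ring
      _ ≤ _ := by gcongr
  nlinarith [sq_nonneg h]

lemma mesh_arith {R θ s κ ε₀ D t : ℝ} (hκ : 0 < κ) (hε₀ : 0 < ε₀) (hD0 : 0 ≤ D) (hR1 : 1 ≤ R)
    (hθ : 0 ≤ θ) (hs : 0 ≤ s) (ht : 0 ≤ t) :
    1 + (1 + R) ^ θ / κ + 1 / ε₀ + D * (1 + R) ^ s * t ≤
      (1 + 1 / κ + 1 / ε₀ + D) * (1 + R) ^ (θ + s) * max 1 t := by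
  have hG1 : 1 ≤ max 1 t := le_max_left _ _
  have hG2 : t ≤ max 1 t := le_max_right _ _
  generalize max 1 t = G at *
  have h1 : 1 ≤ (1 + R) ^ θ := Real.one_le_rpow (by linarith) hθ
  have h2 : 1 ≤ (1 + R) ^ s := Real.one_le_rpow (by linarith) hs
  have hU : (1 + R) ^ (θ + s) = (1 + R) ^ θ * (1 + R) ^ s := Real.rpow_add (by positivity) _ _
  generalize (1 + R) ^ (θ + s) = U at *
  have hU1 : 1 ≤ U := by rw [hU]; nlinarith
  have hθU : (1 + R) ^ θ ≤ U := by rw [hU]; nlinarith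
  have hsU : (1 + R) ^ s ≤ U := by rw [hU]; nlinarith
  have hUG : U ≤ U * G := by nlinarith
  have t1 : (1 + R) ^ θ / κ ≤ 1 / κ * (U * G) := by
    rw [div_eq_mul_inv, mul_comm, one_div]; gcongr; linarith
  have t2 : 1 / ε₀ ≤ 1 / ε₀ * (U * G) := le_mul_of_one_le_right (by positivity) (by linarith)
  have t3 : D * (1 + R) ^ s * (t) ≤ D * (U * G) := by
    rw [mul_assoc]; gcongr
  have : (1 + 1 / κ + 1 / ε₀ + D) * U * G = U * G + 1 / κ * (U * G) + 1 / ε₀ * (U * G) + D * (U * G) := by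
    ring
  rw [this]
  linarith

/-- Cost of one coefficient: its number of rounding levels is polynomial in `M`, `R` and `1/h`, and
`R` dominates both `log M` and `log₊(1/h)`. -/
lemma log_arith {N R k M h : ℝ} (hN1 : 1 ≤ N) (hR1 : 1 ≤ R) (hk : 0 ≤ k) (hM : 1 ≤ M) (hh : 0 < h)
    (hRL : logPlus (1 / h) + Real.log M ≤ R) :
    Real.log (2 * (M * (2 + R) ^ k) / (h / (6 * N)) + 2) ≤
      (Real.log (12 * N + 2) + 2 + k) * (1 + R) := by
  have hlogN : 0 ≤ Real.log (12 * N + 2) := Real.log_nonneg (by linarith)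
  obtain ⟨B, hB⟩ : ∃ B, B = M * (2 + R) ^ k := ⟨_, rfl⟩
  rw [← hB]
  have h1h : 0 < 1 / h := by positivity
  obtain ⟨H, hH⟩ : ∃ H, H = max 1 (1 / h) := ⟨_, rfl⟩
  have hH1 : 1 ≤ H := hH ▸ le_max_left _ _
  have hlogH : Real.log H ≤ logPlus (1 / h) := by
    rcases le_total (1 / h) 1 with h1 | h1
    · rw [hH, max_eq_left h1, Real.log_one]; linarith [one_le_logPlus (1 / h)]
    · rw [hH, max_eq_right h1]; exact log_le_logPlus _
  have h2R : 1 ≤ (2 + R) ^ k := Real.one_le_rpow (by linarith) hk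
  have hB1 : 1 ≤ B := by rw [hB]; nlinarith
  have hBH : B ≤ B * H := by nlinarith
  have h2 : 2 * B / (h / (6 * N)) + 2 ≤ (12 * N + 2) * (M * (2 + R) ^ k * H) := by
    have e : 2 * B / (h / (6 * N)) = 12 * N * (B * (1 / h)) := by field_simp; norm_num
    have h3 : B * (1 / h) ≤ B * H := by gcongr; rw [hH]; exact le_max_right _ _
    rw [e, ← hB]
    nlinarith
  have h4 := Real.log_le_log (by positivity) h2
  rw [Real.log_mul (by positivity) (by positivity), Real.log_mul (by positivity) (by positivity),
    Real.log_mul (by positivity) (by positivity), Real.log_rpow (by positivity)] at h4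
  have h5 : Real.log (2 + R) ≤ 1 + R := by
    have := Real.log_le_sub_one_of_pos (show 0 < 2 + R by linarith)
    linarith
  have h6 : k * Real.log (2 + R) ≤ k * (1 + R) := by gcongr
  have h7 : Real.log (12 * N + 2) ≤ Real.log (12 * N + 2) * (1 + R) :=
    le_mul_of_one_le_right hlogN (by linarith)
  linarith

/-- Number of cells of radius `1 / Z`: the powers of `R`, which are logarithmic in the end, are
separated from the main factor `G ^ m`. -/
lemma count_arith {m c R Z C₂ θ s G : ℝ} (hm : 0 ≤ m) (hc : 0 < c) (hR1 : 1 ≤ R) (hZ0 : 0 < Z)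
    (hZG : Z ≤ C₂ * (1 + R) ^ (θ + s) * G) (hC₂ : 0 ≤ C₂) (hG : 0 ≤ G) :
    (c * (1 / Z / 4) / R) ^ (-m) ≤
      (4 * C₂ / c) ^ m * (1 + R) ^ ((1 + θ + s) * m) * G ^ m := by
  have e : (c * (1 / Z / 4) / R) ^ (-m) = (4 * R * Z / c) ^ m := by
    rw [Real.rpow_neg (by positivity), ← Real.inv_rpow (by positivity)]
    congr 1
    field_simp
  rw [e, Real.rpow_mul (by positivity), ← Real.mul_rpow (by positivity) (by positivity),
    ← Real.mul_rpow (by positivity) (by positivity)]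
  apply Real.rpow_le_rpow (by positivity) _ hm
  have e2 : (1 + R) ^ (1 + θ + s) = (1 + R) * (1 + R) ^ (θ + s) := by
    rw [add_assoc, Real.rpow_add (by positivity), Real.rpow_one]
  rw [e2]
  calc 4 * R * Z / c ≤ 4 * (1 + R) * (C₂ * (1 + R) ^ (θ + s) * G) / c := by
        gcongr; linarith
    _ = _ := by ring

set_option maxHeartbeats 1000000 in
/-- Entropy bound for a family of functions of polynomial growth which satisfy local
Poincaré inequalities with energy densities `E`. -/
lemma exists_coded_bound {d : ℕ} {P : Measure (Euc d)} [IsProbabilityMeasure P]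
    (hexp : ∃ c : ℝ, 0 < c ∧ ∫⁻ x, ENNReal.ofReal (Real.exp (c * ‖x‖)) ∂P ≠ ⊤)
    {m : ℝ} (hm : 0 ≤ m) (hS : SupportGrowth P m) (K : ℝ≥0) {θ κ s k : ℝ} (hθ : 0 ≤ θ)
    (hκ : 0 < κ) (hs : 0 ≤ s) (hk : 0 ≤ k) :
    ∃ C p : ℝ, 0 ≤ C ∧ 0 ≤ p ∧ ∀ {X : Type} (F : X → Euc d → ℝ) (E : X → Euc d → ℝ≥0∞)
      (M T h : ℝ), 1 ≤ M → 0 ≤ T → 0 < h → (∀ x, AEStronglyMeasurable (F x) P) →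
      (∀ x, Measurable (E x)) → (∀ x, ∀ z ∈ P.support, |F x z| ≤ M * (1 + ‖z‖) ^ k) →
      (∀ x, ∫⁻ z, E x z ∂P ≤ ENNReal.ofReal (T ^ 2)) →
      (∀ x, ∀ R r : ℝ, 0 < R → 0 < r → r ≤ 1 → r ≤ κ * (1 + R) ^ (-θ) →
        ∀ z ∈ P.support ∩ Metric.ball 0 R,
        evariance (F x) (ProbabilityTheory.cond P (Metric.ball z r)) ≤
          K * ENNReal.ofReal (r ^ 2 * (1 + R) ^ s) *
            ∫⁻ y, E x y ∂(ProbabilityTheory.cond P (Metric.ball z r))) →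
      Coded P F h (C * (logPlus (1 / h) + Real.log M) ^ p * (max 1 (T / h)) ^ m) := by
  classical
  obtain ⟨A, c', hA, hc', htail⟩ := exists_tail_bound hexp (2 * k)
  obtain ⟨c, R₀, ε₀, hc, hR₀, hε₀, hcover⟩ := hS
  set N : ℝ := 5 ^ d with hN
  have hN1 : 1 ≤ N := one_le_pow₀ (by norm_num)
  set D : ℝ := 9 * N * (K + 1) with hD
  have hD0 : 0 < D := by positivity
  -- The summands ensure in turn `R ≥ L`, `R ≥ R₀` and the smallness of the tail.
  set C₁ : ℝ := 1 + R₀ + (|Real.log (16 * A)| + 2) / c' with hC₁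
  have hC₁1 : 1 ≤ C₁ := by
    have : 0 ≤ (|Real.log (16 * A)| + 2) / c' := by positivity
    linarith
  set C₂ : ℝ := 1 + 1 / κ + 1 / ε₀ + D with hC₂
  have hC₂0 : 0 < C₂ := by positivity
  -- The number of cells contributes the power `(1 + θ + s) * m` of `1 + R`, the cost of a
  -- coefficient one more.
  set p : ℝ := (1 + θ + s) * m + 1 with hp
  have hp0 : 0 ≤ p := by positivity
  set C₃ : ℝ := Real.log (12 * N + 2) + 2 + k with hC₃
  have hlogN : 0 ≤ Real.log (12 * N + 2) := Real.log_nonneg (by linarith)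
  have hC₃0 : 0 ≤ C₃ := by positivity
  refine ⟨(4 * C₂ / c) ^ m * C₃ * (2 * C₁) ^ p, p, by positivity, hp0, ?_⟩
  intro X F E M T h hM hT hh hFm hEm hFM hET hloc
  have hlogM : 0 ≤ Real.log M := Real.log_nonneg hM
  set L := logPlus (1 / h) + Real.log M with hL
  have hL1 : 1 ≤ L := by linarith [one_le_logPlus (1 / h)]
  set R := C₁ * L with hR
  have hR1 : 1 ≤ R := by nlinarith
  have hRL : L ≤ R := by nlinarith
  have hRR₀ : R₀ ≤ R := by
    have : R₀ ≤ C₁ := by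
      have : 0 ≤ (|Real.log (16 * A)| + 2) / c' := by positivity
      linarith
    nlinarith
  -- Each summand enforces one constraint on `r = 1 / Z`: `r ≤ 1`, validity of the local Poincaré
  -- inequality, validity of the covering bound, and oscillation below `h`.
  set Z : ℝ := 1 + (1 + R) ^ θ / κ + 1 / ε₀ + D * (1 + R) ^ s * (T / h) with hZ
  have hTh : 0 ≤ T / h := by positivity
  have hZ1 : 1 ≤ Z := by
    have h1 : 0 ≤ (1 + R) ^ θ / κ := by positivity
    have h2 : 0 ≤ 1 / ε₀ := by positivity
    have h3 : 0 ≤ D * (1 + R) ^ s * (T / h) := by positivity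
    linarith
  have hZ0 : 0 < Z := by linarith
  set r : ℝ := 1 / Z with hr
  have hr0 : 0 < r := by positivity
  have hr1 : r ≤ 1 := by rw [hr, div_le_one hZ0]; exact hZ1
  have hrκ : r ≤ κ * (1 + R) ^ (-θ) := by
    rw [Real.rpow_neg (by positivity), ← div_eq_mul_inv, hr, div_le_div_iff₀ hZ0 (by positivity),
      one_mul]
    have h2 : 0 ≤ 1 / ε₀ := by positivity
    have h3 : 0 ≤ D * (1 + R) ^ s * (T / h) := by positivity
    have h4 : (1 + R) ^ θ / κ ≤ Z := by linarith
    rw [div_le_iff₀ hκ] at h4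
    linarith
  have hrε : r / 4 ≤ ε₀ := by
    have h1 : 0 ≤ (1 + R) ^ θ / κ := by positivity
    have h3 : 0 ≤ D * (1 + R) ^ s * (T / h) := by positivity
    have h4 : 1 / ε₀ ≤ Z := by linarith
    have : r ≤ ε₀ := by
      rw [hr, div_le_iff₀ hZ0]
      rw [div_le_iff₀ hε₀] at h4
      linarith
    linarith
  have hrT : r * (D * (1 + R) ^ s * T) ≤ h := by
    have h1 : 0 ≤ (1 + R) ^ θ / κ := by positivity
    have h2 : 0 ≤ 1 / ε₀ := by positivity
    have h4 : D * (1 + R) ^ s * (T / h) ≤ Z := by linarith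
    rw [mul_div_assoc', div_le_iff₀ hh] at h4
    calc r * (D * (1 + R) ^ s * T) ≤ r * (Z * h) := by gcongr
      _ = h := by rw [hr]; field_simp
  set n : ℝ := (c * (r / 4) / R) ^ (-m) with hn
  have hcov := hcover R hRR₀ (r / 4) (by positivity) hrε
  obtain ⟨S, hSsub, hScard, hScov, hSover⟩ := exists_separated_cover hr0 hcov (by positivity)
  set δ : ℝ := h / (6 * N) with hδ
  have hδ0 : 0 < δ := by positivity
  set B : ℝ := M * (2 + R) ^ k with hB
  have hB0 : 0 ≤ B := by positivity
  set W : ℝ := 4 * M ^ 2 * (A * Real.exp (-(c' * R))) with hW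
  have hW0 : 0 ≤ W := by positivity
  have hWh : W ≤ h ^ 2 / 4 :=
    tail_arith hA hc' hM hh hL1 (by linarith)
  have hFB : ∀ x, ∀ z ∈ P.support, ‖z‖ ≤ R + 1 → |F x z| ≤ B := by
    intro x z hz hzR
    have h1 : 1 + ‖z‖ ≤ 2 + R := by linarith
    have h2 : (1 + ‖z‖) ^ k ≤ (2 + R) ^ k := by gcongr
    calc |F x z| ≤ M * (1 + ‖z‖) ^ k := hFM x z hz
      _ ≤ M * (2 + R) ^ k := by gcongr
  have hcoded := coded_of_net (N := 5 ^ d) (T := ENNReal.ofReal (T ^ 2))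
    (K := K * ENNReal.ofReal (r ^ 2 * (1 + R) ^ s)) (W := ENNReal.ofReal W) (h := h) hFm hEm
    (S := S) (R := R) (r := r) (δ := δ) (B := B)
    (fun z hz => by
      have := (Measure.mem_support_iff_forall z).1 (hSsub hz).1 _ (Metric.ball_mem_nhds z hr0)
      exact this.ne')
    hr1 (fun z hz => by
      have := (hSsub hz).2
      rw [mem_ball_zero_iff] at this
      exact this.le) hScov
    (fun E hE => sum_setLIntegral_le_of_overlap hSover hE)
    hFB hB0 hδ0 hET
    (fun x z hz => hloc x R r (by positivity) hr0 hr1 hrκ z (hSsub hz))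
    (fun x y => by
      have hae : ∀ᵐ z ∂(P.restrict {z | R ≤ ‖z‖}), ‖F x z - F y z‖ₑ ^ 2 ≤
          ENNReal.ofReal (4 * M ^ 2) * ENNReal.ofReal ((1 + ‖z‖) ^ (2 * k)) := by
        filter_upwards [ae_restrict_of_ae (Measure.support_mem_ae (μ := P))] with z hz
        rw [← ENNReal.ofReal_mul (by positivity), ← ofReal_norm,
          ← ENNReal.ofReal_pow (norm_nonneg _)]
        apply ENNReal.ofReal_le_ofReal
        have h1 : ‖F x z - F y z‖ ≤ 2 * (M * (1 + ‖z‖) ^ k) := by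
          refine (norm_sub_le _ _).trans ?_
          have := hFM x z hz
          have := hFM y z hz
          simp only [Real.norm_eq_abs]
          linarith
        calc ‖F x z - F y z‖ ^ 2 ≤ (2 * (M * (1 + ‖z‖) ^ k)) ^ 2 := by gcongr
          _ = 4 * M ^ 2 * (1 + ‖z‖) ^ (2 * k) := by
            rw [mul_comm 2 k, Real.rpow_mul (by positivity)]
            norm_cast
            ring
      refine (lintegral_mono_ae hae).trans ?_
      rw [lintegral_const_mul' _ _ ENNReal.ofReal_ne_top, hW,
        ENNReal.ofReal_mul (p := 4 * M ^ 2) (by positivity)]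
      exact mul_le_mul_right (htail R) _)
    hh.le (by
      have e1 : (K : ℝ≥0∞) = ENNReal.ofReal K := (ENNReal.ofReal_coe_nnreal).symm
      have e2 : ((5 ^ d : ℕ) : ℝ≥0∞) = ENNReal.ofReal N := by
        rw [hN, ENNReal.ofReal_pow (by norm_num)]; simp
      rw [e1, e2, show (3 : ℝ≥0∞) = ENNReal.ofReal 3 by simp,
        show (2 : ℝ≥0∞) = ENNReal.ofReal 2 by simp]
      rw [← ENNReal.ofReal_mul (by positivity), ← ENNReal.ofReal_mul (by positivity),
        ← ENNReal.ofReal_mul (by positivity), ← ENNReal.ofReal_mul (by positivity),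
        ← ENNReal.ofReal_add (by positivity) (by positivity),
        ← ENNReal.ofReal_mul (by positivity), ← ENNReal.ofReal_add (by positivity) (by positivity)]
      apply ENNReal.ofReal_le_ofReal
      exact energy_arith hN1 hR1 hs hT hWh hrT hr0.le)
  refine hcoded.mono ?_
  set G := max 1 (T / h) with hG
  have hG1 : 1 ≤ G := le_max_left _ _
  have hZG : Z ≤ C₂ * (1 + R) ^ (θ + s) * G :=
    mesh_arith hκ hε₀ hD0.le hR1 hθ hs hTh
  have hnle : n ≤ (4 * C₂ / c) ^ m * (1 + R) ^ ((1 + θ + s) * m) * G ^ m :=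
    count_arith hm hc hR1 hZ0 hZG (by positivity) (by positivity)
  have hlog : Real.log (2 * B / δ + 2) ≤ C₃ * (1 + R) :=
    log_arith hN1 hR1 hk hM hh hRL
  calc (S.card : ℝ) * Real.log (2 * B / δ + 2)
      ≤ ((4 * C₂ / c) ^ m * (1 + R) ^ ((1 + θ + s) * m) * G ^ m) * (C₃ * (1 + R)) := by
        gcongr
        · exact Real.log_nonneg (by
            have : 0 ≤ 2 * B / δ := by positivity
            linarith)
        · exact hScard.trans hnle
    _ = (4 * C₂ / c) ^ m * C₃ * (1 + R) ^ p * G ^ m := by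
        rw [hp, Real.rpow_add (by positivity), Real.rpow_one]; ring
    _ ≤ (4 * C₂ / c) ^ m * C₃ * ((2 * C₁) * L) ^ p * G ^ m := by
        gcongr
        linarith
    _ = _ := by
        rw [Real.mul_rpow (by positivity) (by positivity)]; ring

/-! ### Poincaré inequalities for functions defined near the support and for Lipschitz compositions
-/

lemma measurable_gradient {d : ℕ} (f : Euc d → ℝ) : Measurable (gradient f) :=
  (InnerProductSpace.toDual ℝ (Euc d)).symm.continuous.measurable.comp (measurable_fderiv ℝ f)

lemma evariance_congr_ae {d : ℕ} {P : Measure (Euc d)} {f g : Euc d → ℝ} (h : f =ᵐ[P] g) :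
    evariance f P = evariance g P := by
  unfold evariance
  rw [integral_congr_ae h]
  exact lintegral_congr_ae (by filter_upwards [h] with x hx; rw [hx])

/-- A function differentiable near a closed set agrees near that set with a function which is
differentiable everywhere. -/
lemma exists_differentiable_extension {d : ℕ} {S U : Set (Euc d)} (hS : IsClosed S)
    (hU : IsOpen U) (hSU : S ⊆ U) {f : Euc d → ℝ} (hf : ∀ x ∈ U, DifferentiableAt ℝ f x) :
    ∃ g : Euc d → ℝ, Differentiable ℝ g ∧ ∀ x ∈ S, g =ᶠ[𝓝 x] f := by
  -- The cutoff is `1` near `S` and `0` near the complement of `U`, so the product with `f` is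
  -- differentiable even where `f` is not.
  obtain ⟨χ, h0, h1, -⟩ := exists_contMDiffMap_zero_one_nhds_of_isClosed
    (n := 1) (modelWithCornersSelf ℝ (Euc d)) hU.isClosed_compl hS
    (disjoint_compl_left_iff_subset.2 hSU)
  have hχ : Differentiable ℝ χ := (χ.contMDiff.contDiff).differentiable (by norm_num)
  refine ⟨fun x => χ x * f x, fun x => ?_, fun x hx => ?_⟩
  · by_cases hx : x ∈ U
    · exact (hχ x).mul (hf x hx)
    · have h2 : ∀ᶠ y in 𝓝 x, χ y = 0 := (eventually_nhdsSet_iff_forall.1 h0) x hx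
      have h3 : (fun y => χ y * f y) =ᶠ[𝓝 x] fun _ => 0 := by
        filter_upwards [h2] with y hy
        simp [hy]
      exact (differentiableAt_const (0 : ℝ)).congr_of_eventuallyEq h3
  · filter_upwards [(eventually_nhdsSet_iff_forall.1 h1) x hx] with y hy
    simp [hy]

/-- A Poincaré inequality for differentiable functions holds for functions which are only
differentiable near the support. -/
lemma evariance_le_of_differentiable_near {d : ℕ} {P Q : Measure (Euc d)} (hQP : Q ≪ P)
    {C : ℝ≥0∞} (hC : ∀ f : Euc d → ℝ, Differentiable ℝ f →
      evariance f Q ≤ C * ∫⁻ x, ‖gradient f x‖ₑ ^ 2 ∂Q)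
    {U : Set (Euc d)} (hU : IsOpen U) (hPU : P.support ⊆ U) {f : Euc d → ℝ}
    (hf : ∀ x ∈ U, DifferentiableAt ℝ f x) :
    evariance f Q ≤ C * ∫⁻ x, ‖gradient f x‖ₑ ^ 2 ∂Q := by
  obtain ⟨g, hg, hgf⟩ := exists_differentiable_extension Measure.isClosed_support hU hPU hf
  have hae : ∀ᵐ x ∂Q, x ∈ P.support := hQP.ae_le Measure.support_mem_ae
  have h1 : f =ᵐ[Q] g := by
    filter_upwards [hae] with x hx
    exact (hgf x hx).self_of_nhds.symm
  rw [evariance_congr_ae h1]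
  refine (hC g hg).trans_eq ?_
  congr 1
  refine lintegral_congr_ae ?_
  filter_upwards [hae] with x hx
  rw [(hgf x hx).gradient_eq]

/-- Mollification of a Lipschitz map. -/
lemma exists_differentiable_lipschitz_approx {d : ℕ} {Λ : ℝ≥0} {T : Euc d → Euc d}
    (hT : LipschitzWith Λ T) {ε : ℝ} (hε : 0 < ε) :
    ∃ T' : Euc d → Euc d, Differentiable ℝ T' ∧ LipschitzWith Λ T' ∧
      ∀ x, dist (T' x) (T x) ≤ Λ * ε := by
  set φ : ContDiffBump (0 : Euc d) := ⟨ε / 2, ε, half_pos hε, half_lt_self hε⟩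
  set ψ := φ.normed volume
  have hloc : LocallyIntegrable T volume := hT.continuous.locallyIntegrable
  have hcs : HasCompactSupport ψ := φ.hasCompactSupport_normed
  have hcd : ContDiff ℝ 1 ψ := φ.contDiff_normed
  have hex : ∀ x, Integrable (fun t => ψ t • T (x - t)) volume := fun x =>
    hcs.convolutionExists_left (ContinuousLinearMap.lsmul ℝ ℝ) hcd.continuous hloc x
  refine ⟨convolution ψ T (ContinuousLinearMap.lsmul ℝ ℝ) volume, ?_, ?_, fun x => ?_⟩
  · exact (hcs.contDiff_convolution_left (ContinuousLinearMap.lsmul ℝ ℝ) hcd hloc).differentiable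
      (by norm_num)
  · refine LipschitzWith.of_dist_le_mul fun x y => ?_
    simp only [convolution, ContinuousLinearMap.lsmul_apply]
    rw [dist_eq_norm, ← integral_sub (hex x) (hex y)]
    calc ‖∫ t, (ψ t • T (x - t) - ψ t • T (y - t))‖
        ≤ ∫ t, ψ t * (Λ * dist x y) := by
          refine norm_integral_le_of_norm_le (φ.integrable_normed.mul_const _)
            (ae_of_all _ fun t => ?_)
          rw [← smul_sub, norm_smul, Real.norm_of_nonneg (φ.nonneg_normed t)]
          refine mul_le_mul_of_nonneg_left ?_ (φ.nonneg_normed t)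
          rw [← dist_eq_norm]
          simpa using hT.dist_le_mul (x - t) (y - t)
      _ = Λ * dist x y := by
          rw [integral_mul_const, φ.integral_normed, one_mul]
  · refine φ.dist_normed_convolution_le hT.continuous.aestronglyMeasurable fun y hy => ?_
    refine (hT.dist_le_mul y x).trans ?_
    gcongr
    exact (Metric.mem_ball.1 hy).le

/-- A Poincaré inequality for differentiable functions on a ball, applied to the composition of a
continuously differentiable function with a Lipschitz map. -/
lemma evariance_comp_le {d : ℕ} {Q : Measure (Euc d)} [IsProbabilityMeasure Q]
    {C : ℝ≥0∞} (hCt : C ≠ ⊤) (hC : ∀ f : Euc d → ℝ, Differentiable ℝ f →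
      evariance f Q ≤ C * ∫⁻ x, ‖gradient f x‖ₑ ^ 2 ∂Q)
    {x₀ : Euc d} {r : ℝ} (hB : ∀ᵐ x ∂Q, x ∈ Metric.ball x₀ r)
    {Λ : ℝ≥0} {T : Euc d → Euc d} (hT : LipschitzWith Λ T)
    {f : Euc d → ℝ} {v : Euc d → Euc d} (hf : ∀ y, HasGradientAt f (v y) y) (hv : Continuous v) :
    evariance (fun x => f (T x)) Q ≤ C * (Λ ^ 2 * ∫⁻ x, ‖v (T x)‖ₑ ^ 2 ∂Q) := by
  have hfc : Continuous f := continuous_iff_continuousAt.2 fun y => (hf y).continuousAt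
  have hε : ∀ n : ℕ, (0 : ℝ) < 1 / (n + 1) := fun n => by positivity
  -- `f ∘ T` need not be differentiable. Mollifying `T` keeps the Lipschitz constant, and both sides
  -- of the inequality pass to the limit by dominated convergence.
  choose T' hTd hTl hTn using fun n : ℕ => exists_differentiable_lipschitz_approx hT (hε n)
  have hlim : ∀ x, Tendsto (fun n => T' n x) atTop (𝓝 (T x)) := by
    intro x
    rw [tendsto_iff_dist_tendsto_zero]
    refine squeeze_zero (fun _ => dist_nonneg) (fun n => hTn n x) ?_
    simpa using (tendsto_one_div_add_atTop_nhds_zero_nat (𝕜 := ℝ)).const_mul (Λ : ℝ)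
  -- A compact set containing the images of the ball under all the mollified maps; it provides the
  -- dominating constants.
  set B := Metric.closedBall (T x₀) (Λ * r + Λ)
  have hmem : ∀ n, ∀ x ∈ Metric.ball x₀ r, T' n x ∈ B := by
    intro n x hx
    have h1 := hTn n x
    have h2 := hT.dist_le_mul x x₀
    have h3 : dist x x₀ ≤ r := (Metric.mem_ball.1 hx).le
    have h4 := dist_triangle (T' n x) (T x) (T x₀)
    have h5 : (1 : ℝ) / (n + 1) ≤ 1 := by
      rw [div_le_one (by positivity)]
      have : (0 : ℝ) ≤ n := n.cast_nonneg
      linarith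
    have h6 : (Λ : ℝ) * (1 / (n + 1)) ≤ Λ * 1 := by gcongr
    have h7 : (Λ : ℝ) * dist x x₀ ≤ Λ * r := by gcongr
    rw [Metric.mem_closedBall]
    linarith
  obtain ⟨M, hM⟩ := (isCompact_closedBall (T x₀) (Λ * r + Λ)).exists_bound_of_continuousOn
    (f := f) hfc.continuousOn
  obtain ⟨M', hM'⟩ := (isCompact_closedBall (T x₀) (Λ * r + Λ)).exists_bound_of_continuousOn
    (f := v) hv.continuousOn
  have hFc : ∀ n, Continuous fun x => f (T' n x) := fun n => hfc.comp (hTd n).continuous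
  have hFb : ∀ n, ∀ᵐ x ∂Q, ‖f (T' n x)‖ ≤ M := fun n => by
    filter_upwards [hB] with x hx
    exact hM _ (hmem n x hx)
  have hmean : Tendsto (fun n => ∫ x, f (T' n x) ∂Q) atTop (𝓝 (∫ x, f (T x) ∂Q)) :=
    tendsto_integral_of_dominated_convergence (fun _ => M)
      (fun n => (hFc n).aestronglyMeasurable) (integrable_const _) hFb
      (ae_of_all _ fun x => (hfc.tendsto _).comp (hlim x))
  have hmb : ∀ n, ‖∫ x, f (T' n x) ∂Q‖ ≤ M := fun n => by
    simpa using norm_integral_le_of_norm_le_const (hFb n)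
  have hleft : Tendsto (fun n => evariance (fun x => f (T' n x)) Q) atTop
      (𝓝 (evariance (fun x => f (T x)) Q)) := by
    unfold evariance
    refine tendsto_lintegral_of_dominated_convergence (fun _ => ENNReal.ofReal ((2 * M) ^ 2))
      (fun n => ?_) (fun n => ?_) (by simp) (ae_of_all _ fun x => ?_)
    · exact ((hFc n).sub continuous_const).enorm.measurable.pow_const 2
    · filter_upwards [hFb n] with x hx
      rw [← ofReal_norm, ← ENNReal.ofReal_pow (norm_nonneg _)]
      apply ENNReal.ofReal_le_ofReal
      gcongr
      refine (norm_sub_le _ _).trans ?_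
      linarith [hmb n]
    · exact ((ENNReal.continuous_pow 2).tendsto _).comp
        ((((hfc.tendsto _).comp (hlim x)).sub hmean).enorm)
  have hright : Tendsto (fun n => C * (Λ ^ 2 * ∫⁻ x, ‖v (T' n x)‖ₑ ^ 2 ∂Q)) atTop
      (𝓝 (C * (Λ ^ 2 * ∫⁻ x, ‖v (T x)‖ₑ ^ 2 ∂Q))) := by
    refine ENNReal.Tendsto.const_mul (ENNReal.Tendsto.const_mul ?_ (Or.inr (by finiteness)))
      (Or.inr hCt)
    refine tendsto_lintegral_of_dominated_convergence (fun _ => ENNReal.ofReal (M' ^ 2))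
      (fun n => ?_) (fun n => ?_) (by simp) (ae_of_all _ fun x => ?_)
    · exact (hv.comp (hTd n).continuous).enorm.measurable.pow_const 2
    · filter_upwards [hB] with x hx
      rw [← ofReal_norm, ← ENNReal.ofReal_pow (norm_nonneg _)]
      apply ENNReal.ofReal_le_ofReal
      gcongr
      exact hM' _ (hmem n x hx)
    · exact ((ENNReal.continuous_pow 2).tendsto _).comp (((hv.tendsto _).comp (hlim x)).enorm)
  refine le_of_tendsto_of_tendsto' hleft hright fun n => ?_
  have hd : Differentiable ℝ fun x => f (T' n x) := fun x =>
    ((hf (T' n x)).differentiableAt).comp x (hTd n x)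
  refine (hC _ hd).trans ?_
  gcongr
  rw [← lintegral_const_mul' _ _ (by finiteness)]
  refine lintegral_mono fun x => ?_
  rw [← mul_pow]
  gcongr
  rw [← ofReal_norm, ← ofReal_norm, norm_gradient_eq,
    show ((Λ : ℝ≥0) : ℝ≥0∞) = ENNReal.ofReal Λ from (ENNReal.ofReal_coe_nnreal).symm,
    ← ENNReal.ofReal_mul (p := (Λ : ℝ)) Λ.2]
  apply ENNReal.ofReal_le_ofReal
  have hcomp : fderiv ℝ (fun x => f (T' n x)) x =
      (fderiv ℝ f (T' n x)).comp (fderiv ℝ (T' n) x) :=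
    fderiv_comp x (hf _).differentiableAt (hTd n x)
  rw [hcomp]
  refine (ContinuousLinearMap.opNorm_comp_le _ _).trans ?_
  rw [← norm_gradient_eq, (hf _).gradient, mul_comm]
  gcongr
  exact norm_fderiv_le_of_lipschitz ℝ (hTl n)

/-! ### Strong convexity and conjugation -/

/-- A twice differentiable function whose Hessian is bounded below by `α` is strongly convex. -/
lemma strongConvexOn_of_hess {d : ℕ} {D : Set (Euc d)} (hD : Convex ℝ D) (hDo : IsOpen D)
    {g : Euc d → ℝ} {α : ℝ} (hg : ∀ x ∈ D, DifferentiableAt ℝ g x)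
    (hg' : ∀ x ∈ D, DifferentiableAt ℝ (gradient g) x)
    (hH : ∀ x ∈ D, ∀ v, α * ‖v‖ ^ 2 ≤ inner ℝ (fderiv ℝ (gradient g) x v) v) :
    StrongConvexOn D α g := by
  rw [strongConvexOn_iff_convex]
  refine ⟨hD, fun x hx y hy a b ha hb hab => ?_⟩
  set f : Euc d → ℝ := fun x => g x - α / 2 * ‖x‖ ^ 2 with hf
  set v := y - x with hv
  set γ : ℝ → Euc d := fun s => x + s • v with hγ
  have hγd : ∀ s, HasDerivAt γ v s := fun s => by
    have h := ((hasDerivAt_id s).smul_const v).const_add x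
    rw [one_smul] at h
    exact h
  -- Restriction to the line through `x` and `y` reduces the claim to the sign of a second
  -- derivative in one variable.
  set O := γ ⁻¹' D with hO
  have hOo : IsOpen O := hDo.preimage (by fun_prop)
  have hOc : Convex ℝ O := by
    intro s hs t ht p q hp hq hpq
    show γ (p • s + q • t) ∈ D
    have : γ (p • s + q • t) = p • γ s + q • γ t := by
      have e : p • x + q • x = x := by rw [← add_smul, hpq, one_smul]
      simp only [hγ, smul_eq_mul, smul_add, add_smul, mul_smul]
      nth_rewrite 1 [← e]
      abel
    rw [this]
    exact hD hs ht hp hq hpq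
  have h1 : ∀ s ∈ O, HasDerivAt (fun s => f (γ s))
      (inner ℝ (gradient g (γ s)) v - α * inner ℝ (γ s) v) s := by
    intro s hs
    have e1 : HasDerivAt (fun s => g (γ s)) (inner ℝ (gradient g (γ s)) v) s := by
      have := (hg _ hs).hasFDerivAt.comp_hasDerivAt s (hγd s)
      rwa [← inner_gradient_left] at this
    have e2 : HasDerivAt (fun s => ‖γ s‖ ^ 2) (2 * inner ℝ (γ s) v) s := by
      simpa using (hγd s).norm_sq
    exact (e1.sub (e2.const_mul (α / 2))).congr_deriv (by ring)
  have h2 : ∀ s ∈ O, HasDerivAt (fun s => inner ℝ (gradient g (γ s)) v - α * inner ℝ (γ s) v)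
      (inner ℝ (fderiv ℝ (gradient g) (γ s) v) v - α * inner ℝ v v) s := by
    intro s hs
    have e1 : HasDerivAt (fun s => gradient g (γ s)) (fderiv ℝ (gradient g) (γ s) v) s :=
      (hg' _ hs).hasFDerivAt.comp_hasDerivAt s (hγd s)
    have e2 := e1.inner ℝ (hasDerivAt_const s v)
    have e3 := (hγd s).inner ℝ (hasDerivAt_const s v)
    exact (e2.sub (e3.const_mul α)).congr_deriv (by simp)
  have hd1 : ∀ s ∈ O, deriv (fun s => f (γ s)) =ᶠ[𝓝 s]
      fun s => inner ℝ (gradient g (γ s)) v - α * inner ℝ (γ s) v := fun s hs => by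
    filter_upwards [hOo.mem_nhds hs] with t ht
    exact (h1 t ht).deriv
  have hconv : ConvexOn ℝ O (fun s => f (γ s)) := by
    refine convexOn_of_deriv2_nonneg' hOc
      (fun s hs => (h1 s hs).differentiableAt.differentiableWithinAt)
      (fun s hs => ((h2 s hs).differentiableAt.congr_of_eventuallyEq
        (hd1 s hs)).differentiableWithinAt) fun s hs => ?_
    simp only [Function.iterate_succ, Function.iterate_zero, Function.comp_apply, id_eq]
    rw [(hd1 s hs).deriv_eq, (h2 s hs).deriv, real_inner_self_eq_norm_sq]
    linarith [hH _ hs v]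
  have h0 : (0 : ℝ) ∈ O := by simpa [hO, hγ] using hx
  have h1' : (1 : ℝ) ∈ O := by simpa [hO, hγ, hv] using hy
  have := hconv.2 h0 h1' ha hb hab
  have e0 : γ 0 = x := by simp [hγ]
  have e1 : γ 1 = y := by simp [hγ, hv]
  have e2 : γ (a • 0 + b • 1) = a • x + b • y := by
    have : a = 1 - b := by linarith
    simp only [hγ, hv, this, smul_eq_mul, mul_zero, mul_one, zero_add, sub_smul, one_smul, smul_sub]
    abel
  simpa only [e0, e1, e2] using this

/-- First order lower bound for strongly convex functions. -/
lemma _root_.StrongConvexOn.le_of_hasGradientAt {d : ℕ} {D : Set (Euc d)} {g : Euc d → ℝ} {α : ℝ}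
    (hg : StrongConvexOn D α g) (h0 : (0 : Euc d) ∈ D) {w : Euc d} (hw : HasGradientAt g w 0)
    {x : Euc d} (hx : x ∈ D) : g 0 + inner ℝ w x + α / 2 * ‖x‖ ^ 2 ≤ g x := by
  have hd : HasDerivAt (fun s : ℝ => g (s • x)) (inner ℝ w x) 0 := by
    have h1 : HasDerivAt (fun s : ℝ => s • x) x 0 := by
      simpa using (hasDerivAt_id (0 : ℝ)).smul_const x
    have h2 : HasFDerivAt g (InnerProductSpace.toDual ℝ (Euc d) w) ((0 : ℝ) • x) := by
      rw [zero_smul]; exact hw.hasFDerivAt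
    exact (h2.comp_hasDerivAt (0 : ℝ) h1).congr_deriv (by simp)
  have hlim := hd.tendsto_slope_zero_right
  have hlim2 : Tendsto (fun s : ℝ => g x - g 0 - (1 - s) * (α / 2 * ‖x‖ ^ 2)) (𝓝[>] 0)
      (𝓝 (g x - g 0 - (1 - 0) * (α / 2 * ‖x‖ ^ 2))) :=
    tendsto_nhdsWithin_of_tendsto_nhds (Continuous.tendsto (by fun_prop) 0)
  -- Strong convexity between `0` and `x` bounds the difference quotients along the segment; then `s
  -- → 0`.
  have hle : ∀ᶠ s : ℝ in 𝓝[>] 0, s⁻¹ • (g ((0 + s) • x) - g ((0 : ℝ) • x)) ≤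
      g x - g 0 - (1 - s) * (α / 2 * ‖x‖ ^ 2) := by
    filter_upwards [Ioo_mem_nhdsGT (show (0 : ℝ) < 1 by norm_num)] with s hs
    have h1 := hg.2 h0 hx (show 0 ≤ 1 - s by linarith [hs.2]) hs.1.le (by ring)
    simp only [smul_zero, zero_add, smul_eq_mul, zero_sub, norm_neg, zero_smul] at h1 ⊢
    rw [inv_mul_le_iff₀ hs.1]
    linarith
  have := le_of_tendsto_of_tendsto hlim hlim2 hle
  linarith

/-- Maximizers in the Legendre transform of a strongly convex function `g` on `D`, whose conjugate
is `G`: they exist in the closure of `D`, depend in a Lipschitz way on the slope and are the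
gradients of `G`. -/
lemma _root_.StrongConvexOn.exists_gradient_conj {d : ℕ} {D : Set (Euc d)} {g G : Euc d → ℝ} {α : ℝ}
    (hα : 0 < α) (hg : StrongConvexOn D α g)
    (hG : ∀ y, IsLUB ((fun x => inner ℝ x y - g x) '' D) (G y)) :
    ∃ X : Euc d → Euc d, (∀ y y', ‖X y - X y'‖ ≤ ‖y - y'‖ / α) ∧ (∀ y, HasGradientAt G (X y) y) ∧
      (∀ y, ∀ x ∈ D, inner ℝ x y - g x ≤ G y - α / 2 * ‖x - X y‖ ^ 2) ∧
      ∀ y, ∃ u : ℕ → Euc d, (∀ n, u n ∈ D) ∧ Tendsto u atTop (𝓝 (X y)) ∧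
        Tendsto (fun n => inner ℝ (u n) y - g (u n)) atTop (𝓝 (G y)) := by
  have hseq : ∀ y, ∃ u : ℕ → Euc d, (∀ n, u n ∈ D) ∧
      ∀ n : ℕ, G y - 1 / ((n : ℝ) + 1) < inner ℝ (u n) y - g (u n) := by
    intro y
    have : ∀ n : ℕ, ∃ x ∈ D, G y - 1 / ((n : ℝ) + 1) < inner ℝ x y - g x := by
      intro n
      have hpos : (0 : ℝ) < 1 / ((n : ℝ) + 1) := by positivity
      obtain ⟨_, ⟨x, hx, rfl⟩, hlt, -⟩ := (hG y).exists_between (show G y - 1 / ((n : ℝ) + 1) < G y by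
        linarith)
      exact ⟨x, hx, hlt⟩
    choose u hu hu' using this
    exact ⟨u, hu, hu'⟩
  choose u huD hul using hseq
  have hub : ∀ y, ∀ x ∈ D, inner ℝ x y - g x ≤ G y := fun y x hx => (hG y).1 ⟨x, hx, rfl⟩
  -- Used with `s = 1/2` to show that maximizing sequences are Cauchy, and with `s → 0` for
  -- quadratic decay away from the limit `X y`.
  have hcomb : ∀ y, ∀ x ∈ D, ∀ x' ∈ D, ∀ s, 0 ≤ s → s ≤ 1 →
      (1 - s) * (inner ℝ x y - g x) + s * (inner ℝ x' y - g x') +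
        (1 - s) * s * (α / 2 * ‖x - x'‖ ^ 2) ≤ G y := by
    intro y x hx x' hx' s hs0 hs1
    have h1 := hg.2 hx hx' (show 0 ≤ 1 - s by linarith) hs0 (by ring)
    have h2 := hub y _ (hg.1 hx hx' (show 0 ≤ 1 - s by linarith) hs0 (by ring))
    rw [inner_add_left, real_inner_smul_left, real_inner_smul_left] at h2
    simp only [smul_eq_mul] at h1
    linarith
  have hv : ∀ y, Tendsto (fun n => inner ℝ (u y n) y - g (u y n)) atTop (𝓝 (G y)) := by
    intro y
    refine tendsto_of_tendsto_of_tendsto_of_le_of_le ?_ tendsto_const_nhds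
      (fun n => (hul y n).le) (fun n => hub y _ (huD y n))
    simpa using (tendsto_one_div_add_atTop_nhds_zero_nat (𝕜 := ℝ)).const_sub (G y)
  have hcauchy : ∀ y, CauchySeq (u y) := by
    intro y
    refine cauchySeq_of_le_tendsto_0 (fun n : ℕ => Real.sqrt (8 / α * (1 / ((n : ℝ) + 1)))) ?_ ?_
    · intro n m N hn hm
      rw [dist_eq_norm]
      apply Real.le_sqrt_of_sq_le
      have h1 := hcomb y _ (huD y n) _ (huD y m) (1 / 2) (by norm_num) (by norm_num)
      have h2 := hul y n
      have h3 := hul y m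
      have h4 : 1 / ((n : ℝ) + 1) ≤ 1 / ((N : ℝ) + 1) := by gcongr
      have h5 : 1 / ((m : ℝ) + 1) ≤ 1 / ((N : ℝ) + 1) := by gcongr
      rw [div_mul_eq_mul_div, le_div_iff₀ hα]
      linarith
    · have := ((tendsto_one_div_add_atTop_nhds_zero_nat (𝕜 := ℝ)).const_mul (8 / α)).sqrt
      simpa using this
  choose X hX using fun y => cauchySeq_tendsto_of_complete (hcauchy y)
  have hgrow : ∀ y, ∀ x ∈ D, inner ℝ x y - g x ≤ G y - α / 2 * ‖x - X y‖ ^ 2 := by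
    intro y x hx
    have hs : ∀ s : ℝ, 0 < s → s ≤ 1 →
        inner ℝ x y - g x + (1 - s) * (α / 2 * ‖X y - x‖ ^ 2) ≤ G y := by
      intro s hs0 hs1
      have hl : Tendsto (fun n => (1 - s) * (inner ℝ (u y n) y - g (u y n)) +
          s * (inner ℝ x y - g x) + (1 - s) * s * (α / 2 * ‖u y n - x‖ ^ 2)) atTop
          (𝓝 ((1 - s) * G y + s * (inner ℝ x y - g x) +
            (1 - s) * s * (α / 2 * ‖X y - x‖ ^ 2))) :=
        (((hv y).const_mul _).add tendsto_const_nhds).add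
          (((((hX y).sub_const x).norm.pow 2).const_mul _).const_mul _)
      have := le_of_tendsto' hl fun n => hcomb y _ (huD y n) x hx s hs0.le hs1
      have h2 : s * (inner ℝ x y - g x + (1 - s) * (α / 2 * ‖X y - x‖ ^ 2)) ≤ s * G y := by linarith
      exact le_of_mul_le_mul_left h2 hs0
    have hlim : Tendsto (fun s : ℝ => inner ℝ x y - g x + (1 - s) * (α / 2 * ‖X y - x‖ ^ 2))
        (𝓝[>] 0) (𝓝 (inner ℝ x y - g x + (1 - 0) * (α / 2 * ‖X y - x‖ ^ 2))) :=
      tendsto_nhdsWithin_of_tendsto_nhds (Continuous.tendsto (by fun_prop) 0)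
    have := le_of_tendsto hlim (by
      filter_upwards [Ioc_mem_nhdsGT (show (0 : ℝ) < 1 by norm_num)] with s hs'
      exact hs s hs'.1 hs'.2)
    rw [norm_sub_rev]
    linarith
  have hshift : ∀ y y', Tendsto (fun n => inner ℝ (u y n) y' - g (u y n)) atTop
      (𝓝 (G y + inner ℝ (X y) (y' - y))) := by
    intro y y'
    have h1 : Tendsto (fun n => inner ℝ (u y n) (y' - y)) atTop (𝓝 (inner ℝ (X y) (y' - y))) :=
      (hX y).inner tendsto_const_nhds
    refine ((hv y).add h1).congr fun n => ?_
    rw [inner_sub_right]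
    ring
  -- The decay at slope `y'` is evaluated along the maximizing sequence of `y`. Exchanging `y` and
  -- `y'` and adding gives the Lipschitz bound for `X`.
  have hlow : ∀ y y', G y + inner ℝ (X y) (y' - y) ≤ G y' - α / 2 * ‖X y - X y'‖ ^ 2 := by
    intro y y'
    exact le_of_tendsto_of_tendsto' (hshift y y')
      (((((hX y).sub_const (X y')).norm.pow 2).const_mul _).const_sub _)
      fun n => hgrow y' _ (huD y n)
  have hupp : ∀ y y', G y' ≤ G y + inner ℝ (X y) (y' - y) + 1 / (2 * α) * ‖y' - y‖ ^ 2 := by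
    intro y y'
    refine (hG y').2 ?_
    rintro _ ⟨x, hx, rfl⟩
    have h1 := hgrow y x hx
    have h2 : inner ℝ x y' = inner ℝ x y + inner ℝ (X y) (y' - y) +
        inner ℝ (x - X y) (y' - y) := by
      rw [inner_sub_left, inner_sub_right, inner_sub_right]; ring
    have h3 := real_inner_le_norm (x - X y) (y' - y)
    have h4 : ‖x - X y‖ * ‖y' - y‖ ≤ α / 2 * ‖x - X y‖ ^ 2 + 1 / (2 * α) * ‖y' - y‖ ^ 2 := by
      have : α / 2 * ‖x - X y‖ ^ 2 + 1 / (2 * α) * ‖y' - y‖ ^ 2 - ‖x - X y‖ * ‖y' - y‖ =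
          1 / (2 * α) * (α * ‖x - X y‖ - ‖y' - y‖) ^ 2 := by
        field_simp; ring
      have h5 : 0 ≤ 1 / (2 * α) * (α * ‖x - X y‖ - ‖y' - y‖) ^ 2 := by positivity
      linarith
    show inner ℝ x y' - g x ≤ _
    linarith
  refine ⟨X, fun y y' => ?_, fun y => ?_, hgrow, fun y => ⟨u y, huD y, hX y, hv y⟩⟩
  · have h1 := hlow y y'
    have h2 := hlow y' y
    rw [norm_sub_rev (X y')] at h2
    have h3 : inner ℝ (X y - X y') (y - y') =
        -(inner ℝ (X y) (y' - y)) - inner ℝ (X y') (y - y') := by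
      rw [inner_sub_left, ← neg_sub y y', inner_neg_right]; ring
    have h4 := real_inner_le_norm (X y - X y') (y - y')
    rw [le_div_iff₀ hα]
    by_cases h0 : ‖X y - X y'‖ = 0
    · rw [h0, zero_mul]; positivity
    · have h5 : 0 < ‖X y - X y'‖ := lt_of_le_of_ne (norm_nonneg _) (Ne.symm h0)
      refine le_of_mul_le_mul_left ?_ h5
      nlinarith
  -- `hlow` and `hupp` squeeze `G` between its affine approximation and a quadratic perturbation of
  -- it.
  · have hO : (fun y' => G y' - (G y + inner ℝ (X y) (y' - y))) =O[𝓝 y] fun y' => ‖y' - y‖ ^ 2 := by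
      refine Asymptotics.IsBigO.of_bound (1 / (2 * α)) (Eventually.of_forall fun y' => ?_)
      have h1 := hlow y y'
      have h2 := hupp y y'
      have h3 : 0 ≤ α / 2 * ‖X y - X y'‖ ^ 2 := by positivity
      rw [Real.norm_of_nonneg (by linarith), Real.norm_of_nonneg (by positivity)]
      linarith
    have h1 := hO.hasFDerivAt (𝕜 := ℝ) (by norm_num)
    have h2 : HasFDerivAt (fun y' => G y + inner ℝ (X y) (y' - y))
        (InnerProductSpace.toDual ℝ (Euc d) (X y)) y := by
      have h3 : HasFDerivAt (fun y' => InnerProductSpace.toDual ℝ (Euc d) (X y) y')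
          (InnerProductSpace.toDual ℝ (Euc d) (X y)) y := ContinuousLinearMap.hasFDerivAt _
      refine (h3.add_const (G y - inner ℝ (X y) y)).congr_of_eventuallyEq
        (Eventually.of_forall fun y' => ?_)
      simp only [InnerProductSpace.toDual_apply_apply, inner_sub_right]
      ring
    have h3 := h1.add h2
    rw [hasGradientAt_iff_hasFDerivAt]
    simp only [zero_add] at h3
    refine h3.congr_of_eventuallyEq (Eventually.of_forall fun y' => ?_)
    simp

/-! ### Regularity of the convex members of the class and of their conjugates -/

lemma Smooth.differentiableAt {d : ℕ} {β a : ℝ} {φ : Euc d → EReal} (h : Smooth β a φ) {x : Euc d}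
    (hx : x ∈ edom φ) : DifferentiableAt ℝ (realPart φ) x := by
  rcases h with ⟨h, -⟩ | ⟨-, h, -⟩
  · exact (h x hx).1
  · exact h x hx

/-- Mean value inequality, on a convex part `s` of the domain because the domain itself need not be
convex. -/
lemma Smooth.norm_grad_sub_le {d : ℕ} {β a : ℝ} (hβ : 0 ≤ β) (ha : 0 ≤ a) {φ : Euc d → EReal}
    (h : Smooth β a φ) {s : Set (Euc d)} (hs : Convex ℝ s) (hsφ : s ⊆ edom φ) {R : ℝ}
    (hsR : ∀ x ∈ s, ‖x‖ ≤ R) {x y : Euc d} (hx : x ∈ s) (hy : y ∈ s) :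
    ‖grad φ x - grad φ y‖ ≤ β * (1 + R) ^ a * ‖x - y‖ := by
  rcases h with ⟨h, hH⟩ | ⟨rfl, -, h⟩
  · refine hs.norm_image_sub_le_of_norm_fderiv_le (𝕜 := ℝ) (fun z hz => (h z (hsφ hz)).2)
      (fun z hz => (hH z (hsφ hz)).trans ?_) hy hx
    gcongr
    exact hsR z hz
  · simpa using h x (hsφ hx) y (hsφ hy)

lemma Smooth.norm_grad_sub_grad_zero_le {d : ℕ} {β a : ℝ} (hβ : 0 ≤ β) (ha : 0 ≤ a)
    {φ : Euc d → EReal} (h : Smooth β a φ) {D : Set (Euc d)} (hD : Convex ℝ D)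
    (hDφ : D ⊆ edom φ) (h0 : (0 : Euc d) ∈ D) {x : Euc d} (hx : x ∈ D) :
    ‖grad φ x - grad φ 0‖ ≤ β * (1 + ‖x‖) ^ a * ‖x‖ := by
  have := h.norm_grad_sub_le hβ ha (hD.inter (convex_closedBall (0 : Euc d) ‖x‖))
    (inter_subset_left.trans hDφ) (R := ‖x‖) (fun z hz => by simpa using hz.2)
    (x := x) (y := 0) ⟨hx, by simp⟩ ⟨h0, by simp⟩
  simpa using this

lemma coe_realPart {d : ℕ} {φ : Euc d → EReal} (h : ∀ x, φ x ≠ ⊥) {x : Euc d} (hx : x ∈ edom φ) :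
    ((realPart φ x : ℝ) : EReal) = φ x :=
  EReal.coe_toReal (ne_of_lt hx) (h x)

lemma IsPotential.zero_mem {d : ℕ} {P : Measure (Euc d)} {φ : Euc d → EReal}
    (h : IsPotential P φ) : (0 : Euc d) ∈ edom φ := by
  show φ 0 < ⊤
  rw [h.map_zero]
  exact EReal.zero_lt_top

lemma IsPotential.realPart_zero {d : ℕ} {P : Measure (Euc d)} {φ : Euc d → EReal}
    (h : IsPotential P φ) : realPart φ 0 = 0 := by
  simp [realPart, h.map_zero]

/-- An element of `segments F φbar` is a potential which is a convex combination of two elements of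
`F` on a common subset of their domains. -/
lemma exists_of_mem_segments {d : ℕ} {P : Measure (Euc d)} {F : Set (Euc d → EReal)}
    (hF : ∀ φ ∈ F, IsPotential P φ) {φbar : Euc d → EReal} (hφbar : φbar ∈ F)
    {g : Euc d → EReal} (hg : g ∈ segments F φbar) :
    IsPotential P g ∧ ∃ φ₁ ∈ F, ∃ φ₂ ∈ F, ∃ t : ℝ, 0 ≤ t ∧ t ≤ 1 ∧ edom g ⊆ edom φ₁ ∧
      edom g ⊆ edom φ₂ ∧ ∀ x ∈ edom g, realPart g x = t * realPart φ₁ x + (1 - t) * realPart φ₂ x := by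
  obtain ⟨φ, hφ, t, ht0, ht1, rfl⟩ := hg
  -- At the endpoints `0 * ∞ = 0` removes one function together with its domain; for `0 < t < 1` the
  -- domain is the intersection.
  rcases ht0.eq_or_lt with rfl | ht0
  · have e : (fun x => ((0 : ℝ) : EReal) * φ x + ((1 - 0 : ℝ) : EReal) * φbar x) = φbar := by
      ext x; simp
    rw [e]
    exact ⟨hF _ hφbar, φbar, hφbar, φbar, hφbar, 0, le_rfl, zero_le_one, subset_rfl, subset_rfl,
      fun x _ => by ring⟩
  rcases ht1.eq_or_lt with rfl | ht1
  · have e : (fun x => ((1 : ℝ) : EReal) * φ x + ((1 - 1 : ℝ) : EReal) * φbar x) = φ := by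
      ext x; simp
    rw [e]
    exact ⟨hF _ hφ, φ, hφ, φ, hφ, 0, le_rfl, zero_le_one, subset_rfl, subset_rfl,
      fun x _ => by ring⟩
  have h1 := hF φ hφ
  have h2 := hF φbar hφbar
  have ht1' : 0 < 1 - t := by linarith
  set g : Euc d → EReal := fun x => (t : EReal) * φ x + ((1 - t : ℝ) : EReal) * φbar x with hg
  have hin : ∀ x ∈ edom φ, x ∈ edom φbar →
      g x = ((t * realPart φ x + (1 - t) * realPart φbar x : ℝ) : EReal) := by
    intro x hx hx'
    rw [hg]
    simp only
    rw [← coe_realPart h1.ne_bot hx, ← coe_realPart h2.ne_bot hx']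
    norm_cast
  have hbot1 : ∀ x, (t : EReal) * φ x ≠ ⊥ := by
    intro x
    by_cases hx : x ∈ edom φ
    · rw [← coe_realPart h1.ne_bot hx, ← EReal.coe_mul]; exact EReal.coe_ne_bot _
    · have : φ x = ⊤ := by simpa [edom] using hx
      rw [this, EReal.coe_mul_top_of_pos ht0]; simp
  have hbot2 : ∀ x, ((1 - t : ℝ) : EReal) * φbar x ≠ ⊥ := by
    intro x
    by_cases hx : x ∈ edom φbar
    · rw [← coe_realPart h2.ne_bot hx, ← EReal.coe_mul]; exact EReal.coe_ne_bot _
    · have : φbar x = ⊤ := by simpa [edom] using hx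
      rw [this, EReal.coe_mul_top_of_pos ht1']; simp
  have hdom : edom g = edom φ ∩ edom φbar := by
    ext x
    constructor
    · intro hx
      by_contra hn
      have : g x = ⊤ := by
        by_cases hx1 : x ∈ edom φ
        · have hx2 : φbar x = ⊤ := by
            by_contra h
            exact hn ⟨hx1, lt_top_iff_ne_top.2 h⟩
          rw [hg]
          simp only
          rw [hx2, EReal.coe_mul_top_of_pos ht1', EReal.add_top_of_ne_bot (hbot1 x)]
        · have hx2 : φ x = ⊤ := by simpa [edom] using hx1
          rw [hg]
          simp only
          rw [hx2, EReal.coe_mul_top_of_pos ht0, EReal.top_add_of_ne_bot (hbot2 x)]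
      have hx' : g x < ⊤ := hx
      simp [this] at hx'
    · rintro ⟨hx1, hx2⟩
      show g x < ⊤
      rw [hin x hx1 hx2]
      exact EReal.coe_lt_top _
  refine ⟨⟨fun x => ?_, ?_, ?_, ?_⟩, φ, hφ, φbar, hφbar, t, ht0.le, ht1.le, ?_, ?_, fun x hx => ?_⟩
  · exact fun h => (EReal.add_eq_bot_iff.1 h).elim (hbot1 x) (hbot2 x)
  · simp [hg, h1.map_zero, h2.map_zero]
  · rw [hdom]; exact h1.isOpen_edom.inter h2.isOpen_edom
  · rw [hdom]; exact subset_inter h1.support_subset h2.support_subset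
  · rw [hdom]; exact inter_subset_left
  · rw [hdom]; exact inter_subset_right
  · rw [hdom] at hx
    rw [realPart, hin x hx.1 hx.2, EReal.toReal_coe]

/-- The regularity shared by the convex elements of `segments F φbar`. -/
structure RegularConvex {d : ℕ} (P : Measure (Euc d)) (β a α : ℝ) (g : Euc d → EReal) : Prop where
  isPotential : IsPotential P g
  differentiableAt : ∀ x ∈ edom g, DifferentiableAt ℝ (realPart g) x
  norm_grad_sub_le : ∀ x ∈ edom g, ‖grad g x - grad g 0‖ ≤ β * (1 + ‖x‖) ^ a * ‖x‖
  strongConvexOn : StrongConvexOn (edom g) α (realPart g)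

lemma StrConvex.strongConvexOn {d : ℕ} {α a : ℝ} (hα : 0 < α) (ha : 0 ≤ a) {g : Euc d → EReal}
    (hgo : IsOpen (edom g)) (h : StrConvex α a g) : StrongConvexOn (edom g) α (realPart g) := by
  rcases h with ⟨hc, hd, hH⟩ | ⟨-, h⟩
  · refine strongConvexOn_of_hess hc hgo (fun x hx => (hd x hx).1) (fun x hx => (hd x hx).2)
      fun x hx v => le_trans ?_ (hH x hx v)
    have : 1 ≤ (1 + ‖x‖) ^ a := Real.one_le_rpow (by linarith [norm_nonneg x]) ha
    have h2 : 0 ≤ α * ‖v‖ ^ 2 := by positivity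
    calc α * ‖v‖ ^ 2 = 1 * (α * ‖v‖ ^ 2) := (one_mul _).symm
      _ ≤ (1 + ‖x‖) ^ a * (α * ‖v‖ ^ 2) := by gcongr
      _ = _ := by ring
  · exact h

/-- The gradient bounds of the two combined functions hold along `edom g`, which is convex and
contained in both domains, and they survive convex combination. -/
lemma regularConvex_of_mem_segments {d : ℕ} {P : Measure (Euc d)} {β a α : ℝ} (hβ : 0 ≤ β)
    (ha : 0 ≤ a) (hα : 0 < α) {F : Set (Euc d → EReal)}
    (hF : ∀ φ ∈ F, IsPotential P φ ∧ Smooth β a φ) {φbar : Euc d → EReal} (hφbar : φbar ∈ F)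
    {g : Euc d → EReal} (hg : g ∈ segments F φbar) (hgc : StrConvex α a g) :
    RegularConvex P β a α g := by
  obtain ⟨hpot, φ₁, h1, φ₂, h2, t, ht0, ht1, hd1, hd2, heq⟩ :=
    exists_of_mem_segments (fun φ hφ => (hF φ hφ).1) hφbar hg
  have hsc := hgc.strongConvexOn hα ha hpot.isOpen_edom
  have hgrad : ∀ x ∈ edom g, HasGradientAt (realPart g)
      (t • grad φ₁ x + (1 - t) • grad φ₂ x) x := by
    intro x hx
    have e1 := ((hF _ h1).2.differentiableAt (hd1 hx)).hasGradientAt.hasFDerivAt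
    have e2 := ((hF _ h2).2.differentiableAt (hd2 hx)).hasGradientAt.hasFDerivAt
    have e3 := (e1.const_mul t).add (e2.const_mul (1 - t))
    rw [hasGradientAt_iff_hasFDerivAt]
    rw [map_add, map_smul, map_smul]
    refine e3.congr_of_eventuallyEq ?_
    filter_upwards [hpot.isOpen_edom.mem_nhds hx] with y hy
    exact heq y hy
  refine ⟨hpot, fun x hx => (hgrad x hx).differentiableAt, fun x hx => ?_, hsc⟩
  have g1 : grad g x = _ := (hgrad x hx).gradient
  have g0 : grad g 0 = _ := (hgrad 0 hpot.zero_mem).gradient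
  rw [g1, g0]
  have b1 := (hF _ h1).2.norm_grad_sub_grad_zero_le hβ ha hsc.1 hd1 hpot.zero_mem hx
  have b2 := (hF _ h2).2.norm_grad_sub_grad_zero_le hβ ha hsc.1 hd2 hpot.zero_mem hx
  have e : t • grad φ₁ x + (1 - t) • grad φ₂ x - (t • grad φ₁ 0 + (1 - t) • grad φ₂ 0) =
      t • (grad φ₁ x - grad φ₁ 0) + (1 - t) • (grad φ₂ x - grad φ₂ 0) := by
    rw [smul_sub, smul_sub]; abel
  rw [e]
  have ht1' : 0 ≤ 1 - t := by linarith
  calc ‖t • (grad φ₁ x - grad φ₁ 0) + (1 - t) • (grad φ₂ x - grad φ₂ 0)‖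
      ≤ t * ‖grad φ₁ x - grad φ₁ 0‖ + (1 - t) * ‖grad φ₂ x - grad φ₂ 0‖ := by
        refine (norm_add_le _ _).trans_eq ?_
        rw [norm_smul, norm_smul, Real.norm_of_nonneg ht0, Real.norm_of_nonneg ht1']
    _ ≤ t * (β * (1 + ‖x‖) ^ a * ‖x‖) + (1 - t) * (β * (1 + ‖x‖) ^ a * ‖x‖) := by gcongr
    _ = _ := by ring

namespace RegularConvex

variable {d : ℕ} {P : Measure (Euc d)} {β a α : ℝ} {g : Euc d → EReal}

lemma hasGradientAt (h : RegularConvex P β a α g) {x : Euc d} (hx : x ∈ edom g) :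
    HasGradientAt (realPart g) (grad g x) x :=
  (h.differentiableAt x hx).hasGradientAt

/-- Mean value inequality for `g` minus its linear part at `0`. The bound involves only `β` and `a`,
so all the freedom in the size of `g` sits in `grad g 0`. -/
lemma abs_sub_inner_le (hβ : 0 ≤ β) (ha : 0 ≤ a) (h : RegularConvex P β a α g) {x : Euc d}
    (hx : x ∈ edom g) : |realPart g x - inner ℝ (grad g 0) x| ≤ β * (1 + ‖x‖) ^ (a + 2) := by
  have h0 := h.isPotential.zero_mem
  have hs : Convex ℝ (edom g ∩ Metric.closedBall 0 ‖x‖) :=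
    h.strongConvexOn.1.inter (convex_closedBall _ _)
  have key := hs.norm_image_sub_le_of_norm_hasFDerivWithin_le'
    (f := realPart g) (f' := fun z => InnerProductSpace.toDual ℝ (Euc d) (grad g z))
    (φ := InnerProductSpace.toDual ℝ (Euc d) (grad g 0)) (C := β * (1 + ‖x‖) ^ a * ‖x‖)
    (fun z hz => (h.hasGradientAt hz.1).hasFDerivAt.hasFDerivWithinAt)
    (fun z hz => by
      have hz2 : ‖z‖ ≤ ‖x‖ := by simpa using hz.2
      rw [← map_sub, LinearIsometryEquiv.norm_map]
      refine (h.norm_grad_sub_le z hz.1).trans ?_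
      gcongr)
    (x := 0) (y := x) ⟨h0, by simp⟩ ⟨hx, by simp⟩
  rw [h.isPotential.realPart_zero] at key
  simp only [sub_zero, InnerProductSpace.toDual_apply_apply, Real.norm_eq_abs] at key
  refine key.trans ?_
  rw [Real.rpow_add (by positivity), mul_assoc, mul_assoc, Real.rpow_two]
  gcongr
  nlinarith [norm_nonneg x]

/-- The conjugate is finite, nonnegative, of quadratic growth, and it is a least upper bound of
real numbers. -/
lemma conj_spec (hα : 0 < α) (h : RegularConvex P β a α g) (y : Euc d) :
    IsLUB ((fun x => inner ℝ x y - realPart g x) '' edom g) (realPart (conj g) y) ∧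
      0 ≤ realPart (conj g) y ∧ realPart (conj g) y ≤ ‖y - grad g 0‖ ^ 2 / (2 * α) := by
  have h0 := h.isPotential.zero_mem
  have hterm : ∀ x ∈ edom g, ((inner ℝ x y : ℝ) : EReal) - g x =
      ((inner ℝ x y - realPart g x : ℝ) : EReal) := by
    intro x hx
    rw [← coe_realPart h.isPotential.ne_bot hx]
    norm_cast
  have hbd : ∀ x ∈ edom g, inner ℝ x y - realPart g x ≤ ‖y - grad g 0‖ ^ 2 / (2 * α) := by
    intro x hx
    have h1 := h.strongConvexOn.le_of_hasGradientAt h0 (h.hasGradientAt h0) hx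
    rw [h.isPotential.realPart_zero] at h1
    have h2 : inner ℝ x y = inner ℝ (grad g 0) x + inner ℝ (y - grad g 0) x := by
      rw [inner_sub_left, real_inner_comm]; ring
    have h3 := real_inner_le_norm (y - grad g 0) x
    rw [le_div_iff₀ (by positivity)]
    nlinarith [sq_nonneg (α * ‖x‖ - ‖y - grad g 0‖), norm_nonneg x]
  have hle : ∀ c : ℝ, (∀ x ∈ edom g, inner ℝ x y - realPart g x ≤ c) → conj g y ≤ (c : EReal) := by
    intro c hc
    refine iSup_le fun x => ?_
    by_cases hx : x ∈ edom g
    · rw [hterm x hx]; exact_mod_cast hc x hx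
    · have : g x = ⊤ := by simpa [edom] using hx
      simp [this]
  have hge : ∀ x ∈ edom g, ((inner ℝ x y - realPart g x : ℝ) : EReal) ≤ conj g y := by
    intro x hx
    rw [← hterm x hx]
    exact le_iSup (fun x : Euc d => ((inner ℝ x y : ℝ) : EReal) - g x) x
  have hcoe : ((realPart (conj g) y : ℝ) : EReal) = conj g y := by
    apply EReal.coe_toReal
    · exact ((hle _ hbd).trans_lt (EReal.coe_lt_top _)).ne
    · exact ((EReal.bot_lt_coe _).trans_le (hge 0 h0)).ne'
  have hlub : IsLUB ((fun x => inner ℝ x y - realPart g x) '' edom g) (realPart (conj g) y) := by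
    constructor
    · rintro _ ⟨x, hx, rfl⟩
      have := hge x hx
      rw [← hcoe] at this
      exact_mod_cast this
    · intro c hc
      have := hle c fun x hx => hc ⟨x, hx, rfl⟩
      rw [← hcoe] at this
      exact_mod_cast this
  refine ⟨hlub, ?_, hlub.2 ?_⟩
  · have := hlub.1 ⟨0, h0, rfl⟩
    simpa [h.isPotential.realPart_zero] using this
  · rintro _ ⟨x, hx, rfl⟩
    exact hbd x hx

lemma hasGradientAt_conj (hα : 0 < α) (h : RegularConvex P β a α g) (y : Euc d) :
    HasGradientAt (realPart (conj g)) (grad (conj g) y) y := by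
  obtain ⟨X, -, hX, -⟩ := h.strongConvexOn.exists_gradient_conj hα fun y => (h.conj_spec hα y).1
  exact (hX y).differentiableAt.hasGradientAt

lemma norm_grad_conj_sub_le (hα : 0 < α) (h : RegularConvex P β a α g) (y y' : Euc d) :
    ‖grad (conj g) y - grad (conj g) y'‖ ≤ ‖y - y'‖ / α := by
  obtain ⟨X, hXl, hX, -⟩ := h.strongConvexOn.exists_gradient_conj hα fun y => (h.conj_spec hα y).1
  have e : grad (conj g) = X := gradient_eq hX
  rw [e]
  exact hXl y y'

lemma continuous_grad_conj (hα : 0 < α) (h : RegularConvex P β a α g) :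
    Continuous (grad (conj g)) := by
  have : LipschitzWith (1 / α).toNNReal (grad (conj g)) := by
    refine LipschitzWith.of_dist_le_mul fun y y' => ?_
    rw [Real.coe_toNNReal _ (by positivity), dist_eq_norm, dist_eq_norm]
    exact (h.norm_grad_conj_sub_le hα y y').trans_eq (by ring)
  exact this.continuous

/-- The gradient at the origin is controlled by the minimizer when the domain is the whole space. -/
lemma norm_grad_zero_le (hα : 0 < α) (h : RegularConvex P β a α g) (hdom : edom g = univ) :
    ‖grad g 0‖ ≤ β * (1 + ‖grad (conj g) 0‖) ^ a * ‖grad (conj g) 0‖ := by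
  obtain ⟨X, -, hX, hgrow, hu⟩ :=
    h.strongConvexOn.exists_gradient_conj hα fun y => (h.conj_spec hα y).1
  have e : grad (conj g) = X := gradient_eq hX
  rw [e]
  -- The full domain guarantees that the limit `X 0` of a minimizing sequence is a point where `g`
  -- is differentiable, hence a critical point.
  have hmem : ∀ x, x ∈ edom g := fun x => by rw [hdom]; trivial
  obtain ⟨u, -, hu1, hu2⟩ := hu 0
  have hcont : Tendsto (fun n => realPart g (u n)) atTop (𝓝 (realPart g (X 0))) :=
    (h.hasGradientAt (hmem (X 0))).continuousAt.tendsto.comp hu1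
  have hval : realPart g (X 0) = -realPart (conj g) 0 := by
    have h1 : Tendsto (fun n => inner ℝ (u n) 0 - realPart g (u n)) atTop
        (𝓝 (-realPart g (X 0))) := hcont.neg.congr fun n => by simp
    have := tendsto_nhds_unique hu2 h1
    linarith
  have hmin : IsLocalMin (realPart g) (X 0) := by
    refine Eventually.of_forall fun x => ?_
    have := hgrow 0 x (hmem x)
    rw [inner_zero_right] at this
    have h2 : 0 ≤ α / 2 * ‖x - X 0‖ ^ 2 := by positivity
    linarith
  have hz : grad g (X 0) = 0 := by
    simp [grad, gradient, hmin.fderiv_eq_zero]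
  have := h.norm_grad_sub_le (X 0) (hmem _)
  rwa [hz, zero_sub, norm_neg] at this

end RegularConvex

/-! ### Integrability and coding of linear functions -/

lemma lintegral_sq_le_of_eLpNorm_le {d : ℕ} {E : Type*} [NormedAddCommGroup E]
    {P : Measure (Euc d)} {f : Euc d → E} {t : ℝ} (ht : 0 ≤ t)
    (h : eLpNorm f 2 P ≤ ENNReal.ofReal t) :
    ∫⁻ x, ‖f x‖ₑ ^ 2 ∂P ≤ ENNReal.ofReal (t ^ 2) := by
  have h1 : eLpNorm f 2 P ^ 2 = ∫⁻ x, ‖f x‖ₑ ^ 2 ∂P := by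
    have := eLpNorm_nnreal_pow_eq_lintegral (p := 2) (f := f) (μ := P) (by norm_num)
    simpa using this
  rw [← h1, ENNReal.ofReal_pow ht]
  gcongr

lemma eLpNorm_sub_le_two {d : ℕ} {P : Measure (Euc d)} {u v w : Euc d → Euc d} {t : ℝ}
    (ht : 0 ≤ t) (hu : Measurable u) (hv : Measurable v) (hw : Measurable w)
    (h1 : eLpNorm (fun x => u x - w x) 2 P ≤ ENNReal.ofReal t)
    (h2 : eLpNorm (fun x => v x - w x) 2 P ≤ ENNReal.ofReal t) :
    eLpNorm (fun x => u x - v x) 2 P ≤ ENNReal.ofReal (2 * t) := by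
  have e : (fun x => u x - v x) = (fun x => u x - w x) - fun x => v x - w x := by
    ext1 x; simp
  rw [e, two_mul, ENNReal.ofReal_add ht ht]
  exact (eLpNorm_sub_le (hu.sub hw).aestronglyMeasurable (hv.sub hw).aestronglyMeasurable
    (by norm_num)).trans (add_le_add h1 h2)

lemma memLp_one_add_norm_rpow {d : ℕ} {P : Measure (Euc d)}
    (hexp : ∃ c : ℝ, 0 < c ∧ ∫⁻ x, ENNReal.ofReal (Real.exp (c * ‖x‖)) ∂P ≠ ⊤) (k : ℝ) :
    MemLp (fun x : Euc d => (1 + ‖x‖) ^ k) 2 P := by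
  have hm : Measurable fun x : Euc d => (1 + ‖x‖) ^ k := by fun_prop
  refine ⟨hm.aestronglyMeasurable, ?_⟩
  rw [eLpNorm_lt_top_iff_lintegral_rpow_enorm_lt_top (by norm_num) (by norm_num)]
  refine lt_of_le_of_lt ?_ (lt_top_iff_ne_top.2 (lintegral_rpow_ne_top hexp (k * 2)))
  refine lintegral_mono fun x => ?_
  rw [Real.rpow_mul (by positivity), ← ofReal_norm, Real.norm_of_nonneg (by positivity),
    ENNReal.ofReal_rpow_of_nonneg (by positivity) (by norm_num)]
  simp

lemma memLp_of_abs_le {d : ℕ} {P : Measure (Euc d)}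
    (hexp : ∃ c : ℝ, 0 < c ∧ ∫⁻ x, ENNReal.ofReal (Real.exp (c * ‖x‖)) ∂P ≠ ⊤) {E : Type*}
    [NormedAddCommGroup E] {M k : ℝ} {f : Euc d → E} (hf : AEStronglyMeasurable f P)
    (h : ∀ᵐ x ∂P, ‖f x‖ ≤ M * (1 + ‖x‖) ^ k) : MemLp f 2 P :=
  ((memLp_one_add_norm_rpow hexp k).const_mul M).mono' hf h

lemma Coded.of_isEmpty {d : ℕ} {P : Measure (Euc d)} {X : Type} [IsEmpty X] {u : X → Euc d → ℝ}
    {h n : ℝ} : Coded P u h n :=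
  ⟨Empty, inferInstance, isEmptyElim, by simp [Real.exp_nonneg], fun x => isEmptyElim x⟩

/-- Allows a fixed reference function to be subtracted before coding. -/
lemma Coded.congr_sub {d : ℕ} {P : Measure (Euc d)} {X : Type} {u v : X → Euc d → ℝ} {h n : ℝ}
    (hu : Coded P u h n) (huv : ∀ x y, v x - v y = u x - u y) : Coded P v h n := by
  obtain ⟨ι, hι, code, hc, hd⟩ := hu
  exact ⟨ι, hι, code, hc, fun x y hxy => by rw [huv]; exact hd x y hxy⟩

/-- Each coordinate of `v` is rounded. The crude bound `log x ≤ x - 1` on the count suffices, since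
a cost linear in `V / h` is affordable. -/
lemma coded_linear {d : ℕ} {P : Measure (Euc d)} {X : Type} {v : X → Euc d} {V μ h : ℝ}
    (hV : 0 ≤ V) (hμ : 0 < μ) (hh : 0 < h) (hv : ∀ x, ‖v x‖ ≤ V)
    (hPμ : eLpNorm (fun z : Euc d => z) 2 P ≤ ENNReal.ofReal μ) :
    Coded P (fun x z => inner ℝ (v x) z) h (d * (2 * V * ((d + 1) * μ) / h + 1)) := by
  -- `d + 1` dominates the factor `√d` between coordinates and norm, and is positive also for `d =
  -- 0`.
  set δ := h / ((d + 1) * μ) with hδ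
  have hδ0 : 0 < δ := by positivity
  obtain ⟨ι, hι, code, hc, hd⟩ := exists_code_coeff (fun x (i : Fin d) => v x i) hV hδ0
    (fun x i => (by simpa using PiLp.norm_apply_le (v x) i : |v x i| ≤ ‖v x‖).trans (hv x))
  refine ⟨ι, hι, code, hc.trans (Real.exp_le_exp.2 ?_), fun x y hxy => ?_⟩
  · rw [Fintype.card_fin]
    gcongr
    have h0 : 0 ≤ 2 * V / δ := by positivity
    have h1 := Real.log_le_sub_one_of_pos (show 0 < 2 * V / δ + 2 by linarith)
    have h2 : 2 * V * ((d + 1) * μ) / h = 2 * V / δ := by rw [hδ]; field_simp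
    rw [h2]
    linarith
  · have hn : ‖v x - v y‖ ≤ (d + 1) * δ := by
      refine le_of_sq_le_sq ?_ (by positivity)
      rw [EuclideanSpace.norm_sq_eq]
      calc ∑ i, ‖(v x - v y) i‖ ^ 2 ≤ ∑ _i : Fin d, δ ^ 2 := by
            refine Finset.sum_le_sum fun i _ => ?_
            gcongr
            simpa using hd x y hxy i
        _ = d * δ ^ 2 := by simp
        _ ≤ ((d + 1) * δ) ^ 2 := by
            have : (0 : ℝ) ≤ d := d.cast_nonneg
            rw [mul_pow]
            gcongr
            nlinarith
    have h1 : eLpNorm ((fun z => inner ℝ (v x) z) - fun z => inner ℝ (v y) z) 2 P ≤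
        ENNReal.ofReal ((d + 1) * δ) * eLpNorm (fun z : Euc d => z) 2 P := by
      refine eLpNorm_le_mul_eLpNorm_of_ae_le_mul (ae_of_all _ fun z => ?_) _
      simp only [Pi.sub_apply]
      rw [← inner_sub_left]
      exact (norm_inner_le_norm _ _).trans (by gcongr)
    refine h1.trans ?_
    calc ENNReal.ofReal ((d + 1) * δ) * eLpNorm (fun z : Euc d => z) 2 P
        ≤ ENNReal.ofReal ((d + 1) * δ) * ENNReal.ofReal μ := by gcongr
      _ = ENNReal.ofReal h := by
        rw [← ENNReal.ofReal_mul (by positivity)]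
        congr 1
        rw [hδ]
        have : (d : ℝ) + 1 ≠ 0 := by positivity
        field_simp

lemma logPlus_mul_le {c h : ℝ} (hc : 1 ≤ c) (hh : 0 < h) :
    logPlus (1 / (h / c)) ≤ (1 + Real.log c) * logPlus (1 / h) := by
  have h1 := one_le_logPlus (1 / h)
  have h2 := Real.log_nonneg hc
  have h3 := log_le_logPlus (1 / h)
  refine max_le (by nlinarith) ?_
  have e : 1 / (h / c) = c * (1 / h) := by field_simp
  rw [e, Real.log_mul (by positivity) (by positivity)]
  nlinarith

namespace RegularConvex

variable {d : ℕ} {P : Measure (Euc d)} {β a α : ℝ} {g : Euc d → EReal}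

lemma aestronglyMeasurable (h : RegularConvex P β a α g) :
    AEStronglyMeasurable (realPart g) P := by
  have hc : ContinuousOn (realPart g) (edom g) := fun x hx =>
    (h.differentiableAt x hx).continuousAt.continuousWithinAt
  have := hc.aestronglyMeasurable (μ := P) h.isPotential.isOpen_edom.measurableSet
  rwa [Measure.restrict_eq_self_of_ae_mem] at this
  filter_upwards [Measure.support_mem_ae (μ := P)] with x hx
  exact h.isPotential.support_subset hx

lemma memLp (hβ : 0 ≤ β) (ha : 0 ≤ a)
    (hexp : ∃ c : ℝ, 0 < c ∧ ∫⁻ x, ENNReal.ofReal (Real.exp (c * ‖x‖)) ∂P ≠ ⊤)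
    (h : RegularConvex P β a α g) : MemLp (realPart g) 2 P := by
  refine memLp_of_abs_le hexp (M := ‖grad g 0‖ + β) (k := a + 2) h.aestronglyMeasurable ?_
  filter_upwards [Measure.support_mem_ae (μ := P)] with x hx
  have h1 := h.abs_sub_inner_le hβ ha (h.isPotential.support_subset hx)
  have h2 := abs_real_inner_le_norm (grad g 0) x
  have h3 : ‖x‖ ≤ (1 + ‖x‖) ^ (a + 2) := by
    calc ‖x‖ ≤ (1 + ‖x‖) ^ (1 : ℝ) := by rw [Real.rpow_one]; linarith
      _ ≤ _ := Real.rpow_le_rpow_of_exponent_le (by linarith [norm_nonneg x]) (by linarith)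
  have h4 : |realPart g x| ≤ |realPart g x - inner ℝ (grad g 0) x| + |inner ℝ (grad g 0) x| := by
    have := abs_add_le (realPart g x - inner ℝ (grad g 0) x) (inner ℝ (grad g 0) x)
    simpa using this
  have h5 : ‖grad g 0‖ * ‖x‖ ≤ ‖grad g 0‖ * (1 + ‖x‖) ^ (a + 2) := by gcongr
  rw [Real.norm_eq_abs]
  linarith

lemma norm_grad_sub_le' (hβ : 0 ≤ β) (h : RegularConvex P β a α g) {x : Euc d} (hx : x ∈ edom g) :
    ‖grad g x - grad g 0‖ ≤ β * (1 + ‖x‖) ^ (a + 1) := by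
  refine (h.norm_grad_sub_le x hx).trans ?_
  rw [Real.rpow_add (by positivity), Real.rpow_one, mul_assoc]
  gcongr
  linarith

end RegularConvex

/-! ### Entropy of balls of potentials -/

lemma RegularConvex.hasGradientAt_sub_sub {d : ℕ} {P : Measure (Euc d)} {β a α : ℝ}
    {g g₀ : Euc d → EReal} (h : RegularConvex P β a α g) (h₀ : RegularConvex P β a α g₀)
    (b : Euc d) {z : Euc d} (hz : z ∈ edom g ∩ edom g₀) :
    HasGradientAt (fun z => realPart g z - realPart g₀ z - inner ℝ b z)
      (grad g z - grad g₀ z - b) z := by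
  have e1 := (h.hasGradientAt hz.1).hasFDerivAt
  have e2 := (h₀.hasGradientAt hz.2).hasFDerivAt
  have e3 : HasFDerivAt (fun y => InnerProductSpace.toDual ℝ (Euc d) b y)
      (InnerProductSpace.toDual ℝ (Euc d) b) z := ContinuousLinearMap.hasFDerivAt _
  rw [hasGradientAt_iff_hasFDerivAt, map_sub, map_sub]
  exact (e1.sub e2).sub e3

/-- Entropy of differences of regular convex functions, up to linear functions. -/
lemma exists_coded_differences {d : ℕ} {P : Measure (Euc d)} [IsProbabilityMeasure P]
    (hP : Poincare P) (hLP : LocalPoincare P) {m : ℝ} (hm : 0 ≤ m) (hS : SupportGrowth P m)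
    {β a α : ℝ} (ha : 0 ≤ a) :
    ∃ C p : ℝ, 0 ≤ C ∧ 0 ≤ p ∧ ∀ {X : Type} (g : X → Euc d → EReal) (g₀ : Euc d → EReal)
      (b : X → Euc d) (M T h : ℝ), 1 ≤ M → 0 ≤ T → 0 < h →
      (∀ x, RegularConvex P β a α (g x)) → RegularConvex P β a α g₀ →
      (∀ x, ∀ z ∈ P.support, |realPart (g x) z - realPart g₀ z - inner ℝ (b x) z| ≤
        M * (1 + ‖z‖) ^ (a + 2)) →
      (∀ x, eLpNorm (fun z => grad (g x) z - grad g₀ z - b x) 2 P ≤ ENNReal.ofReal T) →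
      Coded P (fun x z => realPart (g x) z - realPart g₀ z - inner ℝ (b x) z) h
        (C * (logPlus (1 / h) + Real.log M) ^ p * (max 1 (T / h)) ^ m) := by
  obtain ⟨K, θ, κ, hθ, hκ, hloc⟩ := hLP
  obtain ⟨C, p, hC, hp, hcod⟩ := exists_coded_bound hP.exp_moment hm hS K hθ hκ le_rfl
    (show 0 ≤ a + 2 by linarith)
  refine ⟨C, p, hC, hp, fun {X} g g₀ b M T h hM hT hh hg hg₀ hb hbT => ?_⟩
  have hsub : ∀ x, P.support ⊆ edom (g x) ∩ edom g₀ := fun x =>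
    subset_inter (hg x).isPotential.support_subset hg₀.isPotential.support_subset
  refine hcod _ (fun x z => ‖gradient (fun z => realPart (g x) z - realPart g₀ z -
    inner ℝ (b x) z) z‖ₑ ^ 2) M T h hM hT hh (fun x => ?_) (fun x => ?_) hb (fun x => ?_)
    fun x R r hR hr _ hrκ z hz => ?_
  · exact ((hg x).aestronglyMeasurable.sub hg₀.aestronglyMeasurable).sub
      (by fun_prop : Continuous fun z : Euc d => inner ℝ (b x) z).aestronglyMeasurable
  · exact (measurable_gradient _).enorm.pow_const 2
  · refine le_trans (lintegral_mono_ae ?_) (lintegral_sq_le_of_eLpNorm_le hT (hbT x))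
    filter_upwards [Measure.support_mem_ae (μ := P)] with z hz
    rw [((hg x).hasGradientAt_sub_sub hg₀ (b x) (hsub x hz)).gradient]
  · rw [Real.rpow_zero, mul_one]
    exact evariance_le_of_differentiable_near ProbabilityTheory.cond_absolutelyContinuous
      (hloc R hR r hr hrκ z hz)
      ((hg x).isPotential.isOpen_edom.inter hg₀.isPotential.isOpen_edom) (hsub x)
      fun z hz => ((hg x).hasGradientAt_sub_sub hg₀ (b x) hz).differentiableAt

lemma max_one_div_rpow_le {m c τ h : ℝ} (hm : 0 ≤ m) (hc : 1 ≤ c) (hh : 0 < h) (hτ : h < τ) {t : ℝ}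
    (ht : t ≤ c * (τ / h)) : (max 1 t) ^ m ≤ c ^ m * (h / τ) ^ (-m) := by
  have hτ0 : 0 < τ := hh.trans hτ
  have h1 : 1 ≤ τ / h := (one_le_div hh).2 hτ.le
  have h2 : (h / τ) ^ (-m) = (τ / h) ^ m := by
    rw [Real.rpow_neg (by positivity), ← Real.inv_rpow (by positivity), inv_div]
  rw [h2, ← Real.mul_rpow (by positivity) (by positivity)]
  apply Real.rpow_le_rpow (by positivity) _ hm
  exact max_le (by nlinarith) ht

lemma linear_count_le {d : ℕ} {c μ τ h : ℝ} (hc : 0 ≤ c) (hμ : 0 ≤ μ) (hh : 0 < h)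
    (hτ1 : 1 ≤ τ) (hτh : 1 ≤ τ / h) :
    (d : ℝ) * (2 * (2 * τ + c) * ((d + 1) * μ) / (h / 4) + 1) ≤
      d * (2 * (2 + c) * ((d + 1) * μ) * 4 + 1) * (τ / h) := by
  have h1 : 2 * τ + c ≤ (2 + c) * τ := by nlinarith
  calc (d : ℝ) * (2 * (2 * τ + c) * ((d + 1) * μ) / (h / 4) + 1)
      ≤ d * (2 * ((2 + c) * τ) * ((d + 1) * μ) / (h / 4) + τ / h) := by gcongr
    _ = _ := by field_simp

set_option maxHeartbeats 1000000 in
/-- Entropy of localized balls of strongly convex potentials. -/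
lemma exists_l2Entropy_gradBall_le {d : ℕ} {P : Measure (Euc d)} [IsProbabilityMeasure P]
    (hP : Poincare P) (hLP : LocalPoincare P) {m : ℝ} (hm : 1 ≤ m) (hS : SupportGrowth P m)
    {β a α : ℝ} (hβ : 0 ≤ β) (ha : 0 ≤ a) :
    ∃ C p : ℝ, ∀ (G : Set (Euc d → EReal)) (φbar : Euc d → EReal),
      (∀ g ∈ G, RegularConvex P β a α g) → ∀ τ h : ℝ, 0 < h → h < τ →
        l2Entropy P h (gradBall P G φbar τ) ≤
          ((C * logPlus (1 / h) ^ p * (h / τ) ^ (-m) : ℝ) : EReal) := by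
  obtain ⟨C, p, hC, hp, hcod⟩ := exists_coded_differences (α := α) hP hLP
    (show 0 ≤ m by linarith) hS (β := β) ha
  have hexp := hP.exp_moment
  set c₁ : ℝ := (eLpNorm (fun x : Euc d => 2 * β * (1 + ‖x‖) ^ (a + 1)) 2 P).toReal with hc₁
  have hmem1 : MemLp (fun x : Euc d => 2 * β * (1 + ‖x‖) ^ (a + 1)) 2 P :=
    (memLp_one_add_norm_rpow hexp (a + 1)).const_mul _
  have hc₁' : eLpNorm (fun x : Euc d => 2 * β * (1 + ‖x‖) ^ (a + 1)) 2 P = ENNReal.ofReal c₁ :=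
    (ENNReal.ofReal_toReal hmem1.2.ne).symm
  have hc₁0 : 0 ≤ c₁ := ENNReal.toReal_nonneg
  set μ : ℝ := (eLpNorm (fun z : Euc d => z) 2 P).toReal + 1 with hμ
  have hμ0 : 0 < μ := by positivity
  have hmemid : MemLp (fun z : Euc d => z) 2 P := by
    refine memLp_of_abs_le hexp (M := 1) (k := 1) (by fun_prop) (ae_of_all _ fun z => ?_)
    rw [Real.rpow_one]
    linarith
  have hPμ : eLpNorm (fun z : Euc d => z) 2 P ≤ ENNReal.ofReal μ := by
    rw [← ENNReal.ofReal_toReal hmemid.2.ne]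
    exact ENNReal.ofReal_le_ofReal (by linarith)
  set M₁ := 2 + c₁ + 2 * β with hM₁
  have hM₁1 : 1 ≤ M₁ := by linarith
  set M₂ := 1 + 2 * β with hM₂
  have hM₂1 : 1 ≤ M₂ := by linarith
  have hlM₁ := Real.log_nonneg hM₁1
  have hlM₂ := Real.log_nonneg hM₂1
  have hl2 : (0 : ℝ) ≤ Real.log 2 := Real.log_nonneg (by norm_num)
  have hl4 : (0 : ℝ) ≤ Real.log 4 := Real.log_nonneg (by norm_num)
  set B₁ := C * (1 + Real.log 2 + Real.log M₁) ^ p * 4 ^ m with hB₁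
  set B₂ := C * (1 + Real.log 4 + Real.log M₂) ^ p * (1 + 4 * c₁) ^ m with hB₂
  set B₃ := d * (2 * (2 + c₁) * ((d + 1) * μ) * 4 + 1) with hB₃
  have hB₁0 : 0 ≤ B₁ := by positivity
  have hB₂0 : 0 ≤ B₂ := by positivity
  have hB₃0 : 0 ≤ B₃ := by positivity
  refine ⟨B₁ + B₂ + B₃, p, fun G φbar hG τ h hh hτ => ?_⟩
  have hτ0 : 0 < τ := hh.trans hτ
  set A := gradBall P G φbar τ with hA
  set Λ := logPlus (1 / h) ^ p with hΛ
  have hΛ1 : 1 ≤ Λ := Real.one_le_rpow (one_le_logPlus _) hp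
  set H := (h / τ) ^ (-m) with hH
  have hHeq : H = (τ / h) ^ m := by
    rw [hH, Real.rpow_neg (by positivity), ← Real.inv_rpow (by positivity), inv_div]
  have hτh : 1 ≤ τ / h := (one_le_div hh).2 hτ.le
  -- Here `1 ≤ m` lets the linear cost of the linear parts be absorbed.
  have hH1 : τ / h ≤ H := by
    rw [hHeq]
    calc τ / h = (τ / h) ^ (1 : ℝ) := (Real.rpow_one _).symm
      _ ≤ _ := Real.rpow_le_rpow_of_exponent_le hτh hm
  have hH0 : 0 ≤ H := by linarith
  have hΛH : 0 ≤ Λ * H := by positivity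
  refine Coded.l2Entropy_le hh (fun g hg => (hG g hg.1).memLp hβ ha hexp) ?_
  rcases isEmpty_or_nonempty A with hE | ⟨⟨g₀, hg₀⟩⟩
  · exact Coded.of_isEmpty
  have hreg : ∀ g : A, RegularConvex P β a α g.1 := fun g => hG _ g.2.1
  have hreg₀ : RegularConvex P β a α g₀ := hG _ hg₀.1
  set v : A → Euc d := fun g => grad g.1 0 - grad g₀ 0 with hv
  have hgrad : ∀ g : A, eLpNorm (fun x => grad g.1 x - grad g₀ x) 2 P ≤ ENNReal.ofReal (2 * τ) :=
    fun g => eLpNorm_sub_le_two hτ0.le (measurable_gradient _) (measurable_gradient _)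
      (measurable_gradient _) g.2.2 hg₀.2
  have hrem : ∀ g : A, ∀ z ∈ P.support, |realPart g.1 z - realPart g₀ z - inner ℝ (v g) z| ≤
      2 * β * (1 + ‖z‖) ^ (a + 2) := by
    intro g z hz
    have h1 := (hreg g).abs_sub_inner_le hβ ha ((hreg g).isPotential.support_subset hz)
    have h2 := hreg₀.abs_sub_inner_le hβ ha (hreg₀.isPotential.support_subset hz)
    have e : realPart g.1 z - realPart g₀ z - inner ℝ (v g) z =
        (realPart g.1 z - inner ℝ (grad g.1 0) z) - (realPart g₀ z - inner ℝ (grad g₀ 0) z) := by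
      rw [hv, inner_sub_left]; ring
    rw [e]
    refine (abs_sub _ _).trans ?_
    linarith
  have hgrem : ∀ g : A, ∀ z ∈ P.support, ‖grad g.1 z - grad g₀ z - v g‖ ≤
      2 * β * (1 + ‖z‖) ^ (a + 1) := by
    intro g z hz
    have h1 := (hreg g).norm_grad_sub_le' hβ ((hreg g).isPotential.support_subset hz)
    have h2 := hreg₀.norm_grad_sub_le' hβ (hreg₀.isPotential.support_subset hz)
    have e : grad g.1 z - grad g₀ z - v g =
        (grad g.1 z - grad g.1 0) - (grad g₀ z - grad g₀ 0) := by
      simp only [hv]; abel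
    rw [e]
    refine (norm_sub_le _ _).trans ?_
    linarith
  have hgremL : ∀ g : A, eLpNorm (fun z => grad g.1 z - grad g₀ z - v g) 2 P ≤
      ENNReal.ofReal c₁ := by
    intro g
    rw [← hc₁']
    refine eLpNorm_mono_ae_real ?_
    filter_upwards [Measure.support_mem_ae (μ := P)] with z hz
    exact hgrem g z hz
  -- `P` is a probability measure, so the norm of `v g` is the `L²` norm of a constant, which is the
  -- gradient difference minus its remainder.
  have hvb : ∀ g : A, ‖v g‖ ≤ 2 * τ + c₁ := by
    intro g
    have h1 : eLpNorm (fun _ : Euc d => v g) 2 P = ENNReal.ofReal ‖v g‖ := by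
      rw [eLpNorm_const _ (by norm_num) (IsProbabilityMeasure.ne_zero P)]
      simp
    have h2 : eLpNorm (fun _ : Euc d => v g) 2 P ≤
        ENNReal.ofReal (2 * τ) + ENNReal.ofReal c₁ := by
      have e : (fun _ : Euc d => v g) = (fun x => grad g.1 x - grad g₀ x) -
          fun z => grad g.1 z - grad g₀ z - v g := by
        ext1 z; simp
      rw [e]
      have hm1 : Measurable fun x => grad g.1 x - grad g₀ x :=
        (measurable_gradient _).sub (measurable_gradient _)
      exact (eLpNorm_sub_le hm1.aestronglyMeasurable
        (hm1.sub measurable_const).aestronglyMeasurable (by norm_num)).trans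
        (add_le_add (hgrad g) (hgremL g))
    rw [h1, ← ENNReal.ofReal_add (by positivity) hc₁0] at h2
    exact (ENNReal.ofReal_le_ofReal_iff (by positivity)).1 h2
  -- For `τ ≤ 1` the linear part is bounded by a constant and needs no separate treatment. For `τ >
  -- 1` it would make the growth constant depend on `τ` and cost a power of `log τ`, so it is coded
  -- apart.
  rcases le_or_gt τ 1 with hτ1 | hτ1
  · have hcoded := hcod (fun g : A => g.1) g₀ (fun _ => 0) M₁ (2 * τ) (h / 2) hM₁1 (by positivity)
      (by positivity) hreg hreg₀ (fun g z hz => by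
        rw [inner_zero_left, sub_zero]
        have h1 := hrem g z hz
        have h2 := abs_real_inner_le_norm (v g) z
        have h3 : |realPart g.1 z - realPart g₀ z| ≤
            |realPart g.1 z - realPart g₀ z - inner ℝ (v g) z| + |inner ℝ (v g) z| := by
          have := abs_add_le (realPart g.1 z - realPart g₀ z - inner ℝ (v g) z) (inner ℝ (v g) z)
          simpa using this
        have h4 : ‖z‖ ≤ (1 + ‖z‖) ^ (a + 2) := by
          calc ‖z‖ ≤ (1 + ‖z‖) ^ (1 : ℝ) := by rw [Real.rpow_one]; linarith
            _ ≤ _ := Real.rpow_le_rpow_of_exponent_le (by linarith [norm_nonneg z]) (by linarith)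
        have h5 : ‖v g‖ * ‖z‖ ≤ (2 + c₁) * (1 + ‖z‖) ^ (a + 2) := by
          gcongr
          linarith [hvb g]
        rw [hM₁]
        linarith) (fun g => by simpa using hgrad g)
    refine (hcoded.congr_sub fun x y => ?_).mono ?_
    · ext z
      simp
    · have h1 : logPlus (1 / (h / 2)) + Real.log M₁ ≤
          (1 + Real.log 2 + Real.log M₁) * logPlus (1 / h) := by
        have := logPlus_mul_le (c := 2) (by norm_num) hh
        have := one_le_logPlus (1 / h)
        nlinarith
      have h0 : 0 ≤ logPlus (1 / (h / 2)) + Real.log M₁ := by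
        linarith [one_le_logPlus (1 / (h / 2))]
      have hL0 : 0 ≤ logPlus (1 / h) := by linarith [one_le_logPlus (1 / h)]
      have h2 := max_one_div_rpow_le (m := m) (c := 4) (by linarith) (by norm_num) hh hτ
        (t := 2 * τ / (h / 2)) (by rw [div_div_eq_mul_div]; apply le_of_eq; ring)
      calc C * (logPlus (1 / (h / 2)) + Real.log M₁) ^ p * max 1 (2 * τ / (h / 2)) ^ m
          ≤ C * ((1 + Real.log 2 + Real.log M₁) * logPlus (1 / h)) ^ p * (4 ^ m * H) := by gcongr
        _ = B₁ * (Λ * H) := by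
          rw [Real.mul_rpow (by positivity) hL0, hB₁]; ring
        _ ≤ (B₁ + B₂ + B₃) * (Λ * H) := mul_le_mul_of_nonneg_right (by linarith) hΛH
        _ = (B₁ + B₂ + B₃) * Λ * H := (mul_assoc _ _ _).symm
  -- The remainder has energy `c₁` independent of `τ`; it and the linear part each receive precision
  -- `h / 4`.
  · have hcoded := hcod (fun g : A => g.1) g₀ v M₂ c₁ (h / 4) hM₂1 hc₁0
      (by positivity) hreg hreg₀ (fun g z hz => (hrem g z hz).trans (by
        gcongr
        linarith)) hgremL
    have hlin := coded_linear (P := P) (V := 2 * τ + c₁) (by positivity) hμ0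
      (show 0 < h / 4 by positivity) hvb hPμ
    have hadd := hcoded.add hlin (by positivity) (by positivity)
      (fun g => ((hreg g).aestronglyMeasurable.sub hreg₀.aestronglyMeasurable).sub
        (by fun_prop : Continuous fun z : Euc d => inner ℝ (v g) z).aestronglyMeasurable)
      (fun g => (by fun_prop : Continuous fun z : Euc d => inner ℝ (v g) z).aestronglyMeasurable)
    rw [show h / 4 + h / 4 = h / 2 by ring] at hadd
    refine (hadd.congr_sub fun x y => ?_).mono ?_
    · ext z
      simp
    · have h1 : logPlus (1 / (h / 4)) + Real.log M₂ ≤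
          (1 + Real.log 4 + Real.log M₂) * logPlus (1 / h) := by
        have := logPlus_mul_le (c := 4) (by norm_num) hh
        have := one_le_logPlus (1 / h)
        nlinarith
      have h0 : 0 ≤ logPlus (1 / (h / 4)) + Real.log M₂ := by
        linarith [one_le_logPlus (1 / (h / 4))]
      have hL0 : 0 ≤ logPlus (1 / h) := by linarith [one_le_logPlus (1 / h)]
      have h2 := max_one_div_rpow_le (m := m) (c := 1 + 4 * c₁) (by linarith) (by linarith) hh hτ
        (t := c₁ / (h / 4)) (by
          have e : c₁ / (h / 4) = 4 * c₁ * (1 / h) := by field_simp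
          have e2 : 1 / h ≤ τ / h := by gcongr
          rw [e]
          have : 4 * c₁ * (1 / h) ≤ 4 * c₁ * (τ / h) := by gcongr
          linarith)
      have h3 : C * (logPlus (1 / (h / 4)) + Real.log M₂) ^ p * max 1 (c₁ / (h / 4)) ^ m ≤
          B₂ * (Λ * H) := by
        calc C * (logPlus (1 / (h / 4)) + Real.log M₂) ^ p * max 1 (c₁ / (h / 4)) ^ m
            ≤ C * ((1 + Real.log 4 + Real.log M₂) * logPlus (1 / h)) ^ p *
              ((1 + 4 * c₁) ^ m * H) := by gcongr
          _ = B₂ * (Λ * H) := by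
            rw [Real.mul_rpow (by positivity) hL0, hB₂]; ring
      have h4 : (d : ℝ) * (2 * (2 * τ + c₁) * ((d + 1) * μ) / (h / 4) + 1) ≤ B₃ * (Λ * H) := by
        calc (d : ℝ) * (2 * (2 * τ + c₁) * ((d + 1) * μ) / (h / 4) + 1)
            ≤ B₃ * (τ / h) := linear_count_le hc₁0 hμ0.le hh hτ1.le hτh
          _ ≤ B₃ * (Λ * H) := mul_le_mul_of_nonneg_left
            (hH1.trans (le_mul_of_one_le_left hH0 hΛ1)) hB₃0
      have h5 : 0 ≤ B₁ * (Λ * H) := by positivity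
      rw [mul_assoc]
      linarith

/-! ### Entropy of balls of conjugates -/

lemma Coded.map {d : ℕ} {P : Measure (Euc d)} {X : Type} {T : Euc d → Euc d} (hT : Measurable T)
    {u : X → Euc d → ℝ} (hu : ∀ x, Continuous (u x)) {h n : ℝ}
    (hc : Coded P (fun x z => u x (T z)) h n) : Coded (P.map T) u h n := by
  obtain ⟨ι, hι, code, hc, hd⟩ := hc
  refine ⟨ι, hι, code, hc, fun x y hxy => ?_⟩
  rw [eLpNorm_map_measure ((hu x).sub (hu y)).aestronglyMeasurable hT.aemeasurable]
  exact hd x y hxy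

/-- The local Poincaré inequality for compositions with the gradient of a smooth convex
potential. -/
lemma LocalPoincare.exists_comp_grad {d : ℕ} {P : Measure (Euc d)} [IsProbabilityMeasure P]
    (hLP : LocalPoincare P) {β a : ℝ} (hβ : 0 ≤ β) (ha : 0 ≤ a) {φ₀ : Euc d → EReal}
    (hφ₀ : IsPotential P φ₀) (hφ₀c : Convex ℝ (edom φ₀)) (hφ₀s : Smooth β a φ₀) :
    ∃ (K : ℝ≥0) (θ κ : ℝ), 0 ≤ θ ∧ 0 < κ ∧ ∀ (f : Euc d → ℝ) (v : Euc d → Euc d),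
      (∀ y, HasGradientAt f (v y) y) → Continuous v →
      ∀ R r : ℝ, 0 < R → 0 < r → r ≤ 1 → r ≤ κ * (1 + R) ^ (-θ) →
        ∀ z ∈ P.support ∩ Metric.ball 0 R,
        evariance (fun x => f (grad φ₀ x)) (ProbabilityTheory.cond P (Metric.ball z r)) ≤
          K * ENNReal.ofReal (r ^ 2 * (1 + R) ^ (2 * a)) *
            ∫⁻ y, ‖v (grad φ₀ y)‖ₑ ^ 2 ∂(ProbabilityTheory.cond P (Metric.ball z r)) := by
  obtain ⟨K, θ, κ, hθ, hκ, hloc⟩ := hLP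
  set e : ℝ≥0 := lipschitzExtensionConstant (Euc d)
  -- On the ball of radius `R + 1` the Lipschitz constant is `β (2 + R) ^ a ≤ b (1 + R) ^ a`.
  set b : ℝ≥0 := (β * 2 ^ a).toNNReal with hb
  have hb' : (b : ℝ) = β * 2 ^ a := Real.coe_toNNReal _ (by positivity)
  refine ⟨K * (e * b) ^ 2, θ, κ, hθ, hκ, fun f v hf hv R r hR hr hr1 hrκ z hz => ?_⟩
  set c : ℝ≥0 := ((1 + R) ^ a).toNNReal with hc
  have hc' : (c : ℝ) = (1 + R) ^ a := Real.coe_toNNReal _ (by positivity)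
  have hPz : P (Metric.ball z r) ≠ 0 :=
    ((Measure.mem_support_iff_forall z).1 hz.1 _ (Metric.ball_mem_nhds z hr)).ne'
  set q := ProbabilityTheory.cond P (Metric.ball z r) with hq
  have : IsProbabilityMeasure q := ProbabilityTheory.cond_isProbabilityMeasure hPz
  have hball : ∀ᵐ x ∂q, x ∈ Metric.ball z r :=
    ProbabilityTheory.ae_cond_mem Metric.isOpen_ball.measurableSet
  have hsupp : ∀ᵐ x ∂q, x ∈ P.support :=
    ProbabilityTheory.cond_absolutelyContinuous.ae_le Measure.support_mem_ae
  have hlip : LipschitzOnWith (b * c) (grad φ₀) (edom φ₀ ∩ Metric.closedBall 0 (R + 1)) := by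
    refine LipschitzOnWith.of_dist_le_mul fun x hx y hy => ?_
    rw [dist_eq_norm, dist_eq_norm]
    refine (hφ₀s.norm_grad_sub_le hβ ha (hφ₀c.inter (convex_closedBall _ _)) inter_subset_left
      (R := R + 1) (fun w hw => by simpa using hw.2) hx hy).trans ?_
    gcongr
    rw [NNReal.coe_mul, hb', hc', mul_assoc, ← Real.mul_rpow (by norm_num) (by positivity)]
    gcongr
    linarith
  -- The gradient is only controlled on part of its domain; a global Lipschitz extension agrees with
  -- it almost everywhere on the cell, at the cost of the factor `e`.
  obtain ⟨T, hT, hTeq⟩ := hlip.extend_finite_dimension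
  have hae : ∀ᵐ x ∂q, grad φ₀ x = T x := by
    filter_upwards [hball, hsupp] with x hx hx'
    refine hTeq ⟨hφ₀.support_subset hx', ?_⟩
    have h1 : ‖z‖ < R := by simpa using hz.2
    have h2 : ‖x - z‖ < r := by rwa [← dist_eq_norm]
    have h3 : ‖x‖ ≤ ‖x - z‖ + ‖z‖ := by simpa using norm_add_le (x - z) z
    rw [mem_closedBall_zero_iff]
    linarith
  have h1 : (fun x => f (grad φ₀ x)) =ᵐ[q] fun x => f (T x) := by
    filter_upwards [hae] with x hx
    rw [hx]
  have h2 : ∫⁻ y, ‖v (grad φ₀ y)‖ₑ ^ 2 ∂q = ∫⁻ y, ‖v (T y)‖ₑ ^ 2 ∂q := by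
    refine lintegral_congr_ae ?_
    filter_upwards [hae] with x hx
    rw [hx]
  rw [evariance_congr_ae h1, h2]
  refine (evariance_comp_le (by finiteness) (hloc R hR r hr hrκ z hz) hball hT hf hv).trans_eq ?_
  rw [← mul_assoc]
  congr 1
  have e1 : ENNReal.ofReal (r ^ 2 * (1 + R) ^ (2 * a)) = ENNReal.ofReal (r ^ 2) * (c : ℝ≥0∞) ^ 2 := by
    rw [ENNReal.ofReal_mul (by positivity), mul_comm 2 a, Real.rpow_mul (by positivity), hc,
      ← ENNReal.ofReal, ← ENNReal.ofReal_pow (by positivity)]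
    simp
  rw [e1]
  push_cast
  ring

section Dual

variable {d : ℕ} {P : Measure (Euc d)} {β a α : ℝ} {φ₀ : Euc d → EReal}

lemma norm_grad_le_rpow (hβ : 0 ≤ β) (ha : 0 ≤ a) (hφ₀ : IsPotential P φ₀)
    (hφ₀c : Convex ℝ (edom φ₀)) (hφ₀s : Smooth β a φ₀) {x : Euc d} (hx : x ∈ P.support) :
    ‖grad φ₀ x‖ ≤ (‖grad φ₀ 0‖ + β) * (1 + ‖x‖) ^ (a + 1) := by
  have h1 := hφ₀s.norm_grad_sub_grad_zero_le hβ ha hφ₀c subset_rfl hφ₀.zero_mem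
    (hφ₀.support_subset hx)
  have h2 : ‖grad φ₀ x‖ ≤ ‖grad φ₀ x - grad φ₀ 0‖ + ‖grad φ₀ 0‖ := by
    simpa using norm_add_le (grad φ₀ x - grad φ₀ 0) (grad φ₀ 0)
  have h3 : β * (1 + ‖x‖) ^ a * ‖x‖ ≤ β * (1 + ‖x‖) ^ (a + 1) := by
    rw [Real.rpow_add (by positivity), Real.rpow_one, mul_assoc]
    gcongr
    linarith
  have h4 : 1 ≤ (1 + ‖x‖) ^ (a + 1) :=
    Real.one_le_rpow (by linarith [norm_nonneg x]) (by linarith)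
  have h5 : ‖grad φ₀ 0‖ ≤ ‖grad φ₀ 0‖ * (1 + ‖x‖) ^ (a + 1) :=
    le_mul_of_one_le_right (norm_nonneg _) h4
  linarith

/-- Since `0 ≤ g*(y) ≤ ‖y - ∇g(0)‖² / (2α)`, the growth of the conjugate is governed by `grad g 0`
alone. -/
lemma RegularConvex.abs_conj_le (hα : 0 < α) {g : Euc d → EReal} (h : RegularConvex P β a α g)
    {W : ℝ} (hW : ‖grad g 0‖ ≤ W) {y : Euc d} {c t : ℝ} (ht : 1 ≤ t)
    (hy : ‖y‖ ≤ c * t) : |realPart (conj g) y| ≤ (c + W) ^ 2 / (2 * α) * t ^ 2 := by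
  obtain ⟨-, h0, h1⟩ := h.conj_spec hα y
  have hW0 : 0 ≤ W := (norm_nonneg _).trans hW
  have h2 : ‖y - grad g 0‖ ≤ (c + W) * t := by
    refine (norm_sub_le _ _).trans ?_
    nlinarith
  rw [abs_of_nonneg h0]
  refine h1.trans ?_
  rw [div_mul_eq_mul_div, ← mul_pow]
  gcongr

lemma RegularConvex.memLp_conj [IsProbabilityMeasure P] (hβ : 0 ≤ β) (ha : 0 ≤ a) (hα : 0 < α)
    (hexp : ∃ c : ℝ, 0 < c ∧ ∫⁻ x, ENNReal.ofReal (Real.exp (c * ‖x‖)) ∂P ≠ ⊤)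
    (hφ₀ : IsPotential P φ₀) (hφ₀c : Convex ℝ (edom φ₀)) (hφ₀s : Smooth β a φ₀)
    {g : Euc d → EReal} (h : RegularConvex P β a α g) :
    MemLp (realPart (conj g)) 2 (P.map (grad φ₀)) := by
  have hTm : Measurable (grad φ₀) := measurable_gradient _
  have hcont : Continuous (realPart (conj g)) :=
    continuous_iff_continuousAt.2 fun y => (h.hasGradientAt_conj hα y).continuousAt
  rw [memLp_map_measure_iff hcont.aestronglyMeasurable hTm.aemeasurable]
  refine memLp_of_abs_le hexp (M := ((‖grad φ₀ 0‖ + β) + ‖grad g 0‖) ^ 2 / (2 * α))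
    (k := (a + 1) * 2) (hcont.measurable.comp hTm).aestronglyMeasurable ?_
  filter_upwards [Measure.support_mem_ae (μ := P)] with x hx
  rw [Real.rpow_mul (by positivity), Real.rpow_two]
  exact h.abs_conj_le hα le_rfl
    (Real.one_le_rpow (by linarith [norm_nonneg x]) (by linarith))
    (norm_grad_le_rpow hβ ha hφ₀ hφ₀c hφ₀s hx)

/-- Bound on the minimizer of a regular convex function in terms of the `L²` norm of the gradient of
its conjugate. -/
lemma RegularConvex.norm_grad_conj_zero_le (hα : 0 < α) {Q : Measure (Euc d)}
    [IsProbabilityMeasure Q] {g : Euc d → EReal} (h : RegularConvex P β a α g) {ψ : Euc d → EReal}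
    {τ K : ℝ} (hτ : 0 ≤ τ) (hK : 0 ≤ K) (hid : eLpNorm (fun y : Euc d => y) 2 Q ≠ ⊤)
    (hψ : eLpNorm (grad ψ) 2 Q ≠ ⊤ → eLpNorm (grad ψ) 2 Q ≤ ENNReal.ofReal K)
    (hgψ : eLpNorm (fun y => grad (conj g) y - grad ψ y) 2 Q ≤ ENNReal.ofReal τ) :
    ‖grad (conj g) 0‖ ≤ τ + K + (eLpNorm (fun y : Euc d => y) 2 Q).toReal / α := by
  set X := grad (conj g) with hX
  have hXm : Measurable X := measurable_gradient _
  have hψm : Measurable (grad ψ) := measurable_gradient _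
  set μ := (eLpNorm (fun y : Euc d => y) 2 Q).toReal with hμ
  have hμ0 : 0 ≤ μ := ENNReal.toReal_nonneg
  have hdiff : eLpNorm (fun y => X y - X 0) 2 Q ≤ ENNReal.ofReal (μ / α) := by
    calc eLpNorm (fun y => X y - X 0) 2 Q
        ≤ ENNReal.ofReal (1 / α) * eLpNorm (fun y : Euc d => y) 2 Q := by
          refine eLpNorm_le_mul_eLpNorm_of_ae_le_mul (ae_of_all _ fun y => ?_) _
          refine (h.norm_grad_conj_sub_le hα y 0).trans_eq ?_
          rw [sub_zero]; ring
      _ = ENNReal.ofReal (1 / α) * ENNReal.ofReal μ := by rw [hμ, ENNReal.ofReal_toReal hid]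
      _ = _ := by
          rw [← ENNReal.ofReal_mul (by positivity)]
          congr 1
          ring
  have hconst : eLpNorm (fun _ : Euc d => X 0) 2 Q = ENNReal.ofReal ‖X 0‖ := by
    rw [eLpNorm_const _ (by norm_num) (IsProbabilityMeasure.ne_zero Q)]
    simp
  have hdm : AEStronglyMeasurable (fun y => X y - X 0) Q :=
    (hXm.sub measurable_const).aestronglyMeasurable
  have hgm : AEStronglyMeasurable (fun y => X y - grad ψ y) Q := (hXm.sub hψm).aestronglyMeasurable
  have hXfin : eLpNorm X 2 Q ≤ ENNReal.ofReal (μ / α) + ENNReal.ofReal ‖X 0‖ := by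
    have e : X = (fun y => X y - X 0) + fun _ => X 0 := by ext1 y; simp
    calc eLpNorm X 2 Q = eLpNorm ((fun y => X y - X 0) + fun _ => X 0) 2 Q := by rw [← e]
      _ ≤ _ := (eLpNorm_add_le hdm aestronglyMeasurable_const (by norm_num)).trans
          (add_le_add hdiff hconst.le)
  -- `X` is Lipschitz and `Q` has a second moment, so a centre at finite distance from `X` has
  -- finite norm: the infinite alternative cannot occur when the ball contains `conj g`.
  have hψfin : eLpNorm (grad ψ) 2 Q ≠ ⊤ := by
    have e : grad ψ = X - fun y => X y - grad ψ y := by ext1 y; simp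
    have h1 : eLpNorm (grad ψ) 2 Q ≤ eLpNorm X 2 Q + ENNReal.ofReal τ := by
      calc eLpNorm (grad ψ) 2 Q = eLpNorm (X - fun y => X y - grad ψ y) 2 Q := by rw [← e]
        _ ≤ _ := (eLpNorm_sub_le hXm.aestronglyMeasurable hgm (by norm_num)).trans (by gcongr)
    refine ne_top_of_le_ne_top ?_ (h1.trans (add_le_add_left hXfin _))
    finiteness
  have hψK := hψ hψfin
  have hfin : ENNReal.ofReal ‖X 0‖ ≤ ENNReal.ofReal (τ + K + μ / α) := by
    rw [← hconst, ENNReal.ofReal_add (by positivity) (by positivity), ENNReal.ofReal_add hτ hK]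
    have e : (fun _ : Euc d => X 0) = ((fun y => X y - grad ψ y) + grad ψ) -
        fun y => X y - X 0 := by ext1 y; simp
    rw [e]
    exact (eLpNorm_sub_le (hgm.add hψm.aestronglyMeasurable) hdm (by norm_num)).trans
      (add_le_add ((eLpNorm_add_le hgm hψm.aestronglyMeasurable (by norm_num)).trans
        (add_le_add hgψ hψK)) hdiff)
  exact (ENNReal.ofReal_le_ofReal_iff (by positivity)).1 hfin

lemma log_one_add_le_logPlus {τ : ℝ} (hτ : 0 < τ) : Real.log (1 + τ) ≤ 2 * logPlus τ := by
  have hl := one_le_logPlus τ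
  have h2 : Real.log 2 ≤ 1 := by linarith [Real.log_two_lt_d9]
  rcases le_or_gt τ 1 with h | h
  · have := Real.log_le_log (by linarith) (show 1 + τ ≤ 2 by linarith)
    linarith
  · have := Real.log_le_log (by linarith) (show 1 + τ ≤ 2 * τ by linarith)
    rw [Real.log_mul (by norm_num) hτ.ne'] at this
    linarith [log_le_logPlus τ]

set_option maxHeartbeats 1000000 in
/-- Entropy of localized balls of conjugates of strongly convex potentials. -/
lemma exists_l2Entropy_gradBall_conj_le [IsProbabilityMeasure P]
    (hP : Poincare P) (hLP : LocalPoincare P) {m : ℝ} (hm : 0 ≤ m) (hS : SupportGrowth P m)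
    (hβ : 0 ≤ β) (ha : 0 ≤ a) (hα : 0 < α)
    (hφ₀ : IsPotential P φ₀) (hφ₀c : Convex ℝ (edom φ₀)) (hφ₀s : Smooth β a φ₀) (K : ℝ) :
    ∃ C p : ℝ, ∀ (G : Set (Euc d → EReal)) (ψ : Euc d → EReal),
      (∀ g ∈ G, RegularConvex P β a α g) →
      (eLpNorm (grad ψ) 2 (P.map (grad φ₀)) ≠ ⊤ →
        eLpNorm (grad ψ) 2 (P.map (grad φ₀)) ≤ ENNReal.ofReal K) →
      (∀ g ∈ G, edom g = univ ∨ ‖grad g 0‖ ≤ K) →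
      ∀ τ h : ℝ, 0 < h → h < τ →
        l2Entropy (P.map (grad φ₀)) h (gradBall (P.map (grad φ₀)) (conj '' G) ψ τ) ≤
          ((C * logPlus (1 / h) ^ p * logPlus τ ^ p * (h / τ) ^ (-m) : ℝ) : EReal) := by
  have hexp := hP.exp_moment
  obtain ⟨KL, θ, κ, hθ, hκ, hloc⟩ := hLP.exists_comp_grad hβ ha hφ₀ hφ₀c hφ₀s
  obtain ⟨C, p, hC, hp, hcod⟩ := exists_coded_bound hexp hm hS KL hθ hκ
    (show 0 ≤ 2 * a by positivity) (show 0 ≤ (a + 1) * 2 by positivity)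
  have hTm : Measurable (grad φ₀) := measurable_gradient _
  have hTb : ∀ x ∈ P.support, ‖grad φ₀ x‖ ≤ (‖grad φ₀ 0‖ + β) * (1 + ‖x‖) ^ (a + 1) :=
    fun x hx => norm_grad_le_rpow hβ ha hφ₀ hφ₀c hφ₀s hx
  obtain ⟨T₀, hT₀⟩ : ∃ T₀, T₀ = ‖grad φ₀ 0‖ + β := ⟨_, rfl⟩
  have hT₀0 : 0 ≤ T₀ := by rw [hT₀]; positivity
  rw [← hT₀] at hTb
  set Q := P.map (grad φ₀) with hQ
  have : IsProbabilityMeasure Q := Measure.isProbabilityMeasure_map hTm.aemeasurable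
  have hid : eLpNorm (fun y : Euc d => y) 2 Q ≠ ⊤ := by
    rw [hQ, eLpNorm_map_measure (by fun_prop) hTm.aemeasurable]
    refine (memLp_of_abs_le hexp (M := T₀) (k := a + 1) hTm.aestronglyMeasurable ?_).2.ne
    filter_upwards [Measure.support_mem_ae (μ := P)] with x hx
    exact hTb x hx
  obtain ⟨μ, hμ⟩ : ∃ μ, μ = (eLpNorm (fun y : Euc d => y) 2 Q).toReal := ⟨_, rfl⟩
  have hμ0 : 0 ≤ μ := hμ ▸ ENNReal.toReal_nonneg
  obtain ⟨K', hK'⟩ : ∃ K', K' = max K 0 := ⟨_, rfl⟩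
  have hK'0 : 0 ≤ K' := hK' ▸ le_max_right _ _
  have hKK' : K ≤ K' := hK' ▸ le_max_left _ _
  obtain ⟨c, hc⟩ : ∃ c, c = T₀ + K' + β * (1 + K' + μ / α) ^ (a + 1) := ⟨_, rfl⟩
  have hc0 : 0 ≤ c := by rw [hc]; positivity
  obtain ⟨c', hc'⟩ : ∃ c', c' = 1 + c ^ 2 / α := ⟨_, rfl⟩
  have hc'1 : 1 ≤ c' := by
    have : 0 ≤ c ^ 2 / α := by positivity
    linarith
  have hlc' := Real.log_nonneg hc'1
  have hl2 : (0 : ℝ) ≤ Real.log 2 := Real.log_nonneg (by norm_num)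
  refine ⟨C * (1 + Real.log 2 + Real.log c' + (a + 1) * 2 * 2) ^ p * 4 ^ m, p,
    fun G ψ hG hψ hGK τ h hh hτ => ?_⟩
  have hτ0 : 0 < τ := hh.trans hτ
  set A := gradBall Q (conj '' G) ψ τ with hA
  have hmem : ∀ u ∈ A, ∃ g ∈ G, u = conj g := by
    rintro _ ⟨⟨g, hg, rfl⟩, -⟩
    exact ⟨g, hg, rfl⟩
  have hψ' : eLpNorm (grad ψ) 2 Q ≠ ⊤ → eLpNorm (grad ψ) 2 Q ≤ ENNReal.ofReal K' :=
    fun h => (hψ h).trans (ENNReal.ofReal_le_ofReal hKK')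
  refine Coded.l2Entropy_le hh (fun u hu => ?_) ?_
  · obtain ⟨g, hg, rfl⟩ := hmem u hu
    exact (hG g hg).memLp_conj hβ ha hα hexp hφ₀ hφ₀c hφ₀s
  rcases isEmpty_or_nonempty A with hE | ⟨⟨u₀, hu₀⟩⟩
  · exact Coded.of_isEmpty
  have hgrad : ∀ u ∈ A, ∀ y, HasGradientAt (realPart u) (grad u y) y := by
    intro u hu
    obtain ⟨g, hg, rfl⟩ := hmem u hu
    exact (hG g hg).hasGradientAt_conj hα
  have hgradc : ∀ u ∈ A, Continuous (grad u) := by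
    intro u hu
    obtain ⟨g, hg, rfl⟩ := hmem u hu
    exact (hG g hg).continuous_grad_conj hα
  have hcont : ∀ u ∈ A, Continuous (realPart u) := fun u hu =>
    continuous_iff_continuousAt.2 fun y => (hgrad u hu y).continuousAt
  -- Covers both alternatives for `grad g 0`: the direct bound `K`, or the bound through the
  -- minimizer when the domain is everything.
  set W := K' + β * (1 + (τ + K' + μ / α)) ^ (a + 1) with hW
  have hW0 : 0 ≤ W := by positivity
  have hbound : ∀ u ∈ A, ∀ x ∈ P.support,
      |realPart u (grad φ₀ x)| ≤ (T₀ + W) ^ 2 / (2 * α) * (1 + ‖x‖) ^ ((a + 1) * 2) := by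
    intro u hu x hx
    obtain ⟨g, hg, rfl⟩ := hmem u hu
    have hgW : ‖grad g 0‖ ≤ W := by
      rcases hGK g hg with hdom | hK
      · have h1 := (hG g hg).norm_grad_zero_le hα hdom
        have h2 := (hG g hg).norm_grad_conj_zero_le hα hτ0.le hK'0 hid hψ' hu.2
        rw [← hμ] at h2
        have h3 : β * (1 + ‖grad (conj g) 0‖) ^ a * ‖grad (conj g) 0‖ ≤
            β * (1 + ‖grad (conj g) 0‖) ^ (a + 1) := by
          rw [Real.rpow_add (by positivity), Real.rpow_one, mul_assoc]
          gcongr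
          linarith
        have h4 : β * (1 + ‖grad (conj g) 0‖) ^ (a + 1) ≤
            β * (1 + (τ + K' + μ / α)) ^ (a + 1) := by gcongr
        linarith
      · have : 0 ≤ β * (1 + (τ + K' + μ / α)) ^ (a + 1) := by positivity
        linarith
    rw [Real.rpow_mul (by positivity), Real.rpow_two]
    exact (hG g hg).abs_conj_le hα hgW
      (Real.one_le_rpow (by linarith [norm_nonneg x]) (by linarith)) (hTb x hx)
  -- A growth constant polynomial in `τ`, so that `log M` is at most a multiple of `log₊ τ`.
  set M := c' * (1 + τ) ^ ((a + 1) * 2) with hM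
  have hτa : 1 ≤ (1 + τ) ^ (a + 1) := Real.one_le_rpow (by linarith) (by linarith)
  have hτa2 : (1 + τ) ^ ((a + 1) * 2) = ((1 + τ) ^ (a + 1)) ^ 2 := by
    rw [Real.rpow_mul (by positivity), Real.rpow_two]
  have hM1 : 1 ≤ M := by
    rw [hM, hτa2]
    exact one_le_mul_of_one_le_of_one_le hc'1 (one_le_pow₀ hτa)
  have hTW : T₀ + W ≤ c * (1 + τ) ^ (a + 1) := by
    have hμα : 0 ≤ μ / α := by positivity
    have h1 : (1 + (τ + K' + μ / α)) ^ (a + 1) ≤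
        (1 + K' + μ / α) ^ (a + 1) * (1 + τ) ^ (a + 1) := by
      rw [← Real.mul_rpow (by positivity) (by positivity)]
      gcongr
      nlinarith
    have h2 : T₀ + K' ≤ (T₀ + K') * (1 + τ) ^ (a + 1) :=
      le_mul_of_one_le_right (by positivity) hτa
    have h3 : β * (1 + (τ + K' + μ / α)) ^ (a + 1) ≤
        β * ((1 + K' + μ / α) ^ (a + 1) * (1 + τ) ^ (a + 1)) := by gcongr
    rw [hW, hc]
    linarith
  have hMW : 2 * ((T₀ + W) ^ 2 / (2 * α)) ≤ M := by
    have h1 : (T₀ + W) ^ 2 ≤ (c * (1 + τ) ^ (a + 1)) ^ 2 := by gcongr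
    have e : 2 * ((T₀ + W) ^ 2 / (2 * α)) = (T₀ + W) ^ 2 / α := by field_simp
    rw [e, hM, hτa2]
    calc (T₀ + W) ^ 2 / α ≤ (c * (1 + τ) ^ (a + 1)) ^ 2 / α := by gcongr
      _ = c ^ 2 / α * ((1 + τ) ^ (a + 1)) ^ 2 := by ring
      _ ≤ c' * ((1 + τ) ^ (a + 1)) ^ 2 := by
        gcongr
        linarith
  have hlogM : Real.log M ≤ (Real.log c' + (a + 1) * 2 * 2) * logPlus τ := by
    have h1 := log_one_add_le_logPlus hτ0
    have h2 : Real.log c' ≤ Real.log c' * logPlus τ :=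
      le_mul_of_one_le_right hlc' (one_le_logPlus _)
    have h3 : (a + 1) * 2 * Real.log (1 + τ) ≤ (a + 1) * 2 * (2 * logPlus τ) := by gcongr
    rw [hM, Real.log_mul (by positivity) (by positivity), Real.log_rpow (by positivity)]
    linarith
  have hcoded := hcod (fun (u : A) x => realPart u.1 (grad φ₀ x) - realPart u₀ (grad φ₀ x))
    (fun u x => ‖grad u.1 (grad φ₀ x) - grad u₀ (grad φ₀ x)‖ₑ ^ 2) M (2 * τ) (h / 2) hM1
    (by positivity) (by positivity)
    (fun u => ((((hcont u.1 u.2).sub (hcont u₀ hu₀)).measurable).comp hTm).aestronglyMeasurable)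
    (fun u => ((((hgradc u.1 u.2).sub (hgradc u₀ hu₀)).measurable).comp hTm).enorm.pow_const 2)
    (fun u x hx => by
      have h1 := hbound u.1 u.2 x hx
      have h2 := hbound u₀ hu₀ x hx
      refine (abs_sub _ _).trans ?_
      calc |realPart u.1 (grad φ₀ x)| + |realPart u₀ (grad φ₀ x)|
          ≤ 2 * ((T₀ + W) ^ 2 / (2 * α)) * (1 + ‖x‖) ^ ((a + 1) * 2) := by linarith
        _ ≤ M * (1 + ‖x‖) ^ ((a + 1) * 2) := by gcongr)
    (fun u => by
      have h1 := lintegral_sq_le_of_eLpNorm_le (by positivity) (eLpNorm_sub_le_two hτ0.le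
        (measurable_gradient _) (measurable_gradient _) (measurable_gradient _) u.2.2 hu₀.2)
      have h2 : Measurable fun y => ‖grad u.1 y - grad u₀ y‖ₑ ^ 2 :=
        ((hgradc u.1 u.2).sub (hgradc u₀ hu₀)).measurable.enorm.pow_const 2
      -- The energy density is the squared gradient difference composed with `grad φ₀`, so its
      -- `P`-integral is the squared distance in `L²(Q)`.
      rw [← lintegral_map h2 hTm]
      exact h1)
    (fun u R r hR hr hr1 hrκ z hz => hloc (fun y => realPart u.1 y - realPart u₀ y)
      (fun y => grad u.1 y - grad u₀ y) (fun y => by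
        rw [hasGradientAt_iff_hasFDerivAt, map_sub]
        exact (hgrad u.1 u.2 y).hasFDerivAt.sub (hgrad u₀ hu₀ y).hasFDerivAt)
      ((hgradc u.1 u.2).sub (hgradc u₀ hu₀)) R r hR hr hr1 hrκ z hz)
  have hcoded' := hcoded.congr_sub (v := fun (u : A) x => realPart u.1 (grad φ₀ x))
    (fun x y => by ext z; simp)
  refine (Coded.map hTm (fun u : A => hcont u.1 u.2) hcoded').mono ?_
  have hL1 := one_le_logPlus (1 / h)
  have hL2 := one_le_logPlus τ
  set D := 1 + Real.log 2 + Real.log c' + (a + 1) * 2 * 2 with hD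
  have hD0 : 0 ≤ D := by positivity
  have h1 : logPlus (1 / (h / 2)) + Real.log M ≤ D * (logPlus (1 / h) * logPlus τ) := by
    have h2 := logPlus_mul_le (c := 2) (by norm_num) hh
    have h3 : logPlus (1 / h) ≤ logPlus (1 / h) * logPlus τ := by nlinarith
    have h4 : logPlus τ ≤ logPlus (1 / h) * logPlus τ := by nlinarith
    have h5 : (1 + Real.log 2) * logPlus (1 / h) ≤
        (1 + Real.log 2) * (logPlus (1 / h) * logPlus τ) := by gcongr
    have h6 : (Real.log c' + (a + 1) * 2 * 2) * logPlus τ ≤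
        (Real.log c' + (a + 1) * 2 * 2) * (logPlus (1 / h) * logPlus τ) := by gcongr
    rw [hD]
    linarith
  have h0 : 0 ≤ logPlus (1 / (h / 2)) + Real.log M := by
    linarith [one_le_logPlus (1 / (h / 2)), Real.log_nonneg hM1]
  have h2 := max_one_div_rpow_le (m := m) (c := 4) hm (by norm_num) hh hτ
    (t := 2 * τ / (h / 2)) (by rw [div_div_eq_mul_div]; apply le_of_eq; ring)
  calc C * (logPlus (1 / (h / 2)) + Real.log M) ^ p * max 1 (2 * τ / (h / 2)) ^ m
      ≤ C * (D * (logPlus (1 / h) * logPlus τ)) ^ p * (4 ^ m * (h / τ) ^ (-m)) := by gcongr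
    _ = C * D ^ p * 4 ^ m * logPlus (1 / h) ^ p * logPlus τ ^ p * (h / τ) ^ (-m) := by
      rw [Real.mul_rpow hD0 (by positivity), Real.mul_rpow (by positivity) (by positivity)]
      ring

end Dual

end Brenier

end

theorem lemma3p1 {d : ℕ} (P : Measure (Brenier.Euc d)) [IsProbabilityMeasure P]
    (hP : Brenier.Poincare P) (hLP : Brenier.LocalPoincare P) (hD : Brenier.LocalDoubling P)
    (m : ℝ) (hm : 2 ≤ m) (hS : Brenier.SupportGrowth P m)
    (β a : ℝ) (hβ : 0 ≤ β) (ha : 0 ≤ a)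
    (φ₀ : Brenier.Euc d → EReal) (hφ₀ : Brenier.IsPotential P φ₀)
    (hφ₀c : ConvexOn ℝ (Brenier.edom φ₀) (Brenier.realPart φ₀))
    (hφ₀s : Brenier.Smooth β a φ₀)
    (Q : Measure (Brenier.Euc d)) (hQ : Q = P.map (Brenier.grad φ₀))
    (α : ℝ) (hα : 0 < α) :
    (∃ C p q : ℝ, ∀ F : Set (Brenier.Euc d → EReal),
      (∀ φ ∈ F, Brenier.IsPotential P φ ∧ Brenier.Smooth β a φ) →
      ∀ φbar ∈ F, ∀ G ⊆ Brenier.segments F φbar, (∀ g ∈ G, Brenier.StrConvex α a g) →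
      ∀ τ h : ℝ, 0 < h → h < τ →
        Brenier.l2Entropy P h (Brenier.gradBall P G φbar τ) ≤
          ((C * Brenier.logPlus (1 / h) ^ p * Brenier.logPlus (1 / τ) ^ q
            * (h / τ) ^ (-m) : ℝ) : EReal)) ∧
    (∀ K : ℝ, ∃ C p q s : ℝ, ∀ F : Set (Brenier.Euc d → EReal),
      (∀ φ ∈ F, Brenier.IsPotential P φ ∧ Brenier.Smooth β a φ) →
      ∀ φbar ∈ F, ∀ G ⊆ Brenier.segments F φbar, (∀ g ∈ G, Brenier.StrConvex α a g) →
      (eLpNorm (Brenier.grad (Brenier.conj φbar)) 2 Q ≠ ⊤ →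
        eLpNorm (Brenier.grad (Brenier.conj φbar)) 2 Q ≤ ENNReal.ofReal K) →
      (∀ g ∈ G, Brenier.edom g = univ ∨ ‖Brenier.grad g 0‖ ≤ K) →
      ∀ τ h : ℝ, 0 < h → h < τ →
        Brenier.l2Entropy Q h
            (Brenier.gradBall Q (Brenier.conj '' G) (Brenier.conj φbar) τ) ≤
          ((C * Brenier.logPlus (1 / h) ^ p * Brenier.logPlus (1 / τ) ^ q
            * Brenier.logPlus τ ^ s * (h / τ) ^ (-m) : ℝ) : EReal)) := by
  subst hQ
  have hreg : ∀ F : Set (Brenier.Euc d → EReal),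
      (∀ φ ∈ F, Brenier.IsPotential P φ ∧ Brenier.Smooth β a φ) →
      ∀ φbar ∈ F, ∀ G ⊆ Brenier.segments F φbar, (∀ g ∈ G, Brenier.StrConvex α a g) →
      ∀ g ∈ G, Brenier.RegularConvex P β a α g :=
    fun F hF φbar hφbar G hG hGc g hg =>
      Brenier.regularConvex_of_mem_segments hβ ha hα hF hφbar (hG hg) (hGc g hg)
  constructor
  · obtain ⟨C, p, h⟩ := Brenier.exists_l2Entropy_gradBall_le (α := α) hP hLP
      (by linarith) hS hβ ha
    -- No power of `log₊(1/τ)` is needed, here or in the second part.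
    refine ⟨C, p, 0, fun F hF φbar hφbar G hG hGc τ r hr hτ => ?_⟩
    have := h G φbar (hreg F hF φbar hφbar G hG hGc) τ r hr hτ
    rwa [Real.rpow_zero, mul_one]
  · intro K
    obtain ⟨C, p, h⟩ := Brenier.exists_l2Entropy_gradBall_conj_le hP hLP
      (by linarith) hS hβ ha hα hφ₀ hφ₀c.1 hφ₀s K
    refine ⟨C, p, 0, p, fun F hF φbar hφbar G hG hGc hK hGK τ r hr hτ => ?_⟩
    have := h G _ (hreg F hF φbar hφbar G hG hGc) hK hGK τ r hr hτ
    rwa [Real.rpow_zero, mul_one]
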